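/- Let $G$ be a finite simple graph on $n$ vertices. Let $\nu(G)$ be the maximum size of a matching of $G$, let $\beta(G)$ be the minimum size of an inclusion-wise maximal matching of $G$, and let $\mu(G)=\nu(G)-\beta(G)$ be the matching gap of $G$. Let $D(G)$ be the set of vertices of $G$ left unsaturated by at least one maximum matching, and let $A(G)$ be the set of vertices outside $D(G)$ with at least one neighbour in $D(G)$. Let $\rho(G)$ be the maximum, over all $v\in A(G)$, of the number of connected components of $G[D(G)]$ that contain a neighbour of $v$, with the convention $\rho(G)=1$ if $A(G)=\emptyset$. The problem MatchingGap takes as input a graph $G$ and a non-negative integer $k$, and asks whether $\mu(G)\ge k$. **Theorem.** There is an XP algorithm for MatchingGap parameterized by $\mu(G)+\rho(G)$. More precisely, there are a single algorithm and a constant $c$ such that, on every input $(G,k)$, where $G$ is given by its adjacency matrix and neither $\mu(G)$ nor $\rho(G)$ is given, the algorithm correctly decides whether $\mu(G)\ge k$ in time at most $$\max\{n,2\}^{\,c\,(\mu(G)+\rho(G))^2},$$ that is, in time $n^{O((\mu(G)+\rho(G))^2)}$. Time is counted on a random access machine with unit-cost addition, truncated subtraction, comparison with zero and indirect memory access (and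 no multiplication). -/

import Mathlib

namespace MatchingGap

/-! ### Matchings, the matching gap, and the Gallai–Edmonds sets -/

section Graph

variable {V : Type*}

/-- The matching number `ν(G)`: the largest number of edges of a matching of `G`.
(A matching is a subgraph in which every vertex has exactly one neighbour, so that its vertex
set is the set of saturated vertices.) -/
noncomputable def matchingNumber (G : SimpleGraph V) : ℕ :=
  sSup {m : ℕ | ∃ M : G.Subgraph, M.IsMatching ∧ M.edgeSet.ncard = m}

/-- `M` is an inclusion-wise maximal matching of `G`. -/
def IsMaximalMatching {G : SimpleGraph V} (M : G.Subgraph) : Prop :=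
  Maximal (fun N : G.Subgraph => N.IsMatching) M

/-- `M` is a matching of `G` of the largest possible size. -/
def IsMaximumMatching {G : SimpleGraph V} (M : G.Subgraph) : Prop :=
  M.IsMatching ∧ M.edgeSet.ncard = matchingNumber G

/-- `β(G)`: the smallest number of edges of a maximal matching of `G`. -/
noncomputable def minMaximalMatchingNumber (G : SimpleGraph V) : ℕ :=
  sInf {m : ℕ | ∃ M : G.Subgraph, IsMaximalMatching M ∧ M.edgeSet.ncard = m}

/-- The matching gap `μ(G) = ν(G) - β(G)`. For finite graphs `β(G) ≤ ν(G)`, so the subtraction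
is never truncated. -/
noncomputable def matchingGap (G : SimpleGraph V) : ℕ :=
  matchingNumber G - minMaximalMatchingNumber G

/-- `D(G)`: the vertices left exposed by at least one maximum matching. -/
def setD (G : SimpleGraph V) : Set V :=
  {v | ∃ M : G.Subgraph, IsMaximumMatching M ∧ v ∉ M.verts}

/-- `A(G)`: the vertices outside `D(G)` with at least one neighbour in `D(G)`. -/
def setA (G : SimpleGraph V) : Set V :=
  {v | v ∉ setD G ∧ ∃ w ∈ setD G, G.Adj v w}

/-- The number of connected components of `G[D(G)]` that contain a neighbour of `v`. -/
noncomputable def numAdjacentComponents (G : SimpleGraph V) (v : V) : ℕ :=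
  {c : (G.induce (setD G)).ConnectedComponent |
    ∃ w : setD G, G.Adj v w ∧ (G.induce (setD G)).connectedComponentMk w = c}.ncard

open Classical in
/-- `ρ(G)`: the maximum, over the vertices of `A(G)`, of the number of components of `G[D(G)]`
adjacent to the vertex; by convention `1` if `A(G)` is empty. -/
noncomputable def rho (G : SimpleGraph V) : ℕ :=
  if setA G = ∅ then 1 else sSup (numAdjacentComponents G '' setA G)

end Graph

/-! ### Random access machines

Programs with natural-number registers and finitely many unbounded arrays (each indexed by
natural numbers), with constants, addition, truncated subtraction, indirect array access and
structured control flow. Each node of an expression that is evaluated, each assignment and each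
test costs one unit. There is no multiplication, so this unit-cost model is polynomially
equivalent to Turing machines. -/

/-- The memory: register `x` holds `reg x`, cell `i` of array `a` holds `arr a i`. -/
structure Memory where
  reg : ℕ → ℕ
  arr : ℕ → ℕ → ℕ

/-- Expressions. -/
inductive Expr where
  | const (c : ℕ)
  | reg (x : ℕ)
  | arr (a : ℕ) (i : Expr)
  | add (e f : Expr)
  | sub (e f : Expr)

/-- The value of an expression. -/
def Expr.eval (s : Memory) : Expr → ℕ
  | .const c => c
  | .reg x => s.reg x
  | .arr a i => s.arr a (i.eval s)
  | .add e f => e.eval s + f.eval s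
  | .sub e f => e.eval s - f.eval s

/-- The cost of evaluating an expression: its number of nodes. -/
def Expr.cost : Expr → ℕ
  | .const _ => 1
  | .reg _ => 1
  | .arr _ i => i.cost + 1
  | .add e f => e.cost + f.cost + 1
  | .sub e f => e.cost + f.cost + 1

/-- Programs: do nothing, assign to a register, assign to an array cell, sequential composition,
conditional (a test succeeds if the expression is nonzero), and while loop. -/
inductive Program where
  | skip
  | setReg (x : ℕ) (e : Expr)
  | setArr (a : ℕ) (i e : Expr)
  | seq (p q : Program)
  | ite (e : Expr) (p q : Program)
  | loop (e : Expr) (p : Program)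

/-- The memory after assigning `v` to register `x`. -/
def Memory.setReg (s : Memory) (x v : ℕ) : Memory :=
  { s with reg := Function.update s.reg x v }

/-- The memory after assigning `v` to cell `i` of array `a`. -/
def Memory.setArr (s : Memory) (a i v : ℕ) : Memory :=
  { s with arr := Function.update s.arr a (Function.update (s.arr a) i v) }

/-- `Runs p s s' t`: started in memory `s`, program `p` halts in memory `s'` after exactly `t`
units of time. -/
inductive Runs : Program → Memory → Memory → ℕ → Prop where
  | skip (s : Memory) : Runs .skip s s 1
  | setReg (x : ℕ) (e : Expr) (s : Memory) :
      Runs (.setReg x e) s (s.setReg x (e.eval s)) (e.cost + 1)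
  | setArr (a : ℕ) (i e : Expr) (s : Memory) :
      Runs (.setArr a i e) s (s.setArr a (i.eval s) (e.eval s)) (i.cost + e.cost + 1)
  | seq {p q : Program} {s s' s'' : Memory} {t t' : ℕ} :
      Runs p s s' t → Runs q s' s'' t' → Runs (.seq p q) s s'' (t + t')
  | ite_true {e : Expr} {p q : Program} {s s' : Memory} {t : ℕ} :
      e.eval s ≠ 0 → Runs p s s' t → Runs (.ite e p q) s s' (e.cost + 1 + t)
  | ite_false {e : Expr} {p q : Program} {s s' : Memory} {t : ℕ} :
      e.eval s = 0 → Runs q s s' t → Runs (.ite e p q) s s' (e.cost + 1 + t)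
  | loop_done {e : Expr} {p : Program} {s : Memory} :
      e.eval s = 0 → Runs (.loop e p) s s (e.cost + 1)
  | loop_step {e : Expr} {p : Program} {s s' s'' : Memory} {t t' : ℕ} :
      e.eval s ≠ 0 → Runs p s s' t → Runs (.loop e p) s' s'' t' →
      Runs (.loop e p) s s'' (e.cost + 1 + t + t')

/-- Programs are deterministic: the final memory and the running time are unique. -/
theorem Runs.unique {p : Program} {s s₁ s₂ : Memory} {t₁ t₂ : ℕ}
    (h₁ : Runs p s s₁ t₁) (h₂ : Runs p s s₂ t₂) : s₁ = s₂ ∧ t₁ = t₂ := by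
  induction h₁ generalizing s₂ t₂ with
  | skip s => cases h₂; exact ⟨rfl, rfl⟩
  | setReg x e s => cases h₂; exact ⟨rfl, rfl⟩
  | setArr a i e s => cases h₂; exact ⟨rfl, rfl⟩
  | seq _ _ ih ih' =>
    cases h₂ with
    | seq h h' =>
      obtain ⟨rfl, rfl⟩ := ih h
      obtain ⟨rfl, rfl⟩ := ih' h'
      exact ⟨rfl, rfl⟩
  | ite_true he _ ih =>
    cases h₂ with
    | ite_true _ h => obtain ⟨rfl, rfl⟩ := ih h; exact ⟨rfl, rfl⟩
    | ite_false h0 _ => exact absurd h0 he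
  | ite_false he _ ih =>
    cases h₂ with
    | ite_true h0 _ => exact absurd he h0
    | ite_false _ h => obtain ⟨rfl, rfl⟩ := ih h; exact ⟨rfl, rfl⟩
  | loop_done he =>
    cases h₂ with
    | loop_done _ => exact ⟨rfl, rfl⟩
    | loop_step h0 _ _ => exact absurd he h0
  | loop_step he _ _ ih ih' =>
    cases h₂ with
    | loop_done h0 => exact absurd h0 he
    | loop_step _ h h' =>
      obtain ⟨rfl, rfl⟩ := ih h
      obtain ⟨rfl, rfl⟩ := ih' h'
      exact ⟨rfl, rfl⟩

open Classical in
/-- The input `(G, k)`, for a graph `G` on the vertices `0, …, n - 1`: register `0` holds `n`,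
register `1` holds `k`, array `0` holds the adjacency matrix of `G` row by row (cell `i * n + j`
is `1` if `i` and `j` are adjacent), and everything else is `0`. -/
noncomputable def inputMemory {n : ℕ} (G : SimpleGraph (Fin n)) (k : ℕ) : Memory where
  reg x := if x = 0 then n else if x = 1 then k else 0
  arr a m := if a = 0 ∧ ∃ i j : Fin n, m = i * n + j ∧ G.Adj i j then 1 else 0

/-- On input `(G, k)`, program `p` halts after exactly `t` units of time and correctly reports
in register `0` whether the matching gap of `G` is at least `k` (`1` for yes, `0` for no). -/
def DecidesMatchingGapIn (p : Program) {n : ℕ} (G : SimpleGraph (Fin n)) (k t : ℕ) : Prop :=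
  ∃ s : Memory, Runs p (inputMemory G k) s t ∧
    (k ≤ matchingGap G → s.reg 0 = 1) ∧ (¬ k ≤ matchingGap G → s.reg 0 = 0)

end MatchingGap

/-! ### Mate functions, deficiency, and Tutte's theorem in terms of labels -/

namespace MatchingGap
open Finset

/-! The algorithm rests on short certificates for a large gap. Let d be the deficiency, that is, the
number of vertices that a maximum matching leaves unsaturated. A gap of at least j means that some
maximal matching leaves at least d + 2j vertices unsaturated (`le_matchingGap_iff`). A certificate
is a pair (S, T) of vertex sets: delete the edges at S and cut the edges between T and its
complement. It is required that (a) every matching of this restricted graph leaves at least d + 2j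
vertices unsaturated, and (b) some matching of it leaves unsaturated only vertices outside T without
neighbours in S. Condition (b) asks for a perfect matching in two copies of the restricted graph in
which each permitted vertex is joined to its copy (`doubleRel`).

A certificate suffices: extend the matching of (b) to a maximal one of the restricted graph. An edge
of G between two unsaturated vertices would have survived the restriction, so the matching is
maximal in G, and (a) bounds its size (`exists_maximalMate_of_certificate`). Conversely, let g be a
maximal matching with exactly d + 2j unsaturated vertices; one exists because the sizes of maximal
matchings form an interval (`exists_maximalMate_card_eq`). Compare g with a Tutte–Berge barrier B.
Most odd classes outside B are good: they have exactly one base, a vertex that is unsaturated or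
matched into B. Let S be the unsaturated vertices outside the good classes and let T consist of the
saturated vertices of B not matched into good classes together with their mates. Counting bases
gives |S| + |T| ≤ 8j, and the good classes alone force (a) (`exists_certificate`).

Both conditions concern deficiencies, which are computable in polynomial time. Trying all vectors of
8j digits for j = 1, 2, ..., up to k or to the first j without a certificate, takes time n^{O(μ+1)},
and ρ ≥ 1 puts this below the required bound.

Maximum matchings are found without contracting blossoms. A label-propagating search decides whether
a given matching is maximum: its rules are sound for every barrier, so an inconsistency at an
unsaturated vertex refutes the existence of a barrier (`Search.le_of_optimal`), while a completed
consistent search supplies one (`Search.optimal`). If the matching is not maximum, edges outside it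
are deleted as long as it stays non-maximum. Afterwards every larger matching that is maximum in the
rest contains all remaining edges outside the old one, so it can be read off locally
(`IsShrunk.exists_better`, `isMate_rematch`). -/

/-- `g` is the mate function of a matching of `R`; unsaturated vertices are their own mates. -/
def IsMate (R : ℕ → ℕ → Prop) (g : ℕ → ℕ) : Prop :=
  (∀ v, g (g v) = v) ∧ ∀ v, g v ≠ v → R v (g v)

/-- The vertices below `N` that the matching `g` leaves unsaturated. -/
def exposed (N : ℕ) (g : ℕ → ℕ) : Finset ℕ := (range N).filter fun v => g v = v

/-- `R` is the adjacency relation of a simple graph on the vertices below `N`. -/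
structure IsGraph (N : ℕ) (R : ℕ → ℕ → Prop) : Prop where
  symm : ∀ u v, R u v → R v u
  ne : ∀ u v, R u v → u ≠ v
  lt : ∀ u v, R u v → u < N

/-- The least number of vertices that a matching leaves unsaturated. -/
noncomputable def deficiency (N : ℕ) (R : ℕ → ℕ → Prop) : ℕ :=
  sInf {d | ∃ g, IsMate R g ∧ (exposed N g).card = d}

theorem IsMate.inv {R : ℕ → ℕ → Prop} {g : ℕ → ℕ} (h : IsMate R g) (v : ℕ) : g (g v) = v := h.1 v

theorem IsMate.adj {R : ℕ → ℕ → Prop} {g : ℕ → ℕ} (h : IsMate R g) {v : ℕ} (hv : g v ≠ v) :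
    R v (g v) := h.2 v hv

theorem IsMate.inj {R : ℕ → ℕ → Prop} {g : ℕ → ℕ} (h : IsMate R g) {u v : ℕ} (e : g u = g v) :
    u = v := by rw [← h.1 u, e, h.1 v]

theorem IsMate.mono {R R' : ℕ → ℕ → Prop} {g : ℕ → ℕ} (h : IsMate R g)
    (hR : ∀ u v, R u v → R' u v) : IsMate R' g :=
  ⟨h.1, fun v hv => hR _ _ (h.2 v hv)⟩

theorem isMate_id (R : ℕ → ℕ → Prop) : IsMate R id := ⟨fun _ => rfl, fun _ h => absurd rfl h⟩

theorem IsGraph.lt' {N : ℕ} {R : ℕ → ℕ → Prop} (hR : IsGraph N R) {u v : ℕ} (h : R u v) : v < N :=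
  hR.lt _ _ (hR.symm _ _ h)

theorem mem_exposed {N : ℕ} {g : ℕ → ℕ} {v : ℕ} : v ∈ exposed N g ↔ v < N ∧ g v = v := by
  simp [exposed]

theorem IsMate.lt {N : ℕ} {R : ℕ → ℕ → Prop} (hR : IsGraph N R) {g : ℕ → ℕ} (h : IsMate R g)
    {v : ℕ} (hv : v < N) : g v < N := by
  by_cases e : g v = v
  · rwa [e]
  · exact hR.lt' (h.adj e)

theorem deficiency_le {N : ℕ} {R : ℕ → ℕ → Prop} {g : ℕ → ℕ} (h : IsMate R g) :
    deficiency N R ≤ (exposed N g).card := Nat.sInf_le ⟨g, h, rfl⟩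

theorem exists_deficiency (N : ℕ) (R : ℕ → ℕ → Prop) :
    ∃ g, IsMate R g ∧ (exposed N g).card = deficiency N R :=
  Nat.sInf_mem (s := {d | ∃ g, IsMate R g ∧ (exposed N g).card = d}) ⟨_, id, isMate_id R, rfl⟩

theorem even_card_of_involution {g : ℕ → ℕ} (hg : ∀ v, g (g v) = v) {C : Finset ℕ}
    (h : ∀ x ∈ C, g x ≠ x ∧ g x ∈ C) : Even C.card := by
  have : (∑ _x ∈ C, (1 : ZMod 2)) = 0 :=
    Finset.sum_involution (fun x _ => g x) (fun x _ => by decide) (fun x hx _ => (h x hx).1)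
      (fun x hx => (h x hx).2) (fun x _ => hg x)
  rw [← ZMod.natCast_eq_zero_iff_even]
  simpa using this

/-- A vertex of an odd set is unsaturated or matched to the outside. -/
theorem exists_escape {g : ℕ → ℕ} (hg : ∀ v, g (g v) = v) {C : Finset ℕ} (hC : Odd C.card) :
    ∃ x ∈ C, g x = x ∨ g x ∉ C := by
  by_contra! h
  exact Nat.not_even_iff_odd.2 hC (even_card_of_involution hg h)

theorem card_exposed_mod_two {N : ℕ} {R : ℕ → ℕ → Prop} (hR : IsGraph N R) {g : ℕ → ℕ}
    (h : IsMate R g) : (exposed N g).card % 2 = N % 2 := by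
  have h1 : Even ((range N).filter fun v => ¬ g v = v).card := by
    apply even_card_of_involution h.1
    intro x hx
    simp only [mem_filter, mem_range] at hx ⊢
    exact ⟨hx.2, h.lt hR hx.1, fun e => hx.2 (h.inj e)⟩
  have h2 := Finset.card_filter_add_card_filter_not (s := range N) (fun v => g v = v)
  simp only [card_range] at h2
  unfold exposed
  obtain ⟨k, hk⟩ := h1
  omega

/-- The vertices outside `B` of label `c`. -/
def labelClass (N : ℕ) (B : Finset ℕ) (κ : ℕ → ℕ) (c : ℕ) : Finset ℕ :=
  (range N).filter fun v => v ∉ B ∧ κ v = c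

/-- The labels of odd classes. -/
def oddLabels (N : ℕ) (B : Finset ℕ) (κ : ℕ → ℕ) : Finset ℕ :=
  ((range N).image κ).filter fun c => Odd (labelClass N B κ c).card

theorem mem_labelClass {N : ℕ} {B : Finset ℕ} {κ : ℕ → ℕ} {c v : ℕ} :
    v ∈ labelClass N B κ c ↔ v < N ∧ v ∉ B ∧ κ v = c := by simp [labelClass]

theorem mem_oddLabels {N : ℕ} {B : Finset ℕ} {κ : ℕ → ℕ} {c : ℕ} :
    c ∈ oddLabels N B κ ↔ Odd (labelClass N B κ c).card := by
  simp only [oddLabels, mem_filter, mem_image, mem_range, and_iff_right_iff_imp]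
  intro h
  obtain ⟨v, hv⟩ := Finset.card_pos.1 h.pos
  rw [mem_labelClass] at hv
  exact ⟨v, hv.1, hv.2.2⟩

-- Tutte's theorem with each component of the graph minus the violator named by the number of a
-- representative vertex. Distinct components get distinct names, so each odd component contributes
-- its own odd label class.
open Classical in
theorem exists_tutte_labels {N : ℕ} {R : ℕ → ℕ → Prop} (hR : IsGraph N R)
    (h : ∀ g, IsMate R g → (exposed N g).card ≠ 0) :
    ∃ B ⊆ range N, ∃ κ : ℕ → ℕ, (∀ u v, R u v → u ∉ B → v ∉ B → κ u = κ v) ∧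
      B.card < (oddLabels N B κ).card := by
  let G : SimpleGraph (Fin N) :=
    { Adj := fun i j => R i j
      symm := ⟨fun i j h => hR.symm _ _ h⟩
      loopless := ⟨fun i h => hR.ne _ _ h rfl⟩ }
  have hno : ¬ ∃ M : G.Subgraph, M.IsPerfectMatching := by
    rintro ⟨M, hM⟩
    rw [SimpleGraph.Subgraph.isPerfectMatching_iff] at hM
    choose f hf hf' using hM
    have hff : ∀ i, f (f i) = i := fun i => (hf' _ _ (hf i).symm).symm
    refine h (fun v => if hv : v < N then f ⟨v, hv⟩ else v) ⟨fun v => ?_, fun v hv => ?_⟩ ?_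
    · by_cases hv : v < N <;> simp [hv, hff]
    · by_cases hvN : v < N
      · simp only [hvN, dite_true]
        exact (hf ⟨v, hvN⟩).adj_sub
      · simp [hvN] at hv
    · rw [Finset.card_eq_zero, Finset.eq_empty_iff_forall_notMem]
      intro v hv
      obtain ⟨hvN, e⟩ := mem_exposed.1 hv
      simp only [hvN, dite_true] at e
      have := (hf ⟨v, hvN⟩).ne
      exact this (Fin.ext e.symm)
  rw [SimpleGraph.tutte] at hno
  push Not at hno
  obtain ⟨u, hu⟩ := hno
  unfold SimpleGraph.IsTutteViolator at hu
  set H := ((⊤ : G.Subgraph).deleteVerts u).coe with hH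
  have hmem : ∀ i : Fin N, i ∉ u → i ∈ ((⊤ : G.Subgraph).deleteVerts u).verts := by
    intro i hi; simpa using hi
  let mk : ∀ i : Fin N, i ∉ u → H.ConnectedComponent :=
    fun i hi => H.connectedComponentMk ⟨i, hmem i hi⟩
  let rep : H.ConnectedComponent → ℕ := fun c => (c.out.1 : Fin N)
  have hrep : Function.Injective rep := by
    intro c c' e
    have : c.out = c'.out := Subtype.ext (Fin.ext e)
    rw [← Quot.out_eq c, ← Quot.out_eq c']
    exact congrArg _ this
  let κ : ℕ → ℕ := fun v => if hv : ∃ hN : v < N, (⟨v, hN⟩ : Fin N) ∉ u then rep (mk ⟨v, hv.1⟩ hv.2)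
    else 0
  have hκ : ∀ (i : Fin N) (hi : i ∉ u), κ i = rep (mk i hi) := by
    intro i hi
    have : ∃ hN : (i : ℕ) < N, (⟨i, hN⟩ : Fin N) ∉ u := ⟨i.2, hi⟩
    simp only [κ, this, dite_true]
  let B : Finset ℕ := (univ.filter fun i : Fin N => i ∈ u).map Fin.valEmbedding
  have hB : ∀ i : Fin N, (i : ℕ) ∈ B ↔ i ∈ u := by
    intro i; simp [B, ← Fin.ext_iff]
  refine ⟨B, ?_, κ, ?_, ?_⟩
  · intro v hv
    simp only [B, Finset.mem_map] at hv
    obtain ⟨i, _, rfl⟩ := hv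
    simp
  · intro x y hxy hx hy
    have hxN := hR.lt _ _ hxy
    have hyN := hR.lt' hxy
    have hx' : (⟨x, hxN⟩ : Fin N) ∉ u := fun e => hx ((hB _).2 e)
    have hy' : (⟨y, hyN⟩ : Fin N) ∉ u := fun e => hy ((hB _).2 e)
    have e1 := hκ ⟨x, hxN⟩ hx'
    have e2 := hκ ⟨y, hyN⟩ hy'
    simp only at e1 e2
    rw [e1, e2]
    congr 1
    apply SimpleGraph.ConnectedComponent.sound
    apply SimpleGraph.Adj.reachable
    have : G.Adj ⟨x, hxN⟩ ⟨y, hyN⟩ := hxy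
    simpa [hH, hx', hy'] using this
  · have hBc : B.card = u.ncard := by
      rw [Set.ncard_eq_toFinset_card', Finset.card_map]
      congr 1; ext; simp
    rw [hBc]
    refine lt_of_lt_of_le hu ?_
    rw [← Set.ncard_coe_finset (oddLabels N B κ)]
    apply Set.ncard_le_ncard_of_injOn rep _ hrep.injOn (Finset.finite_toSet _)
    intro c hc
    simp only [SimpleGraph.oddComponents, Set.mem_ofPred_eq] at hc
    rw [Finset.mem_coe, mem_oddLabels]
    have : (labelClass N B κ (rep c)).card = c.supp.ncard := by
      rw [← Set.ncard_coe_finset]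
      symm
      apply Set.ncard_congr (fun x _ => ((x.1 : Fin N) : ℕ))
      · intro x hx
        have hxu : x.1 ∉ u := by have := x.2; simpa using this
        rw [Finset.mem_coe, mem_labelClass]
        refine ⟨x.1.2, fun e => hxu ((hB _).1 e), ?_⟩
        rw [hκ _ hxu]
        exact congrArg rep hx
      · intro x y _ _ e
        exact Subtype.ext (Fin.ext e)
      · intro v hv
        rw [Finset.mem_coe, mem_labelClass] at hv
        have hvu : (⟨v, hv.1⟩ : Fin N) ∉ u := fun e => hv.2.1 ((hB ⟨v, hv.1⟩).2 e)
        refine ⟨⟨⟨v, hv.1⟩, hmem _ hvu⟩, ?_, rfl⟩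
        have e := hκ ⟨v, hv.1⟩ hvu
        simp only at e
        exact hrep (e.symm.trans hv.2.2)
    rwa [this]

end MatchingGap

/-! ### The Tutte–Berge formula -/

namespace MatchingGap
open Finset

/-- Adding `k` vertices that are adjacent to all others. -/
def addUniversal (N k : ℕ) (R : ℕ → ℕ → Prop) (u v : ℕ) : Prop :=
  u ≠ v ∧ u < N + k ∧ v < N + k ∧ (N ≤ u ∨ N ≤ v ∨ R u v)

theorem IsGraph.addUniversal {N : ℕ} {R : ℕ → ℕ → Prop} (hR : IsGraph N R) (k : ℕ) :
    IsGraph (N + k) (addUniversal N k R) where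
  symm := fun _ _ ⟨h1, h2, h3, h4⟩ => ⟨h1.symm, h3, h2, by
    rcases h4 with h | h | h
    exacts [.inr (.inl h), .inl h, .inr (.inr (hR.symm _ _ h))]⟩
  ne := fun _ _ h => h.1
  lt := fun _ _ h => h.2.1

-- Restrict a perfect matching to the old vertices. Those that lose their mate were matched
-- injectively to the `k` new vertices.
open Classical in
theorem deficiency_le_of_addUniversal {N k : ℕ} {R : ℕ → ℕ → Prop} (hR : IsGraph N R) {g : ℕ → ℕ}
    (hg : IsMate (addUniversal N k R) g) (h0 : (exposed (N + k) g).card = 0) :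
    deficiency N R ≤ k := by
  have hne : ∀ v < N + k, g v ≠ v := by
    intro v hv e
    rw [Finset.card_eq_zero] at h0
    exact absurd (mem_exposed.2 ⟨hv, e⟩) (by simp [h0])
  have hmate : IsMate R fun v => if v < N ∧ g v < N then g v else v := by
    refine ⟨fun v => ?_, fun v hv => ?_⟩
    · by_cases h : v < N ∧ g v < N
      · simp [h, hg.inv]
      · simp [h]
    · by_cases h : v < N ∧ g v < N
      · simp only [h, and_self, if_true] at hv ⊢
        obtain ⟨_, _, _, h1⟩ := hg.adj hv
        rcases h1 with h1 | h1 | h1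
        · omega
        · omega
        · exact h1
      · simp [h] at hv
  refine (deficiency_le hmate).trans ?_
  have : (exposed N fun v => if v < N ∧ g v < N then g v else v).card ≤ (Finset.Ico N (N + k)).card := by
    apply Finset.card_le_card_of_injOn g
    · intro v hv
      obtain ⟨hvN, e⟩ := mem_exposed.1 hv
      by_cases h : g v < N
      · simp only [hvN, h, and_self, if_true] at e
        exact absurd e (hne v (by omega))
      · have := hg.lt (hR.addUniversal k) (v := v) (by omega)
        simp only [coe_Ico, Set.mem_Ico]
        omega
    · intro u _ v _ e
      exact hg.inj e
  simpa using this

theorem card_eq_sum_labelClass {N : ℕ} {B : Finset ℕ} (hB : B ⊆ range N) (κ : ℕ → ℕ) :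
    N = B.card + ∑ c ∈ (range N).image κ, (labelClass N B κ c).card := by
  have h1 : ((range N).filter fun v => v ∉ B).card =
      ∑ c ∈ (range N).image κ, (((range N).filter fun v => v ∉ B).filter fun v => κ v = c).card := by
    apply Finset.card_eq_sum_card_fiberwise
    intro v hv
    simp only [coe_filter, mem_range, Set.mem_ofPred_eq] at hv
    simp only [coe_image, Set.mem_image, mem_coe, mem_range]
    exact ⟨v, hv.1, rfl⟩
  have h2 := Finset.card_filter_add_card_filter_not (s := range N) (fun v => v ∈ B)
  have h3 : (range N).filter (fun v => v ∈ B) = B := by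
    ext v; simp only [mem_filter, and_iff_right_iff_imp]; exact fun h => hB h
  rw [h3, card_range, h1] at h2
  refine h2.symm.trans ?_
  congr 1
  apply Finset.sum_congr rfl
  intro c _
  simp only [labelClass, filter_filter]

theorem card_oddLabels_mod_two {N : ℕ} {B : Finset ℕ} (hB : B ⊆ range N) (κ : ℕ → ℕ) :
    (B.card + (oddLabels N B κ).card) % 2 = N % 2 := by
  have h := card_eq_sum_labelClass hB κ
  have h2 := Finset.odd_sum_iff_odd_card_odd (s := (range N).image κ)
    (fun c => (labelClass N B κ c).card)
  change _ ↔ Odd (oddLabels N B κ).card at h2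
  rw [Nat.odd_iff, Nat.odd_iff] at h2
  omega

/-- The Tutte–Berge formula. -/
theorem exists_barrier {N : ℕ} {R : ℕ → ℕ → Prop} (hR : IsGraph N R) :
    ∃ B ⊆ range N, ∃ κ : ℕ → ℕ, (∀ u v, R u v → u ∉ B → v ∉ B → κ u = κ v) ∧
      B.card + deficiency N R ≤ (oddLabels N B κ).card := by
  obtain ⟨g, hg, hgd⟩ := exists_deficiency N R
  have hpar := card_exposed_mod_two hR hg
  rcases Nat.lt_or_ge (deficiency N R) 2 with hd | hd
  -- With deficiency at most 1, the empty set and a single class suffice: the class is odd exactly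
  -- when `N` is, and `N` has the parity of the deficiency.
  · refine ⟨∅, by simp, fun _ => 0, fun _ _ _ _ _ => rfl, ?_⟩
    have := card_oddLabels_mod_two (B := ∅) (N := N) (by simp) (fun _ => 0)
    simp only [card_empty] at this ⊢
    omega
  · obtain ⟨k, hk⟩ : ∃ k, deficiency N R = k + 2 := ⟨_, (Nat.sub_add_cancel hd).symm⟩
    obtain ⟨B, hB, κ, hκ, hlt⟩ := exists_tutte_labels (hR.addUniversal k) (fun g hg h0 => by
      have := deficiency_le_of_addUniversal hR hg h0
      omega)
    have hpar' := card_oddLabels_mod_two hB κ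
    -- A universal vertex outside `B` would merge all classes into one, forcing `B` empty and
    -- exactly one odd class. This contradicts parity, because `N + k` is even.
    by_cases hz : ∃ z, N ≤ z ∧ z < N + k ∧ z ∉ B
    · exfalso
      obtain ⟨z, hz1, hz2, hz3⟩ := hz
      have hc : ∀ v < N + k, v ∉ B → κ v = κ z := by
        intro v hv hvB
        by_cases e : v = z
        · rw [e]
        · exact hκ v z ⟨e, hv, hz2, .inr (.inl hz1)⟩ hvB hz3
      have h1 : oddLabels (N + k) B κ ⊆ {κ z} := by
        intro c hc'
        rw [mem_oddLabels] at hc'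
        obtain ⟨v, hv⟩ := Finset.card_pos.1 hc'.pos
        rw [mem_labelClass] at hv
        rw [mem_singleton, ← hv.2.2]
        exact hc v hv.1 hv.2.1
      have h2 := Finset.card_le_card h1
      simp only [card_singleton] at h2
      omega
    · push Not at hz
      have hclass : ∀ c, labelClass (N + k) B κ c = labelClass N (B.filter (· < N)) κ c := by
        intro c
        ext v
        rw [mem_labelClass, mem_labelClass, mem_filter]
        constructor
        · rintro ⟨h1, h2, h3⟩
          refine ⟨?_, fun h => h2 h.1, h3⟩
          by_contra h
          exact h2 (hz v (by omega) h1)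
        · rintro ⟨h1, h2, h3⟩
          exact ⟨by omega, fun h => h2 ⟨h, h1⟩, h3⟩
      have hodd : oddLabels (N + k) B κ = oddLabels N (B.filter (· < N)) κ := by
        ext c
        rw [mem_oddLabels, mem_oddLabels, hclass]
      have hcard : B.card = (B.filter (· < N)).card + k := by
        rw [← Finset.card_filter_add_card_filter_not (s := B) (· < N)]
        congr 1
        have : B.filter (fun v => ¬ v < N) = Finset.Ico N (N + k) := by
          ext v
          simp only [mem_filter, not_lt, mem_Ico]
          constructor
          · rintro ⟨h1, h2⟩
            exact ⟨h2, mem_range.1 (hB h1)⟩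
          · rintro ⟨h1, h2⟩
            exact ⟨hz v h1 h2, h1⟩
        rw [this]; simp
      refine ⟨B.filter (· < N), ?_, κ, ?_, ?_⟩
      · intro v hv
        simpa using (mem_filter.1 hv).2
      · intro u v huv hu hv
        have h1 := hR.lt _ _ huv
        have h2 := hR.lt' huv
        exact hκ u v ⟨hR.ne _ _ huv, by omega, by omega, .inr (.inr huv)⟩
          (fun h => hu (mem_filter.2 ⟨h, h1⟩)) (fun h => hv (mem_filter.2 ⟨h, h2⟩))
      -- By parity the strict inequality between `B` and the odd classes has slack at least 2.
      -- Removing the `k` universal vertices from `B` then leaves a surplus of `k + 2`, the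
      -- deficiency.
      · rw [← hodd]
        omega

end MatchingGap

/-! ### Barriers of maximum matchings and extension to maximal matchings -/

namespace MatchingGap
open Finset

/-- A base is unsaturated or matched into `B`, and in the second case `g` exchanges it with a vertex
of `B` whose mate lies outside `B`. This count yields both the tightness for maximum matchings and
the small slack for maximal ones. -/
theorem card_bases {N : ℕ} {R : ℕ → ℕ → Prop} (hR : IsGraph N R) {g : ℕ → ℕ} (hg : IsMate R g)
    {B : Finset ℕ} (hB : B ⊆ range N) (κ : ℕ → ℕ) (p : ℕ → Prop)
    [DecidablePred p] : ((range N).filter fun x => x ∉ B ∧ p (κ x) ∧ (g x = x ∨ g x ∈ B)).card =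
      ((exposed N g).filter fun x => x ∉ B ∧ p (κ x)).card +
        (B.filter fun b => g b ∉ B ∧ p (κ (g b))).card := by
  rw [← Finset.card_filter_add_card_filter_not (fun x => g x = x)]
  congr 1
  · congr 1
    ext x
    simp only [mem_filter, mem_range, mem_exposed]
    tauto
  · apply Finset.card_bij (fun x _ => g x)
    · intro x hx
      simp only [mem_filter, mem_range] at hx ⊢
      rw [hg.inv]
      tauto
    · intro x _ y _ e
      exact hg.inj e
    · intro b hb
      simp only [mem_filter, mem_range] at hb ⊢
      refine ⟨g b, ⟨⟨hg.lt hR (mem_range.1 (hB hb.1)), hb.2.1, hb.2.2, .inr ?_⟩, ?_⟩, hg.inv b⟩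
      · rw [hg.inv]; exact hb.1
      · rw [hg.inv]; intro e; exact hb.2.1 (e ▸ hb.1)

/-- An odd class cannot be matched within itself, and an edge leaving a class can only end in `B`.
-/
theorem exists_base {N : ℕ} {R : ℕ → ℕ → Prop} (hR : IsGraph N R) {g : ℕ → ℕ} (hg : IsMate R g)
    {B : Finset ℕ} {κ : ℕ → ℕ} (hκ : ∀ u v, R u v → u ∉ B → v ∉ B → κ u = κ v) {c : ℕ}
    (hc : c ∈ oddLabels N B κ) : ∃ x < N, x ∉ B ∧ κ x = c ∧ (g x = x ∨ g x ∈ B) := by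
  rw [mem_oddLabels] at hc
  obtain ⟨x, hx, h⟩ := exists_escape hg.1 hc
  rw [mem_labelClass] at hx
  refine ⟨x, hx.1, hx.2.1, hx.2.2, ?_⟩
  rcases h with h | h
  · exact .inl h
  · by_contra! h'
    apply h
    rw [mem_labelClass]
    exact ⟨hg.lt hR hx.1, h'.2, by rw [← hκ _ _ (hg.adj h'.1) hx.2.1 h'.2]; exact hx.2.2⟩

/-- The position of a maximum matching `f` relative to a Tutte–Berge barrier `B`: `D` holds on the
odd classes outside `B`, the classes are the fibres of `κ`, and each class has at most one vertex
that is unsaturated or matched to `B`. -/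
structure IsBarrier (N : ℕ) (R : ℕ → ℕ → Prop) (f : ℕ → ℕ) (B : Finset ℕ) (κ : ℕ → ℕ)
    (D : ℕ → Prop) : Prop where
  notMem : ∀ x, D x → x ∉ B
  adj : ∀ x y, D x → R x y → y ∈ B ∨ (D y ∧ κ x = κ y)
  exposed : ∀ v < N, f v = v → D v
  mate : ∀ b ∈ B, D (f b)
  base_unique : ∀ x y, D x → D y → κ x = κ y → (f x = x ∨ f x ∈ B) → (f y = y ∨ f y ∈ B) → x = y

theorem exists_isBarrier {N : ℕ} {R : ℕ → ℕ → Prop} (hR : IsGraph N R) {f : ℕ → ℕ}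
    (hf : IsMate R f) (hopt : (exposed N f).card = deficiency N R) :
    ∃ B κ D, IsBarrier N R f B κ D := by
  obtain ⟨B, hB, κ, hκ, hcard⟩ := exists_barrier hR
  have h1 := card_bases hR hf hB κ (· ∈ oddLabels N B κ)
  set bs := (range N).filter fun x => x ∉ B ∧ κ x ∈ oddLabels N B κ ∧ (f x = x ∨ f x ∈ B) with hbs
  have h2 : oddLabels N B κ ⊆ bs.image κ := by
    intro c hc
    obtain ⟨x, hx, h3, h4, h5⟩ := exists_base hR hf hκ hc
    rw [mem_image]
    exact ⟨x, by simp [hbs, hx, h3, h4, hc, h5], h4⟩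
  have h3 := Finset.card_le_card h2
  have h4 : (bs.image κ).card ≤ bs.card := Finset.card_image_le
  have h5 := Finset.card_filter_le (exposed N f) fun x => x ∉ B ∧ κ x ∈ oddLabels N B κ
  have h6 := Finset.card_filter_le B fun b => f b ∉ B ∧ κ (f b) ∈ oddLabels N B κ
  -- The chain |bs| ≤ deficiency + |B| ≤ number of odd labels ≤ |image of bs| ≤ |bs| closes up. So
  -- each class contains at most one base, all unsaturated vertices lie in odd classes, and `B` is
  -- matched into odd classes.
  have h7 : (bs.image κ).card = bs.card := by omega
  have h8 : ∀ x ∈ exposed N f, x ∉ B ∧ κ x ∈ oddLabels N B κ :=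
    Finset.card_filter_eq_iff.1 (by omega)
  have h9 : ∀ b ∈ B, f b ∉ B ∧ κ (f b) ∈ oddLabels N B κ :=
    Finset.card_filter_eq_iff.1 (by omega)
  rw [Finset.card_image_iff] at h7
  refine ⟨B, κ, fun x => x < N ∧ x ∉ B ∧ κ x ∈ oddLabels N B κ,
    ⟨fun x h => h.2.1, ?_, ?_, ?_, ?_⟩⟩
  · rintro x y ⟨hx1, hx2, hx3⟩ hxy
    by_cases hy : y ∈ B
    · exact .inl hy
    · have e := hκ _ _ hxy hx2 hy
      exact .inr ⟨⟨hR.lt' hxy, hy, e ▸ hx3⟩, e⟩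
  · intro v hv e
    exact ⟨hv, h8 v (mem_exposed.2 ⟨hv, e⟩)⟩
  · intro b hb
    exact ⟨hf.lt hR (mem_range.1 (hB hb)), h9 b hb⟩
  · rintro x y ⟨hx1, hx2, hx3⟩ ⟨hy1, hy2, hy3⟩ e bx bY
    apply h7 _ _ e
    · simp only [hbs, coe_filter, mem_range, Set.mem_ofPred_eq]
      exact ⟨hx1, hx2, hx3, bx⟩
    · simp only [hbs, coe_filter, mem_range, Set.mem_ofPred_eq]
      exact ⟨hy1, hy2, hy3, bY⟩

theorem exists_maximal_extension {N : ℕ} {R : ℕ → ℕ → Prop} (hR : IsGraph N R) {g : ℕ → ℕ}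
    (hg : IsMate R g) : ∃ g', IsMate R g' ∧ (∀ v, g v ≠ v → g' v = g v) ∧
      ∀ u v, g' u = u → g' v = v → ¬ R u v := by
  induction hm : (exposed N g).card using Nat.strong_induction_on generalizing g with
  | _ m ih =>
    by_cases h : ∀ u v, g u = u → g v = v → ¬ R u v
    · exact ⟨g, hg, fun _ _ => rfl, h⟩
    · push Not at h
      obtain ⟨u, v, hu, hv, huv⟩ := h
      have hne := hR.ne _ _ huv
      have hg' : IsMate R (fun x => if x = u then v else if x = v then u else g x) := by
        refine ⟨fun x => ?_, fun x hx => ?_⟩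
        · by_cases h1 : x = u
          · simp [h1, hne.symm]
          · by_cases h2 : x = v
            · simp [h2, hne.symm]
            · have h3 : g x ≠ u := fun e => h1 (by rw [← hg.inv x, e, hu])
              have h4 : g x ≠ v := fun e => h2 (by rw [← hg.inv x, e, hv])
              simp [h1, h2, h3, h4, hg.inv]
        · by_cases h1 : x = u
          · simpa [h1] using huv
          · by_cases h2 : x = v
            · simpa [h2, hne.symm] using hR.symm _ _ huv
            · simp only [h1, h2, if_false] at hx ⊢
              exact hg.adj hx
      obtain ⟨g', h1, h2, h3⟩ := ih _ (by
        rw [← hm]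
        apply Finset.card_lt_card
        rw [Finset.ssubset_iff_of_subset]
        · refine ⟨u, mem_exposed.2 ⟨hR.lt _ _ huv, hu⟩, ?_⟩
          rw [mem_exposed]; simp [hne.symm]
        · intro x hx
          rw [mem_exposed] at hx ⊢
          refine ⟨hx.1, ?_⟩
          by_cases h1 : x = u
          · rw [h1, hu]
          · by_cases h2 : x = v
            · rw [h2, hv]
            · simpa [h1, h2] using hx.2) hg' rfl
      refine ⟨g', h1, fun x hx => ?_, h3⟩
      have hxu : x ≠ u := fun e => hx (by rw [e, hu])
      have hxv : x ≠ v := fun e => hx (by rw [e, hv])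
      rw [h2 x (by simpa [hxu, hxv] using hx)]
      simp [hxu, hxv]

theorem card_exposed_add {N : ℕ} {R : ℕ → ℕ → Prop} (hR : IsGraph N R) (k : ℕ) {g : ℕ → ℕ}
    (hg : IsMate R g) : (exposed (N + k) g).card = (exposed N g).card + k := by
  rw [← Finset.card_filter_add_card_filter_not (s := exposed (N + k) g) (· < N)]
  congr 1
  · congr 1
    ext x
    simp only [mem_filter, mem_exposed]
    constructor
    · rintro ⟨⟨_, h1⟩, h2⟩; exact ⟨h2, h1⟩
    · rintro ⟨h1, h2⟩; exact ⟨⟨by omega, h2⟩, h1⟩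
  · have : (exposed (N + k) g).filter (fun x => ¬ x < N) = Finset.Ico N (N + k) := by
      ext x
      simp only [mem_filter, mem_exposed, mem_Ico, not_lt]
      constructor
      · rintro ⟨⟨h1, _⟩, h2⟩; exact ⟨h2, h1⟩
      · rintro ⟨h1, h2⟩
        refine ⟨⟨h2, ?_⟩, h1⟩
        by_contra h
        have := hR.lt _ _ (hg.adj h)
        omega
    rw [this]; simp

/-- The additional vertices are isolated. This lets the program store a graph on `n` vertices within
the `2n` vertices of the doubled graph. -/
theorem deficiency_add {N : ℕ} {R : ℕ → ℕ → Prop} (hR : IsGraph N R) (k : ℕ) :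
    deficiency (N + k) R = deficiency N R + k := by
  apply le_antisymm
  · obtain ⟨g, hg, e⟩ := exists_deficiency N R
    rw [← e, ← card_exposed_add hR k hg]
    exact deficiency_le hg
  · obtain ⟨g, hg, e⟩ := exists_deficiency (N + k) R
    rw [← e, card_exposed_add hR k hg]
    exact Nat.add_le_add_right (deficiency_le hg) k

end MatchingGap

/-! ### Certificates for a large matching gap -/

namespace MatchingGap
open Finset

/-- The edges of `R` that avoid `S` and do not leave `T`. -/
def restrictRel (R : ℕ → ℕ → Prop) (S T : ℕ → Prop) (u v : ℕ) : Prop :=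
  R u v ∧ ¬ S u ∧ ¬ S v ∧ (T u ↔ T v)

/-- The edges between a vertex that may stay unsaturated and its copy. -/
def linkRel (n : ℕ) (R : ℕ → ℕ → Prop) (S T : ℕ → Prop) (u v : ℕ) : Prop :=
  u < n ∧ v = u + n ∧ ¬ T u ∧ ∀ w, R u w → ¬ S w

/-- Two copies of `restrictRel R S T`, joined by the edges of `linkRel`. -/
def doubleRel (n : ℕ) (R : ℕ → ℕ → Prop) (S T : ℕ → Prop) (u v : ℕ) : Prop :=
  restrictRel R S T u v ∨ (n ≤ u ∧ n ≤ v ∧ restrictRel R S T (u - n) (v - n)) ∨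
    linkRel n R S T u v ∨ linkRel n R S T v u

theorem IsGraph.restrict {n : ℕ} {R : ℕ → ℕ → Prop} (hR : IsGraph n R) (S T : ℕ → Prop) :
    IsGraph n (restrictRel R S T) where
  symm := fun _ _ h => ⟨hR.symm _ _ h.1, h.2.2.1, h.2.1, h.2.2.2.symm⟩
  ne := fun _ _ h => hR.ne _ _ h.1
  lt := fun _ _ h => hR.lt _ _ h.1

theorem IsGraph.double {n : ℕ} {R : ℕ → ℕ → Prop} (hR : IsGraph n R) (S T : ℕ → Prop) :
    IsGraph (n + n) (doubleRel n R S T) where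
  symm := by
    rintro u v (h | h | h | h)
    · exact .inl ((hR.restrict S T).symm _ _ h)
    · exact .inr (.inl ⟨h.2.1, h.1, (hR.restrict S T).symm _ _ h.2.2⟩)
    · exact .inr (.inr (.inr h))
    · exact .inr (.inr (.inl h))
  ne := by
    rintro u v (h | h | h | h)
    · exact (hR.restrict S T).ne _ _ h
    · have := (hR.restrict S T).ne _ _ h.2.2; omega
    · have := h.1; have := h.2.1; omega
    · have := h.1; have := h.2.1; omega
  lt := by
    rintro u v (h | h | h | h)
    · have := (hR.restrict S T).lt _ _ h; omega
    · have := (hR.restrict S T).lt _ _ h.2.2; omega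
    · have := h.1; omega
    · have := h.1; have := h.2.1; omega

/-- A matching whose unsaturated vertices are pairwise nonadjacent. -/
def IsMaximalMate (R : ℕ → ℕ → Prop) (g : ℕ → ℕ) : Prop :=
  IsMate R g ∧ ∀ u v, g u = u → g v = v → ¬ R u v

/-- Use `g` in both copies and match each unsaturated vertex with its copy along a link edge. -/
theorem double_perfect {n : ℕ} {R : ℕ → ℕ → Prop} (hR : IsGraph n R) {S T : ℕ → Prop} {g : ℕ → ℕ}
    (hg : IsMate (restrictRel R S T) g)
    (hlink : ∀ v < n, g v = v → ¬ T v ∧ ∀ w, R v w → ¬ S w) :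
    deficiency (n + n) (doubleRel n R S T) = 0 := by
  let f : ℕ → ℕ := fun x =>
    if x < n then (if g x = x then x + n else g x)
    else if x < n + n then (if g (x - n) = x - n then x - n else g (x - n) + n) else x
  have hlt : ∀ v < n, g v < n := fun v hv => hg.lt (hR.restrict S T) hv
  have hff : ∀ x, f (f x) = x := by
    intro x
    by_cases h1 : x < n
    · by_cases h2 : g x = x
      · have e : f x = x + n := by simp [f, h1, h2]
        rw [e]
        have : ¬ x + n < n := by omega
        have h3 : x + n < n + n := by omega
        simp [f, h1, h2]
      · have e : f x = g x := by simp [f, h1, h2]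
        rw [e]
        have h3 : x ≠ g x := fun e => h2 e.symm
        simp [f, hlt x h1, hg.inv, h3]
    · by_cases h4 : x < n + n
      · have h5 : x - n < n := by omega
        by_cases h2 : g (x - n) = x - n
        · have e : f x = x - n := by simp [f, h1, h2, h4]
          rw [e]
          simp [f, h5, h2]; omega
        · have e : f x = g (x - n) + n := by simp [f, h1, h2, h4]
          rw [e]
          have h3 : x - n ≠ g (x - n) := fun e => h2 e.symm
          have := hlt _ h5
          simp [f, hg.inv, h3, this]; omega
      · simp [f, h1, h4]
  have hf : IsMate (doubleRel n R S T) f := by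
    refine ⟨hff, fun x hx => ?_⟩
    by_cases h1 : x < n
    · by_cases h2 : g x = x
      · have e : f x = x + n := by simp [f, h1, h2]
        rw [e]
        obtain ⟨h3, h4⟩ := hlink x h1 h2
        exact .inr (.inr (.inl ⟨h1, rfl, h3, h4⟩))
      · have e : f x = g x := by simp [f, h1, h2]
        rw [e]
        exact .inl (hg.adj h2)
    · by_cases h4 : x < n + n
      · have h5 : x - n < n := by omega
        by_cases h2 : g (x - n) = x - n
        · have e : f x = x - n := by simp [f, h1, h2, h4]
          rw [e]
          obtain ⟨h3, h4⟩ := hlink _ h5 h2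
          exact .inr (.inr (.inr ⟨h5, by omega, h3, h4⟩))
        · have e : f x = g (x - n) + n := by simp [f, h1, h2, h4]
          rw [e]
          refine .inr (.inl ⟨by omega, by omega, ?_⟩)
          rw [Nat.add_sub_cancel]
          exact hg.adj h2
      · exact absurd (by simp [f, h1, h4]) hx
  have h0 : (exposed (n + n) f).card = 0 := by
    rw [Finset.card_eq_zero, Finset.eq_empty_iff_forall_notMem]
    intro x hx
    obtain ⟨h4, e⟩ := mem_exposed.1 hx
    by_cases h1 : x < n
    · by_cases h2 : g x = x
      · have e' : f x = x + n := by simp [f, h1, h2]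
        omega
      · have e' : f x = g x := by simp [f, h1, h2]
        omega
    · by_cases h2 : g (x - n) = x - n
      · have e' : f x = x - n := by simp [f, h1, h2, h4]
        omega
      · have e' : f x = g (x - n) + n := by simp [f, h1, h2, h4]
        omega
  have := deficiency_le (N := n + n) hf
  omega

/-- A certificate `(S, T)` for a large matching gap yields a small maximal matching. -/
theorem exists_maximalMate_of_certificate {n j : ℕ} {R : ℕ → ℕ → Prop} (hR : IsGraph n R)
    {S T : ℕ → Prop} (h1 : deficiency n R + j ≤ deficiency n (restrictRel R S T))
    (h2 : deficiency (n + n) (doubleRel n R S T) = 0) :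
    ∃ g, IsMaximalMate R g ∧ deficiency n R + j ≤ (exposed n g).card := by
  obtain ⟨f, hf, hf0⟩ := exists_deficiency (n + n) (doubleRel n R S T)
  rw [h2, Finset.card_eq_zero] at hf0
  have hne : ∀ v < n + n, f v ≠ v := by
    intro v hv e
    exact absurd (mem_exposed.2 ⟨hv, e⟩) (by simp [hf0])
  have hadj : ∀ v < n, f v < n → restrictRel R S T v (f v) := by
    intro v hv hv'
    rcases hf.adj (hne v (by omega)) with h | h | h | h
    · exact h
    · omega
    · have := h.2.1; omega
    · have := h.2.1; omega
  have hg : IsMate (restrictRel R S T) fun v => if v < n ∧ f v < n then f v else v := by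
    refine ⟨fun v => ?_, fun v hv => ?_⟩
    · by_cases h : v < n ∧ f v < n
      · simp [h, hf.inv]
      · simp [h]
    · by_cases h : v < n ∧ f v < n
      · simp only [h, and_self, if_true]
        exact hadj v h.1 h.2
      · simp [h] at hv
  obtain ⟨g, hg1, hg2, hg3⟩ := exists_maximal_extension (hR.restrict S T) hg
  -- A vertex left unsaturated after the extension was unsaturated before it, so the perfect
  -- matching of the double uses its link edge.
  have hexp : ∀ v < n, g v = v → ¬ T v ∧ ∀ w, R v w → ¬ S w := by
    intro v hv e
    by_cases hv' : f v < n
    · exfalso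
      have h := hne v (by omega)
      have := hg2 v (by simpa [hv, hv'] using h)
      rw [e] at this
      simp only [hv, hv', and_self, if_true] at this
      exact h this.symm
    · rcases hf.adj (hne v (by omega)) with h | h | h | h
      · exact absurd ((hR.restrict S T).lt' h) hv'
      · omega
      · exact h.2.2
      · have := h.1; omega
  refine ⟨g, ⟨hg1.mono fun _ _ h => h.1, fun u v hu hv huv => ?_⟩, h1.trans (deficiency_le hg1)⟩
  obtain ⟨a1, a2⟩ := hexp u (hR.lt _ _ huv) hu
  obtain ⟨b1, b2⟩ := hexp v (hR.lt' huv) hv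
  -- Neither end has a neighbour in `S`, so neither end lies in `S`, and both ends avoid `T`. The
  -- edge therefore survives the restriction.
  exact hg3 u v hu hv ⟨huv, b2 _ (hR.symm _ _ huv), a2 _ huv, by tauto⟩

/-- A maximal matching with `2 * j` more unsaturated vertices than necessary is certified by a pair
`(S, T)` with few vertices. -/
theorem exists_certificate {n j : ℕ} {R : ℕ → ℕ → Prop} (hR : IsGraph n R) {g : ℕ → ℕ}
    (hg : IsMaximalMate R g) (hgj : (exposed n g).card = deficiency n R + 2 * j) :
    ∃ S T : Finset ℕ, S ⊆ range n ∧ T ⊆ range n ∧ S.card + T.card ≤ 8 * j ∧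
      deficiency n R + 2 * j ≤ deficiency n (restrictRel R (· ∈ S) (· ∈ T)) ∧
      deficiency (n + n) (doubleRel n R (· ∈ S) (· ∈ T)) = 0 := by
  classical
  obtain ⟨hg, hmax⟩ := hg
  obtain ⟨B, hB, κ, hκ, hcard⟩ := exists_barrier hR
  let base : ℕ → Finset ℕ := fun c =>
    (range n).filter fun x => x ∉ B ∧ κ x = c ∧ (g x = x ∨ g x ∈ B)
  -- Every odd class has a base, so a good class has exactly one and a bad class at least two.
  let good : ℕ → Prop := fun c => c ∈ oddLabels n B κ ∧ (base c).card ≤ 1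
  let bad : ℕ → Prop := fun c => c ∈ oddLabels n B κ ∧ ¬ (base c).card ≤ 1
  have hgood := card_bases hR hg hB κ good
  have hbad := card_bases hR hg hB κ bad
  let S := (exposed n g).filter fun x => ¬ (x ∉ B ∧ good (κ x))
  let Q := B.filter fun b => ¬ (g b ∉ B ∧ good (κ (g b))) ∧ g b ≠ b
  let T := (range n).filter fun v => v ∈ Q ∨ g v ∈ Q
  have hbase : ∀ c ∈ oddLabels n B κ, 1 ≤ (base c).card := by
    intro c hc
    obtain ⟨x, h1, h2, h3, h4⟩ := exists_base hR hg hκ hc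
    exact Finset.card_pos.2 ⟨x, by simp [base, h1, h2, h3, h4]⟩
  have hfib : ∀ (p : ℕ → Prop) [DecidablePred p], (∀ c, p c → c ∈ oddLabels n B κ) →
      ((range n).filter fun x => x ∉ B ∧ p (κ x) ∧ (g x = x ∨ g x ∈ B)).card =
        ∑ c ∈ (oddLabels n B κ).filter p, (base c).card := by
    intro p _ hp
    rw [Finset.card_eq_sum_card_fiberwise (f := κ) (t := (oddLabels n B κ).filter p)]
    · apply Finset.sum_congr rfl
      intro c hc
      congr 1
      ext x
      simp only [mem_filter, base] at hc ⊢
      constructor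
      · rintro ⟨⟨h1, h2, h3, h4⟩, h5⟩; exact ⟨h1, h2, h5, h4⟩
      · rintro ⟨h1, h2, h3, h4⟩; exact ⟨⟨h1, h2, h3 ▸ hc.2, h4⟩, h3⟩
    · intro x hx
      simp only [coe_filter, Set.mem_ofPred_eq] at hx ⊢
      exact ⟨hp _ hx.2.2.1, hx.2.2.1⟩
  have hgood1 : ∑ c ∈ (oddLabels n B κ).filter good, (base c).card =
      ((oddLabels n B κ).filter good).card := by
    rw [Finset.card_eq_sum_ones]
    apply Finset.sum_congr rfl
    intro c hc
    have h1 := (mem_filter.1 hc).2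
    have := hbase c h1.1
    have := h1.2
    omega
  have hbad1 : ((oddLabels n B κ).filter bad).card * 2 ≤
      ∑ c ∈ (oddLabels n B κ).filter bad, (base c).card := by
    rw [← smul_eq_mul]
    apply Finset.card_nsmul_le_sum
    intro c hc
    have h1 := (mem_filter.1 hc).2
    have := h1.2
    omega
  rw [hfib good fun c h => h.1, hgood1] at hgood
  rw [hfib bad fun c h => h.1] at hbad
  have hsplit : ((oddLabels n B κ).filter good).card + ((oddLabels n B κ).filter bad).card =
      (oddLabels n B κ).card := by
    rw [← Finset.card_filter_add_card_filter_not (s := oddLabels n B κ) good]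
    congr 2
    ext c
    simp only [mem_filter, good, bad]
    tauto
  have hS := Finset.card_filter_add_card_filter_not (s := exposed n g) (fun x => x ∉ B ∧ good (κ x))
  change _ + S.card = _ at hS
  have hQ := Finset.card_filter_add_card_filter_not (s := B) (fun b => g b ∉ B ∧ good (κ (g b)))
  have hQ1 : Q.card ≤ (B.filter fun b => ¬ (g b ∉ B ∧ good (κ (g b)))).card := by
    apply Finset.card_le_card
    intro b hb
    simp only [Q, mem_filter] at hb ⊢
    tauto
  have hS2 : ((exposed n g).filter fun x => x ∉ B ∧ bad (κ x)).card ≤ S.card := by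
    apply Finset.card_le_card
    intro x hx
    simp only [S, mem_filter, bad, good] at hx ⊢
    tauto
  have hQ2 : (B.filter fun b => g b ∉ B ∧ bad (κ (g b))).card ≤ Q.card := by
    apply Finset.card_le_card
    intro b hb
    simp only [Q, mem_filter, bad, good] at hb ⊢
    refine ⟨hb.1, by tauto, fun e => hb.2.1 (by rw [e]; exact hb.1)⟩
  have hT : T.card ≤ Q.card + Q.card := by
    have : T ⊆ Q ∪ Q.image g := by
      intro v hv
      simp only [T, mem_filter] at hv
      rw [mem_union, mem_image]
      rcases hv.2 with h | h
      · exact .inl h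
      · exact .inr ⟨g v, h, hg.inv v⟩
    have h1 := (Finset.card_le_card this).trans (Finset.card_union_le _ _)
    have h2 : (Q.image g).card ≤ Q.card := Finset.card_image_le
    omega
  have hSg : ∀ v, v ∈ S → g v = v := fun v hv => (mem_exposed.1 (mem_filter.1 hv).1).2
  have hQg : ∀ v, v ∈ Q → g v ≠ v := fun v hv => (mem_filter.1 hv).2.2
  have hTg : ∀ v, v ∈ T → g v ≠ v := by
    intro v hv e
    rcases (mem_filter.1 hv).2 with h | h
    · exact hQg v h e
    · rw [e] at h; exact hQg v h e
  have hL : IsMate (restrictRel R (· ∈ S) (· ∈ T)) g := by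
    refine ⟨hg.1, fun v hv => ⟨hg.adj hv, fun h => hv (hSg v h), fun h => ?_, ?_⟩⟩
    · have := hSg _ h
      rw [hg.inv] at this
      exact hv this.symm
    · have h1 := hR.lt _ _ (hg.adj hv)
      have h2 := hg.lt hR h1
      simp only [T, mem_filter, mem_range, h1, h2, hg.inv, true_and]
      tauto
  -- Let q count the vertices of `B` not matched into good classes, so |Q| ≤ q. The barrier
  -- inequality gives |S| + q ≤ 2j + #bad, and the two bases per bad class give 2 #bad ≤ |S| + |Q|.
  -- Hence |S| + q ≤ 4j, and |T| ≤ 2|Q| yields the bound 8j.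
  refine ⟨S, T, fun v hv => ?_, Finset.filter_subset _ _, by omega, ?_, ?_⟩
  · exact mem_range.2 (mem_exposed.1 (mem_filter.1 hv).1).1
  · obtain ⟨h, hh, e⟩ := exists_deficiency n (restrictRel R (· ∈ S) (· ∈ T))
    have hhR : IsMate R h := hh.mono fun _ _ h => h.1
    rw [← e, ← hgj]
    have hSh : S ⊆ exposed n h := by
      intro v hv
      refine mem_exposed.2 ⟨(mem_exposed.1 (mem_filter.1 hv).1).1, ?_⟩
      by_contra h'
      exact (hh.adj h').2.1 hv
    have h1 := Finset.card_sdiff_add_card_eq_card hSh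
    let B0 := B.filter fun b => b ∉ S ∧ b ∉ T
    -- A vertex of `B` outside `S` is saturated by `g`, and outside `T` its mate must lie in a good
    -- class.
    have hB0 : B0.card ≤ (B.filter fun b => g b ∉ B ∧ good (κ (g b))).card := by
      apply Finset.card_le_card
      intro b hb
      simp only [B0, S, T, Q, mem_filter, mem_exposed, mem_range] at hb ⊢
      have := mem_range.1 (hB hb.1)
      tauto
    choose! x hx using fun c (hc : c ∈ (oddLabels n B κ).filter good) =>
      exists_base hR hhR hκ (mem_filter.1 hc).1
    have hST : ∀ c ∈ (oddLabels n B κ).filter good, x c ∉ S ∧ x c ∉ T := by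
      intro c hc
      obtain ⟨h1, h2, h3, h4⟩ := hx c hc
      have h5 := (mem_filter.1 hc).2
      rw [← h3] at h5
      constructor
      · intro h6
        exact (mem_filter.1 h6).2 ⟨h2, h5⟩
      · intro h6
        rcases (mem_filter.1 h6).2 with h7 | h7
        · exact h2 (mem_filter.1 h7).1
        · have := (mem_filter.1 h7).2.1
          rw [hg.inv] at this
          exact this ⟨h2, h5⟩
    -- Each good class has a base for `h`, outside `S` and `T`, which is unsaturated or matched into
    -- `B0`. Since `S` is unsaturated by `h` as well, `h` leaves at least as many vertices
    -- unsaturated as `g`.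
    have h2 : ((oddLabels n B κ).filter good).card ≤ ((exposed n h \ S).disjSum B0).card := by
      apply Finset.card_le_card_of_injOn
        (fun c => if h (x c) = x c then Sum.inl (x c) else Sum.inr (h (x c)))
      · intro c hc
        rw [mem_coe] at hc
        obtain ⟨a1, a2, a3, a4⟩ := hx c hc
        obtain ⟨b1, b2⟩ := hST c hc
        by_cases h3 : h (x c) = x c
        · simp only [h3, if_true, mem_coe, inl_mem_disjSum, mem_sdiff, mem_exposed]
          exact ⟨⟨a1, trivial⟩, b1⟩
        · simp only [h3, if_false, mem_coe, inr_mem_disjSum, B0, mem_filter]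
          have h4 := (hh.adj h3)
          refine ⟨by tauto, h4.2.2.1, fun h5 => b2 (h4.2.2.2.2 h5)⟩
      · intro c hc c' hc' e
        rw [mem_coe] at hc hc'
        obtain ⟨_, _, a3, _⟩ := hx c hc
        obtain ⟨_, _, b3, _⟩ := hx c' hc'
        rw [← a3, ← b3]
        congr 1
        simp only at e
        split_ifs at e with e1 e2
        · exact Sum.inl.inj e
        · exact hh.inj (Sum.inr.inj e)
    rw [Finset.card_disjSum] at h2
    omega
  · apply double_perfect hR hL
    intro v hv e
    refine ⟨fun h => hTg v h e, fun w hw hS => hmax v w e (hSg w hS) hw⟩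

end MatchingGap

/-! ### Interpolation between sizes of maximal matchings -/

namespace MatchingGap
open Finset

/-- Insert the edge, release the old mates of its ends, and extend greedily. The unsaturated
vertices of `g` are pairwise nonadjacent, so one that becomes saturated is `x`, `y`, or a new mate
of `g x` or `g y`. This injects the lost vertices into `{g x, g y}`, whence the loss of at most 2.
-/
theorem exists_maximalMate_add_edge {n : ℕ} {R : ℕ → ℕ → Prop} (hR : IsGraph n R) {g : ℕ → ℕ}
    (hg : IsMaximalMate R g) {x y : ℕ} (hxy : R x y) (hgx : g x ≠ y) :
    ∃ g', IsMaximalMate R g' ∧ (exposed n g).card ≤ (exposed n g').card + 2 ∧ g' x = y ∧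
      ∀ v, g v ≠ v → v ≠ x → v ≠ y → v ≠ g x → v ≠ g y → g' v = g v := by
  obtain ⟨hg, hmax⟩ := hg
  have hne := hR.ne _ _ hxy
  have hgy : g y ≠ x := fun e => hgx (by rw [← e, hg.inv])
  let g₁ : ℕ → ℕ := fun v =>
    if v = x then y else if v = y then x else if v = g x ∨ v = g y then v else g v
  have h1x : g₁ x = y := by simp [g₁]
  have h1y : g₁ y = x := by simp [g₁, hne.symm]
  have h1o : ∀ v, v ≠ x → v ≠ y → (v = g x ∨ v = g y) → g₁ v = v := by
    intro v h1 h2 h3; simp [g₁, h1, h2, h3]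
  have h1g : ∀ v, v ≠ x → v ≠ y → ¬ (v = g x ∨ v = g y) → g₁ v = g v := by
    intro v h1 h2 h3; simp [g₁, h1, h2, h3]
  have hg₁ : IsMate R g₁ := by
    refine ⟨fun v => ?_, fun v hv => ?_⟩
    · by_cases h1 : v = x
      · rw [h1, h1x, h1y]
      · by_cases h2 : v = y
        · rw [h2, h1y, h1x]
        · by_cases h3 : v = g x ∨ v = g y
          · rw [h1o v h1 h2 h3, h1o v h1 h2 h3]
          · rw [h1g v h1 h2 h3, h1g, hg.inv]
            · intro e; exact h3 (.inl (by rw [← e, hg.inv]))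
            · intro e; exact h3 (.inr (by rw [← e, hg.inv]))
            · rintro (e | e)
              · exact h1 (hg.inj e)
              · exact h2 (hg.inj e)
    · by_cases h1 : v = x
      · rw [h1, h1x]; exact hxy
      · by_cases h2 : v = y
        · rw [h2, h1y]; exact hR.symm _ _ hxy
        · by_cases h3 : v = g x ∨ v = g y
          · exact absurd (h1o v h1 h2 h3) hv
          · rw [h1g v h1 h2 h3] at hv ⊢
            exact hg.adj hv
  obtain ⟨g', hg', hext, hmax'⟩ := exists_maximal_extension hR hg₁
  have h2x : g' x = y := by rw [hext x (by rw [h1x]; exact hne.symm), h1x]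
  have h2y : g' y = x := by rw [← h2x, hg'.inv]
  have hlost : (exposed n g \ exposed n g').card ≤ ({g x, g y} : Finset ℕ).card := by
    apply Finset.card_le_card_of_injOn (fun u => if u = x ∨ u = y then u else g' u)
    · intro u hu
      rw [mem_coe, mem_sdiff, mem_exposed, mem_exposed] at hu
      obtain ⟨⟨hun, hu1⟩, hu2⟩ := hu
      by_cases h1 : u = x ∨ u = y
      · simp only [h1, if_true, coe_insert, coe_singleton, Set.mem_insert_iff, Set.mem_singleton_iff]
        rcases h1 with h1 | h1
        · left; rw [← h1, hu1]
        · right; rw [← h1, hu1]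
      · simp only [h1, if_false, coe_insert, coe_singleton, Set.mem_insert_iff,
          Set.mem_singleton_iff]
        push Not at h1
        have hu3 : g' u ≠ u := fun e => hu2 ⟨hun, e⟩
        have hgu : g₁ u = u := by
          by_cases h3 : u = g x ∨ u = g y
          · exact h1o u h1.1 h1.2 h3
          · rw [h1g u h1.1 h1.2 h3, hu1]
        have hw : g₁ (g' u) = g' u := by
          by_contra hw
          have := hext _ hw
          rw [hg'.inv] at this
          have h4 := hg₁.inv (g' u)
          rw [← this, hgu] at h4
          exact hu3 h4.symm
        by_contra h3
        have hwx : g' u ≠ x := fun e => by rw [e, h1x] at hw; exact hne hw.symm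
        have hwy : g' u ≠ y := fun e => by rw [e, h1y] at hw; exact hne hw
        rw [h1g _ hwx hwy h3] at hw
        exact hmax u (g' u) hu1 hw (hg'.adj hu3)
    · intro u _ u' _ e
      simp only at e
      split_ifs at e with h1 h2 h2
      · exact e
      · exfalso
        rcases h1 with h1 | h1
        · exact h2 (.inr (by rw [← h2x, ← h1, e, hg'.inv]))
        · exact h2 (.inl (by rw [← h2y, ← h1, e, hg'.inv]))
      · exfalso
        rcases h2 with h2 | h2
        · exact h1 (.inr (by rw [← h2x, ← h2, ← e, hg'.inv]))
        · exact h1 (.inl (by rw [← h2y, ← h2, ← e, hg'.inv]))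
      · exact hg'.inj e
  have h3 := Finset.card_le_two (a := g x) (b := g y)
  have h4 := Finset.card_le_card_sdiff_add_card (s := exposed n g) (t := exposed n g')
  refine ⟨g', ⟨hg', hmax'⟩, by omega, h2x, fun v hv h1 h2 h3 h4 => ?_⟩
  have h5 := h1g v h1 h2 (by tauto)
  rw [hext v (by rwa [h5]), h5]

/-- The sizes of maximal matchings form an interval. -/
theorem exists_maximalMate_card_eq {n j : ℕ} {R : ℕ → ℕ → Prop} (hR : IsGraph n R) {g : ℕ → ℕ}
    (hg : IsMaximalMate R g) (hj : deficiency n R + 2 * j ≤ (exposed n g).card) :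
    ∃ g', IsMaximalMate R g' ∧ (exposed n g').card = deficiency n R + 2 * j := by
  obtain ⟨h, hh, hd⟩ := exists_deficiency n R
  have hparh := card_exposed_mod_two hR hh
  -- Edges of a maximum matching `h` are inserted one at a time, and the agreement with `h` grows.
  -- By parity a number of unsaturated vertices above the target exceeds it by at least 2, so no
  -- step jumps past it.
  induction hm : ((range n).filter fun v => ¬ (g v = h v ∧ h v ≠ v)).card
    using Nat.strong_induction_on generalizing g with
  | _ m ih =>
    have hpar := card_exposed_mod_two hR hg.1
    rcases Nat.eq_or_lt_of_le hj with e | hlt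
    · exact ⟨g, hg, e.symm⟩
    · by_cases hall : ∀ v, h v ≠ v → g v = h v
      · exfalso
        have : (exposed n g).card ≤ (exposed n h).card := by
          apply Finset.card_le_card
          intro v hv
          rw [mem_exposed] at hv ⊢
          refine ⟨hv.1, ?_⟩
          by_contra h1
          have h2 := hall v h1
          rw [hv.2] at h2
          exact h1 h2.symm
        omega
      · push Not at hall
        obtain ⟨x, hx, hgx⟩ := hall
        obtain ⟨g', hg', hcard, hg'x, hkeep⟩ := exists_maximalMate_add_edge hR hg (hh.adj hx) hgx
        refine ih _ ?_ hg' (by omega) rfl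
        rw [← hm]
        apply Finset.card_lt_card
        rw [Finset.ssubset_iff_of_subset]
        · refine ⟨x, ?_, ?_⟩
          · simp [hR.lt _ _ (hh.adj hx), hgx]
          · simp [hg'x, hx]
        · intro v hv
          simp only [mem_filter] at hv ⊢
          refine ⟨hv.1, fun ⟨h1, h2⟩ => hv.2 ⟨?_, h2⟩⟩
          rw [← h1]
          apply hkeep
          · rwa [h1]
          · rintro rfl; exact hgx h1
          · rintro rfl
            rw [hh.inv] at h1
            exact hgx (by rw [← h1, hg.1.inv, h1])
          · rintro rfl
            rw [hg.1.inv] at h1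
            have h4 := hh.inv (g x)
            rw [← h1] at h4
            exact hgx h4.symm
          · rintro rfl
            rw [hg.1.inv] at h1
            exact hgx ((congrArg g (hh.inj h1)).trans (hg.1.inv _))

/-! ### Translation between subgraph matchings and mate functions -/

section Link

variable {n : ℕ} {G : SimpleGraph (Fin n)}

/-- The adjacency relation of `G` on natural numbers. -/
def natRel (G : SimpleGraph (Fin n)) (u v : ℕ) : Prop :=
  ∃ (hu : u < n) (hv : v < n), G.Adj ⟨u, hu⟩ ⟨v, hv⟩

theorem isGraph_natRel (G : SimpleGraph (Fin n)) : IsGraph n (natRel G) where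
  symm := fun _ _ ⟨hu, hv, h⟩ => ⟨hv, hu, h.symm⟩
  ne := fun _ _ ⟨_, _, h⟩ e => h.ne (Fin.ext e)
  lt := fun _ _ ⟨hu, _, _⟩ => hu

theorem two_mul_ncard_edgeSet {M : G.Subgraph} (hM : M.IsMatching) :
    2 * M.edgeSet.ncard = M.verts.ncard := by
  classical
  have h := M.spanningCoe.sum_degrees_eq_twice_card_edges
  have h1 : M.spanningCoe.edgeFinset.card = M.edgeSet.ncard := by
    rw [← Set.ncard_coe_finset, SimpleGraph.coe_edgeFinset]
    congr 1
  have h2 : ∀ v, M.spanningCoe.degree v = if v ∈ M.verts then 1 else 0 := by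
    intro v
    rw [← SimpleGraph.card_neighborFinset_eq_degree]
    split_ifs with hv
    · obtain ⟨w, hw, hw'⟩ := hM hv
      rw [Finset.card_eq_one]
      refine ⟨w, ?_⟩
      ext u
      simp only [SimpleGraph.mem_neighborFinset, SimpleGraph.Subgraph.spanningCoe_adj, mem_singleton]
      exact ⟨fun h => hw' _ h, fun h => h ▸ hw⟩
    · rw [Finset.card_eq_zero, Finset.eq_empty_iff_forall_notMem]
      intro u hu
      simp only [SimpleGraph.mem_neighborFinset, SimpleGraph.Subgraph.spanningCoe_adj] at hu
      exact hv (M.edge_vert hu)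
  rw [← h1, ← h, Finset.sum_congr rfl fun v _ => h2 v, Set.ncard_eq_toFinset_card']
  simp

theorem ncard_add_card_exposed {M : G.Subgraph} (hM : M.IsMatching) {g : ℕ → ℕ}
    (hg : ∀ i : Fin n, g i = i ↔ i ∉ M.verts) :
    2 * M.edgeSet.ncard + (exposed n g).card = n := by
  classical
  rw [two_mul_ncard_edgeSet hM]
  have : (exposed n g).card = (M.vertsᶜ).ncard := by
    rw [Set.ncard_eq_toFinset_card']
    symm
    apply Finset.card_bij (fun (i : Fin n) _ => (i : ℕ))
    · intro i hi
      simp only [Set.mem_toFinset, Set.mem_compl_iff] at hi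
      exact mem_exposed.2 ⟨i.2, (hg i).2 hi⟩
    · intro i _ j _ e; exact Fin.ext e
    · intro v hv
      rw [mem_exposed] at hv
      exact ⟨⟨v, hv.1⟩, by simpa using (hg ⟨v, hv.1⟩).1 hv.2, rfl⟩
  rw [this, Set.ncard_add_ncard_compl]
  simp

theorem exists_isMate_of_isMatching {M : G.Subgraph} (hM : M.IsMatching) :
    ∃ g, IsMate (natRel G) g ∧ ∀ i : Fin n, g i = i ↔ i ∉ M.verts := by
  classical
  have hM' : ∀ v, v ∈ M.verts → ∃ w, M.Adj v w ∧ ∀ y, M.Adj v y → y = w := fun v hv => hM hv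
  choose! f hf hf' using hM'
  have hff : ∀ i, i ∈ M.verts → f i ∈ M.verts ∧ f (f i) = i := by
    intro i hi
    have h1 := M.edge_vert (hf _ hi).symm
    exact ⟨h1, (hf' _ h1 i (hf _ hi).symm).symm⟩
  let g : ℕ → ℕ := fun v => if h : v < n then
    (if (⟨v, h⟩ : Fin n) ∈ M.verts then (f ⟨v, h⟩ : ℕ) else v) else v
  have hg1 : ∀ i : Fin n, i ∈ M.verts → g i = f i := by
    intro i hi; simp [g, hi]
  have hg2 : ∀ i : Fin n, i ∉ M.verts → g i = i := by
    intro i hi; simp [g, hi]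
  have hg3 : ∀ v, ¬ v < n → g v = v := by
    intro v hv; simp [g, hv]
  refine ⟨g, ⟨fun v => ?_, fun v hv => ?_⟩, fun i => ⟨fun h hi => ?_, hg2 i⟩⟩
  · by_cases h : v < n
    · by_cases hi : (⟨v, h⟩ : Fin n) ∈ M.verts
      · have h1 := hg1 ⟨v, h⟩ hi
        simp only at h1
        rw [h1, hg1 _ (hff _ hi).1, (hff _ hi).2]
      · have h1 := hg2 ⟨v, h⟩ hi
        simp only at h1
        rw [h1, h1]
    · rw [hg3 v h, hg3 v h]
  · by_cases h : v < n
    · by_cases hi : (⟨v, h⟩ : Fin n) ∈ M.verts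
      · have h1 := hg1 ⟨v, h⟩ hi
        simp only at h1
        rw [h1]
        exact ⟨h, (f ⟨v, h⟩).2, (hf _ hi).adj_sub⟩
      · exact absurd (hg2 ⟨v, h⟩ hi) hv
    · exact absurd (hg3 v h) hv
  · rw [hg1 i hi] at h
    exact (hf _ hi).ne (Fin.ext h.symm)

theorem exists_isMatching_of_isMate {g : ℕ → ℕ} (hg : IsMate (natRel G) g) :
    ∃ M : G.Subgraph, M.IsMatching ∧ ∀ i : Fin n, g i = i ↔ i ∉ M.verts := by
  refine ⟨{ verts := {i | g i ≠ i}, Adj := fun i j => g i = j ∧ i ≠ j, adj_sub := ?_,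
            edge_vert := ?_, symm := ?_ }, ?_, ?_⟩
  · rintro i j ⟨h1, h2⟩
    obtain ⟨_, _, h3⟩ := hg.adj (v := i) (by rw [h1]; exact fun e => h2 (Fin.ext e.symm))
    have : (⟨g i, by omega⟩ : Fin n) = j := Fin.ext h1
    rw [← this]
    exact h3
  · rintro i j ⟨h1, h2⟩
    simp only [Set.mem_ofPred_eq]
    rw [h1]
    exact fun e => h2 (Fin.ext e.symm)
  · exact ⟨fun i j ⟨h1, h2⟩ => ⟨by rw [← h1, hg.inv], h2.symm⟩⟩
  · intro i hi
    simp only [Set.mem_ofPred_eq] at hi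
    refine ⟨⟨g i, hg.lt (isGraph_natRel G) i.2⟩, ⟨rfl, fun e => hi (congrArg Fin.val e).symm⟩, ?_⟩
    rintro j ⟨h1, _⟩
    exact Fin.ext h1.symm
  · intro i
    simp

theorem isMaximalMatching_iff {M : G.Subgraph} :
    IsMaximalMatching M ↔ M.IsMatching ∧ ∀ u v, u ∉ M.verts → v ∉ M.verts → ¬ G.Adj u v := by
  constructor
  · intro h
    refine ⟨h.1, fun u v hu hv huv => ?_⟩
    have h1 : (M ⊔ G.subgraphOfAdj huv).IsMatching := by
      apply h.1.sup (SimpleGraph.Subgraph.IsMatching.subgraphOfAdj huv)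
      rw [h.1.support_eq_verts, (SimpleGraph.Subgraph.IsMatching.subgraphOfAdj huv).support_eq_verts,
        Set.disjoint_right]
      intro x hx
      simp only [SimpleGraph.subgraphOfAdj_verts, Set.mem_insert_iff, Set.mem_singleton_iff] at hx
      rcases hx with rfl | rfl <;> assumption
    have h2 := h.2 h1 le_sup_left
    exact hu (h2.1 (by simp))
  · rintro ⟨h, hmax⟩
    refine ⟨h, fun N hN hle => ?_⟩
    have hv : N.verts ⊆ M.verts := by
      intro v hv
      by_contra hvM
      obtain ⟨w, hw, _⟩ := hN hv
      refine hmax v w hvM (fun hwM => ?_) hw.adj_sub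
      obtain ⟨x, hx, _⟩ := h hwM
      have : v = x := hN.eq_of_adj_left hw.symm (hle.2 hx)
      exact hvM (this ▸ M.edge_vert hx.symm)
    refine ⟨hv, fun v w hvw => ?_⟩
    obtain ⟨x, hx, _⟩ := h (hv (N.edge_vert hvw))
    rwa [hN.eq_of_adj_left hvw (hle.2 hx)]

theorem isMaximalMate_iff {M : G.Subgraph} (hM : M.IsMatching) {g : ℕ → ℕ}
    (hg : IsMate (natRel G) g) (hgM : ∀ i : Fin n, g i = i ↔ i ∉ M.verts) :
    IsMaximalMate (natRel G) g ↔ IsMaximalMatching M := by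
  rw [isMaximalMatching_iff]
  constructor
  · rintro ⟨_, h⟩
    exact ⟨hM, fun u v hu hv huv => h u v ((hgM u).2 hu) ((hgM v).2 hv) ⟨u.2, v.2, huv⟩⟩
  · rintro ⟨_, h⟩
    refine ⟨hg, ?_⟩
    rintro u v hu hv ⟨h1, h2, h3⟩
    exact h _ _ ((hgM ⟨u, h1⟩).1 hu) ((hgM ⟨v, h2⟩).1 hv) h3

theorem two_mul_matchingNumber_add (G : SimpleGraph (Fin n)) :
    2 * matchingNumber G + deficiency n (natRel G) = n := by
  have hbdd : ∀ m ∈ {m : ℕ | ∃ M : G.Subgraph, M.IsMatching ∧ M.edgeSet.ncard = m},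
      2 * m + deficiency n (natRel G) ≤ n := by
    rintro m ⟨M, hM, rfl⟩
    obtain ⟨g, hg, hgM⟩ := exists_isMate_of_isMatching hM
    have := ncard_add_card_exposed hM hgM
    have := deficiency_le (N := n) hg
    omega
  obtain ⟨g, hg, hd⟩ := exists_deficiency n (natRel G)
  obtain ⟨M, hM, hgM⟩ := exists_isMatching_of_isMate hg
  have h1 := ncard_add_card_exposed hM hgM
  have h2 : M.edgeSet.ncard ≤ matchingNumber G :=
    le_csSup ⟨n, fun m hm => by have := hbdd m hm; omega⟩ ⟨M, hM, rfl⟩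
  have h3 := hbdd _ (Nat.sSup_mem (s := {m : ℕ | ∃ M : G.Subgraph, M.IsMatching ∧
    M.edgeSet.ncard = m}) ⟨_, M, hM, rfl⟩ ⟨n, fun m hm => by have := hbdd m hm; omega⟩)
  change 2 * matchingNumber G + _ ≤ n at h3
  omega

/-- The matching gap in terms of mate functions. -/
theorem le_matchingGap_iff (G : SimpleGraph (Fin n)) (j : ℕ) :
    j ≤ matchingGap G ↔ ∃ g, IsMaximalMate (natRel G) g ∧
      deficiency n (natRel G) + 2 * j ≤ (exposed n g).card := by
  have hν := two_mul_matchingNumber_add G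
  have hle : ∀ M : G.Subgraph, IsMaximalMatching M → minMaximalMatchingNumber G ≤ M.edgeSet.ncard :=
    fun M hM => Nat.sInf_le ⟨M, hM, rfl⟩
  have key : ∀ g, IsMaximalMate (natRel G) g →
      2 * minMaximalMatchingNumber G + (exposed n g).card ≤ n := by
    intro g hg
    obtain ⟨M, hM, hgM⟩ := exists_isMatching_of_isMate hg.1
    have h1 := ncard_add_card_exposed hM hgM
    have h2 := hle M ((isMaximalMate_iff hM hg.1 hgM).1 hg)
    omega
  obtain ⟨g₀, hg₀, _, hmax₀⟩ := exists_maximal_extension (isGraph_natRel G) (isMate_id (natRel G))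
  have hne : {m : ℕ | ∃ M : G.Subgraph, IsMaximalMatching M ∧ M.edgeSet.ncard = m}.Nonempty := by
    obtain ⟨M, hM, hgM⟩ := exists_isMatching_of_isMate hg₀
    exact ⟨_, M, (isMaximalMate_iff hM hg₀ hgM).1 ⟨hg₀, hmax₀⟩, rfl⟩
  obtain ⟨M, hM, hMβ⟩ := Nat.sInf_mem hne
  change M.edgeSet.ncard = minMaximalMatchingNumber G at hMβ
  obtain ⟨g, hg, hgM⟩ := exists_isMate_of_isMatching hM.1
  have h1 := ncard_add_card_exposed hM.1 hgM
  have h2 := (isMaximalMate_iff hM.1 hg hgM).2 hM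
  have h3 := deficiency_le (N := n) hg
  unfold matchingGap
  constructor
  · intro hj
    exact ⟨g, h2, by omega⟩
  · rintro ⟨g', hg', hj⟩
    have := key g' hg'
    omega

theorem matchingGap_le (G : SimpleGraph (Fin n)) : matchingGap G ≤ n := by
  have := two_mul_matchingNumber_add G
  unfold matchingGap
  omega

/-- A vertex of `setA G` has a neighbour in `setD G`, hence an adjacent component. This bound
absorbs the additive 1 in the exponent of the running time. -/
theorem one_le_rho (G : SimpleGraph (Fin n)) : 1 ≤ rho G := by
  unfold rho
  split_ifs with h
  · exact le_rfl
  · obtain ⟨v, hv⟩ := Set.nonempty_iff_ne_empty.2 h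
    refine le_trans ?_ (le_csSup (Set.toFinite _).bddAbove ⟨v, hv, rfl⟩)
    obtain ⟨w, hw, hvw⟩ := hv.2
    exact (Set.ncard_pos (Set.toFinite _)).2 ⟨_, ⟨w, hw⟩, hvw, rfl⟩

end Link

/-- The matching gap is at least `j` if and only if there is a small certificate. -/
theorem le_matchingGap_iff_certificate {n : ℕ} (G : SimpleGraph (Fin n)) (j : ℕ) :
    j ≤ matchingGap G ↔ ∃ S T : Finset ℕ, S ⊆ range n ∧ T ⊆ range n ∧ S.card + T.card ≤ 8 * j ∧
      deficiency n (natRel G) + 2 * j ≤ deficiency n (restrictRel (natRel G) (· ∈ S) (· ∈ T)) ∧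
      deficiency (n + n) (doubleRel n (natRel G) (· ∈ S) (· ∈ T)) = 0 := by
  rw [le_matchingGap_iff]
  constructor
  · rintro ⟨g, hg, hj⟩
    -- The size bound 8j needs a surplus of exactly 2j, not merely at least 2j.
    obtain ⟨g', hg', e⟩ := exists_maximalMate_card_eq (isGraph_natRel G) hg hj
    exact exists_certificate (isGraph_natRel G) hg' e
  · rintro ⟨S, T, _, _, _, h1, h2⟩
    exact exists_maximalMate_of_certificate (isGraph_natRel G) h1 h2

end MatchingGap

/-! ### A search that decides whether a matching is maximum -/

namespace MatchingGap
open Finset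

/-- The state of the search for a certificate that the matching `f` is not maximum: `t v` is the
time at which `v` entered (`0` if it did not), `e v` is the entry time of a vertex that is known to
lie in the same class as `v`, and `T` is the clock. -/
structure Search (N : ℕ) (R : ℕ → ℕ → Prop) (f t e : ℕ → ℕ) (T : ℕ) : Prop where
  pos : 1 ≤ T
  lt : ∀ v < N, t v < T
  lab : ∀ v < N, t v ≠ 0 → 1 ≤ e v ∧ e v ≤ t v
  inj : ∀ u < N, ∀ v < N, t u ≠ 0 → t u = t v → u = v
  clock : T ≤ ((range N).filter fun v => t v ≠ 0).card + 1
  sound : ∀ B κ D, IsBarrier N R f B κ D → ∀ v < N, t v ≠ 0 →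
    D v ∧ (∃ u < N, t u = e v ∧ κ u = κ v) ∧
      ∀ u < N, D u → (f u = u ∨ f u ∈ B) → κ u = κ v → t u ≠ 0 ∧ t u ≤ t v

/-- The quantity that decreases with each step of the search. -/
def searchPotential (N : ℕ) (t e : ℕ → ℕ) : ℕ :=
  ∑ v ∈ range N, if t v = 0 then N + 2 else e v

namespace Search

variable {N : ℕ} {R : ℕ → ℕ → Prop} {f t e : ℕ → ℕ} {T : ℕ}

theorem clock_le (h : Search N R f t e T) : T ≤ N + 1 := by
  have := h.clock
  have := Finset.card_filter_le (range N) fun v => t v ≠ 0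
  simp only [card_range] at this
  omega

theorem potential_le (h : Search N R f t e T) : searchPotential N t e ≤ N * (N + 2) := by
  have : searchPotential N t e ≤ ∑ _v ∈ range N, (N + 2) := by
    apply Finset.sum_le_sum
    intro v hv
    have hv := mem_range.1 hv
    split_ifs with h0
    · exact le_rfl
    · have := h.lab v hv h0
      have := h.lt v hv
      have := h.clock_le
      omega
  simpa using this

/-- The new vertex is its own label witness. The base of its class has been entered by time `T`:
either it is `z` itself, by uniqueness, or an entered vertex of the same class guarantees it. The
potential drops because `N + 2` exceeds every clock value. -/
theorem enter (h : Search N R f t e T) {z : ℕ} (hz : z < N) (h0 : t z = 0)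
    (hD : ∀ B κ D, IsBarrier N R f B κ D → D z ∧ ((f z = z ∨ f z ∈ B) ∨
      ∃ x < N, t x ≠ 0 ∧ κ x = κ z)) :
    Search N R f (Function.update t z T) (Function.update e z T) (T + 1) ∧
      searchPotential N (Function.update t z T) (Function.update e z T) < searchPotential N t e := by
  have hT := h.pos
  refine ⟨⟨by omega, ?_, ?_, ?_, ?_, ?_⟩, ?_⟩
  · intro v hv
    have := h.lt v hv
    by_cases e1 : v = z
    · simp [e1]
    · simp [e1]; omega
  · intro v hv
    by_cases e1 : v = z
    · simp [e1, hT]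
    · simpa [e1] using h.lab v hv
  · intro u hu v hv
    have h1 := h.lt u hu
    have h2 := h.lt v hv
    by_cases e1 : u = z <;> by_cases e2 : v = z
    · simp [e1, e2]
    · simp [e1, e2]; omega
    · simp [e1, e2]; omega
    · simpa [e1, e2] using h.inj u hu v hv
  · have h1 := h.clock
    have : (insert z ((range N).filter fun v => t v ≠ 0)) ⊆
        (range N).filter fun v => Function.update t z T v ≠ 0 := by
      intro v hv
      simp only [mem_insert, mem_filter, mem_range] at hv ⊢
      by_cases e1 : v = z
      · subst e1
        exact ⟨hz, by simp; omega⟩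
      · simpa [e1] using hv
    have h2 := Finset.card_le_card this
    rw [Finset.card_insert_of_notMem (by simp [h0])] at h2
    omega
  · intro B κ D hB v hv hvt
    obtain ⟨hDz, hz'⟩ := hD B κ D hB
    by_cases e1 : v = z
    · subst e1
      refine ⟨hDz, ⟨v, hv, by simp, rfl⟩, fun u hu hDu hbu hκ => ?_⟩
      rcases hz' with hz' | ⟨x, hx, hxt, hxκ⟩
      · have := hB.base_unique u v hDu hDz hκ hbu hz'
        subst this
        simp; omega
      · obtain ⟨_, _, h3⟩ := h.sound B κ D hB x hx hxt
        obtain ⟨h4, h5⟩ := h3 u hu hDu hbu (hκ.trans hxκ.symm)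
        have := h.lt x hx
        have hne : u ≠ v := fun e => h4 (e ▸ h0)
        simp [hne]; omega
    · simp only [ne_eq, e1, not_false_eq_true, Function.update_of_ne] at hvt ⊢
      obtain ⟨h1, ⟨u, hu, hut, hκ⟩, h3⟩ := h.sound B κ D hB v hv hvt
      refine ⟨h1, ⟨u, hu, ?_, hκ⟩, fun w hw hDw hbw hκw => ?_⟩
      · have hne : u ≠ z := by
          rintro rfl
          have := h.lab v hv hvt
          omega
        simpa [hne] using hut
      · obtain ⟨h4, h5⟩ := h3 w hw hDw hbw hκw
        have hne : w ≠ z := fun e => h4 (e ▸ h0)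
        simpa [hne] using ⟨h4, h5⟩
  · apply Finset.sum_lt_sum
    · intro v hv
      by_cases e1 : v = z
      · have := h.clock_le
        simp [e1, h0]
        split_ifs <;> omega
      · simp [e1]
    · refine ⟨z, mem_range.2 hz, ?_⟩
      have := h.clock_le
      simp [h0]
      split_ifs <;> omega

/-- If `y` lies in `B`, its mate is a base. Otherwise `y` lies in the class of `x`, whose base has
already been entered, so `y` is not the base and its mate stays in the class. -/
theorem enter_of_adj (hR : IsGraph N R) (hf : IsMate R f) (h : Search N R f t e T)
    {x y : ℕ} (hxy : R x y) (hx : t x ≠ 0) (hy : t y = 0) :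
    ∀ B κ D, IsBarrier N R f B κ D → D (f y) ∧ ((f (f y) = f y ∨ f (f y) ∈ B) ∨
      ∃ x < N, t x ≠ 0 ∧ κ x = κ (f y)) := by
  intro B κ D hB
  have hxN := hR.lt _ _ hxy
  have hyN := hR.lt' hxy
  obtain ⟨hDx, -, hbase⟩ := h.sound B κ D hB x hxN hx
  rcases hB.adj x y hDx hxy with h1 | ⟨h1, h2⟩
  · exact ⟨hB.mate y h1, .inl (.inr (by rwa [hf.inv]))⟩
  · have h3 : ¬ (f y = y ∨ f y ∈ B) := fun h3 => (hbase y hyN h1 h3 h2.symm).1 hy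
    push Not at h3
    rcases hB.adj y (f y) h1 (hf.adj h3.1) with h4 | ⟨h4, h5⟩
    · exact absurd h4 h3.2
    · exact ⟨h4, .inr ⟨x, hxN, hx, h2.trans h5⟩⟩

/-- A label below the entry time points to an earlier vertex of the same class, and the base of that
class was entered no later than that vertex. -/
theorem not_base (h : Search N R f t e T) {x : ℕ} (hxN : x < N) (hx : e x < t x)
    {B κ D} (hB : IsBarrier N R f B κ D) : ¬ (f x = x ∨ f x ∈ B) := by
  intro h3
  have hx0 : t x ≠ 0 := by omega
  obtain ⟨hDx, ⟨u, hu, hut, hκ⟩, -⟩ := h.sound B κ D hB x hxN hx0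
  have := h.lab x hxN hx0
  obtain ⟨-, -, h4⟩ := h.sound B κ D hB u hu (by omega)
  have := h4 x hxN hDx h3 hκ.symm
  omega

theorem enter_of_lt (hf : IsMate R f) (h : Search N R f t e T)
    {x : ℕ} (hxN : x < N) (hx : e x < t x) :
    ∀ B κ D, IsBarrier N R f B κ D → D (f x) ∧ ((f (f x) = f x ∨ f (f x) ∈ B) ∨
      ∃ u < N, t u ≠ 0 ∧ κ u = κ (f x)) := by
  intro B κ D hB
  have h3 := h.not_base hxN hx hB
  have hx0 : t x ≠ 0 := by omega
  obtain ⟨hDx, -, -⟩ := h.sound B κ D hB x hxN hx0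
  push Not at h3
  rcases hB.adj x (f x) hDx (hf.adj h3.1) with h4 | ⟨h4, h5⟩
  · exact absurd h4 h3.2
  · exact ⟨h4, .inr ⟨x, hxN, hx0, h5⟩⟩

/-- Entered vertices lie in the odd classes, outside every barrier set, so an edge between two of
them stays within one class and the smaller label remains valid for both. -/
theorem relabel (hR : IsGraph N R) (h : Search N R f t e T) {x y : ℕ} (hxy : R x y)
    (hx : t x ≠ 0) (hy : t y ≠ 0) (hlt : e x < e y) :
    Search N R f t (Function.update e y (e x)) T ∧
      searchPotential N t (Function.update e y (e x)) < searchPotential N t e := by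
  have hxN := hR.lt _ _ hxy
  have hyN := hR.lt' hxy
  refine ⟨⟨h.pos, h.lt, ?_, h.inj, h.clock, ?_⟩, ?_⟩
  · intro v hv hvt
    by_cases e1 : v = y
    · subst e1
      have := h.lab _ hv hvt
      have := h.lab _ hxN hx
      simp only [Function.update_self]
      omega
    · simpa [e1] using h.lab v hv hvt
  · intro B κ D hB v hv hvt
    obtain ⟨h1, h2, h3⟩ := h.sound B κ D hB v hv hvt
    refine ⟨h1, ?_, h3⟩
    by_cases e1 : v = y
    · subst e1
      obtain ⟨h4, ⟨u, hu, hut, hκ⟩, -⟩ := h.sound B κ D hB x hxN hx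
      refine ⟨u, hu, by simpa using hut, ?_⟩
      rcases hB.adj x v h4 hxy with h5 | ⟨-, h5⟩
      · exact absurd h5 (hB.notMem v h1)
      · exact hκ.trans h5
    · simpa [e1] using h2
  · apply Finset.sum_lt_sum
    · intro v hv
      by_cases e1 : v = y
      · subst e1
        simp [hy, hlt.le]
      · simp [e1]
    · refine ⟨y, mem_range.2 hyN, by simp [hy, hlt]⟩

/-- A maximum matching has a barrier, and for it an unsaturated vertex is a base, which `not_base`
forbids for a vertex labelled below its entry time. -/
theorem le_of_optimal (hR : IsGraph N R) (hf : IsMate R f) (h : Search N R f t e T)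
    (hopt : (exposed N f).card = deficiency N R) {v : ℕ} (hv : v < N) (hfv : f v = v) :
    t v ≤ e v := by
  obtain ⟨B, κ, D, hB⟩ := exists_isBarrier hR hf hopt
  by_contra hlt
  exact h.not_base hv (by omega) hB (.inl hfv)

/-- A completed search without a contradiction certifies that the matching is maximum. -/
theorem optimal (hR : IsGraph N R) (hf : IsMate R f) (h : Search N R f t e T)
    (hexp : ∀ v < N, f v = v → t v ≠ 0)
    (hadj : ∀ x y, R x y → t x ≠ 0 → (t y = 0 → t (f y) ≠ 0) ∧ (t y ≠ 0 → e y ≤ e x))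
    (hlt : ∀ x y, R x y → e x < t x → t (f x) ≠ 0)
    (hle : ∀ v < N, f v = v → t v ≤ e v) : (exposed N f).card = deficiency N R := by
  classical
  refine le_antisymm ?_ (deficiency_le hf)
  obtain ⟨g, hg, hgd⟩ := exists_deficiency N R
  rw [← hgd]
  have heq : ∀ x y, R x y → t x ≠ 0 → t y ≠ 0 → e x = e y := fun x y hxy hx hy =>
    le_antisymm ((hadj y x (hR.symm _ _ hxy) hy).2 hx) ((hadj x y hxy hx).2 hy)
  -- `X` serves as the barrier set, `bs` as the set of bases and `C b` as the class of `b`. The goal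
  -- is |exposed f| + |X| ≤ |bs| ≤ |exposed g| + |X|.
  let X := (range N).filter fun y => t y = 0 ∧ ∃ x, t x ≠ 0 ∧ R x y
  let bs := (range N).filter fun x => t x ≠ 0 ∧ (f x = x ∨ t (f x) = 0)
  let C : ℕ → Finset ℕ := fun b => (range N).filter fun x => t x ≠ 0 ∧ e x = t b
  have hbs : ∀ b ∈ bs, e b = t b := by
    intro b hb
    obtain ⟨hbN, hbt, hb'⟩ := by simpa [bs] using hb
    have h1 := h.lab b hbN hbt
    by_contra hne
    rcases hb' with hb' | hb'
    · have := hle b hbN hb'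
      omega
    · by_cases hb2 : f b = b
      · rw [hb2] at hb'; exact hbt hb'
      · exact hlt b (f b) (hf.adj hb2) (by omega) hb'
  have hodd : ∀ b ∈ bs, Odd (C b).card := by
    intro b hb
    obtain ⟨hbN, hbt, hb'⟩ := by simpa [bs] using hb
    have hbC : b ∈ C b := by simp [C, hbN, hbt, hbs b hb]
    -- A base carries its own entry time as label and entry times are distinct, so `b` is the only
    -- base in its class and `f` pairs up the rest.
    have heven : Even ((C b).erase b).card := by
      apply even_card_of_involution hf.1
      intro x hx
      obtain ⟨hxb, hxN, hxt, hxe⟩ := by simpa [C] using hx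
      have hxbs : x ∉ bs := by
        intro hx'
        have := hbs x hx'
        exact hxb (h.inj x hxN b hbN hxt (by omega))
      have hx2 : f x ≠ x ∧ t (f x) ≠ 0 := by
        simpa [bs, hxN, hxt] using hxbs
      refine ⟨hx2.1, ?_⟩
      have := heq x (f x) (hf.adj hx2.1) hxt hx2.2
      simp only [C, mem_erase, mem_filter, mem_range]
      refine ⟨?_, hf.lt hR hxN, hx2.2, by omega⟩
      rintro e1
      rw [← e1, hf.inv] at hb'
      rcases hb' with hb' | hb'
      · exact hx2.1 hb'.symm
      · exact hxt hb'
    have := Finset.card_erase_add_one hbC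
    rw [← this]
    exact heven.add_one
  have h1 : ((exposed N f).disjSum X).card ≤ bs.card := by
    apply Finset.card_le_card_of_injOn (Sum.elim id f)
    · intro s hs
      rcases s with v | y
      · have hv := mem_exposed.1 (inl_mem_disjSum.1 hs)
        simp [bs, hv.1, hv.2, hexp v hv.1 hv.2]
      · obtain ⟨hyN, hy0, x, hx, hxy⟩ := by simpa [X] using hs
        simp [bs, hf.lt hR hyN, hf.inv, hy0, (hadj x y hxy hx).1 hy0]
    · intro s hs s' hs' e1
      rcases s with v | y <;> rcases s' with v' | y'
      · simpa using e1
      · have hv := mem_exposed.1 (inl_mem_disjSum.1 hs)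
        obtain ⟨hyN, hy0, x, hx, hxy⟩ := by simpa [X] using hs'
        simp only [Sum.elim_inl, Sum.elim_inr, id] at e1
        have : v = y' := by rw [← hv.2, e1, hf.inv]
        rw [← this] at hy0
        exact absurd hy0 (hexp v hv.1 hv.2)
      · have hv := mem_exposed.1 (inl_mem_disjSum.1 hs')
        obtain ⟨hyN, hy0, x, hx, hxy⟩ := by simpa [X] using hs
        simp only [Sum.elim_inl, Sum.elim_inr, id] at e1
        have : v' = y := by rw [← hv.2, ← e1, hf.inv]
        rw [← this] at hy0
        exact absurd hy0 (hexp v' hv.1 hv.2)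
      · simp only [Sum.elim_inr] at e1
        rw [hf.inj e1]
  choose! x hx using fun b (hb : b ∈ bs) => exists_escape hg.1 (hodd b hb)
  -- Each odd class contains a vertex that `g` leaves unsaturated or matches out of the class.
  -- Labels agree along edges between entered vertices, so in the second case the mate lies in `X`.
  have h2 : bs.card ≤ ((exposed N g).disjSum X).card := by
    apply Finset.card_le_card_of_injOn
      (fun b => if g (x b) = x b then Sum.inl (x b) else Sum.inr (g (x b)))
    · intro b hb
      obtain ⟨h3, h4⟩ := hx b hb
      obtain ⟨hxN, hxt, hxe⟩ := by simpa [C] using h3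
      by_cases h5 : g (x b) = x b
      · simp [h5, mem_exposed, hxN]
      · simp only [h5, if_false, mem_coe, inr_mem_disjSum, X, mem_filter, mem_range]
        have h6 : t (g (x b)) = 0 := by
          by_contra h6
          have h7 := heq _ _ (hg.adj h5) hxt h6
          rcases h4 with h4 | h4
          · exact h5 h4
          · exact h4 (by simp [C, hg.lt hR hxN, h6, ← h7, hxe])
        exact ⟨hg.lt hR hxN, h6, x b, hxt, hg.adj h5⟩
    · intro b hb b' hb' e1
      obtain ⟨hbN, hbt, -⟩ := by simpa [bs] using hb
      obtain ⟨hbN', -, -⟩ := by simpa [bs] using hb'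
      obtain ⟨-, -, hxe⟩ := by simpa [C] using (hx b hb).1
      obtain ⟨-, -, hxe'⟩ := by simpa [C] using (hx b' hb').1
      have : x b = x b' := by
        simp only at e1
        split_ifs at e1
        · exact Sum.inl.inj e1
        · exact hg.inj (Sum.inr.inj e1)
      rw [this] at hxe
      exact h.inj b hbN b' hbN' hbt (by omega)
  rw [Finset.card_disjSum] at h1 h2
  omega

end Search

end MatchingGap

/-! ### Time-bounded runs, loop invariants and memory frames -/

namespace MatchingGap

/-- `p` runs from `s` to `s'` in time at most `T`. -/
def RunsIn (p : Program) (s s' : Memory) (T : ℕ) : Prop := ∃ t ≤ T, Runs p s s' t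

theorem RunsIn.mono {p : Program} {s s' : Memory} {T T' : ℕ} (h : RunsIn p s s' T) (hT : T ≤ T') :
    RunsIn p s s' T' := by
  obtain ⟨t, ht, h⟩ := h
  exact ⟨t, ht.trans hT, h⟩

theorem RunsIn.seq {p q : Program} {s s' s'' : Memory} {T T' : ℕ} (h : RunsIn p s s' T)
    (h' : RunsIn q s' s'' T') : RunsIn (.seq p q) s s'' (T + T') := by
  obtain ⟨t, ht, h⟩ := h
  obtain ⟨t', ht', h'⟩ := h'
  exact ⟨t + t', Nat.add_le_add ht ht', .seq h h'⟩

theorem RunsIn.ite_true {e : Expr} {p q : Program} {s s' : Memory} {T : ℕ} (he : e.eval s ≠ 0)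
    (h : RunsIn p s s' T) : RunsIn (.ite e p q) s s' (e.cost + 1 + T) := by
  obtain ⟨t, ht, h⟩ := h
  exact ⟨_, Nat.add_le_add_left ht _, .ite_true he h⟩

theorem RunsIn.ite_false {e : Expr} {p q : Program} {s s' : Memory} {T : ℕ} (he : e.eval s = 0)
    (h : RunsIn q s s' T) : RunsIn (.ite e p q) s s' (e.cost + 1 + T) := by
  obtain ⟨t, ht, h⟩ := h
  exact ⟨_, Nat.add_le_add_left ht _, .ite_false he h⟩

/-- A loop with invariant `I` and variant `V`. -/
theorem RunsIn.loop {e : Expr} {p : Program} {I : Memory → Prop} {V : Memory → ℕ} {T : ℕ}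
    (h : ∀ s, I s → e.eval s ≠ 0 → ∃ s', RunsIn p s s' T ∧ I s' ∧ V s' < V s) {s : Memory}
    (hs : I s) : ∃ s', RunsIn (.loop e p) s s' ((V s + 1) * (T + e.cost + 1)) ∧ I s' ∧
      e.eval s' = 0 := by
  induction hV : V s using Nat.strong_induction_on generalizing s with
  | _ m ih =>
    by_cases he : e.eval s = 0
    · refine ⟨s, ⟨e.cost + 1, ?_, .loop_done he⟩, hs, he⟩
      calc e.cost + 1 ≤ 1 * (T + e.cost + 1) := by omega
        _ ≤ _ := Nat.mul_le_mul_right _ (by omega)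
    · obtain ⟨s₁, ⟨t₁, ht₁, hr⟩, hI, hlt⟩ := h s hs he
      obtain ⟨s₂, ⟨t₂, ht₂, hr₂⟩, hI₂, he₂⟩ := ih _ (hV ▸ hlt) hI rfl
      refine ⟨s₂, ⟨_, ?_, .loop_step he hr hr₂⟩, hI₂, he₂⟩
      have h1 : (V s₁ + 1) * (T + e.cost + 1) ≤ m * (T + e.cost + 1) :=
        Nat.mul_le_mul_right _ (by omega)
      rw [Nat.add_mul]
      omega

/-- The effect of a program without loops. -/
def Program.exec : Program → Memory → Memory
  | .skip, s => s
  | .setReg x e, s => s.setReg x (e.eval s)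
  | .setArr a i e, s => s.setArr a (i.eval s) (e.eval s)
  | .seq p q, s => q.exec (p.exec s)
  | .ite e p q, s => if e.eval s = 0 then q.exec s else p.exec s
  | .loop _ _, s => s

/-- Programs without loops. -/
def Program.LoopFree : Program → Prop
  | .seq p q => p.LoopFree ∧ q.LoopFree
  | .ite _ p q => p.LoopFree ∧ q.LoopFree
  | .loop _ _ => False
  | _ => True

/-- A bound for the running time of a program without loops. -/
def Program.time : Program → ℕ
  | .skip => 1
  | .setReg _ e => e.cost + 1
  | .setArr _ i e => i.cost + e.cost + 1
  | .seq p q => p.time + q.time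
  | .ite e p q => e.cost + 1 + (p.time + q.time)
  | .loop _ _ => 0

theorem Program.runsIn_exec {p : Program} (hp : p.LoopFree) (s : Memory) :
    RunsIn p s (p.exec s) p.time := by
  induction p generalizing s with
  | skip => exact ⟨1, le_rfl, .skip s⟩
  | setReg x e => exact ⟨_, le_rfl, .setReg x e s⟩
  | setArr a i e => exact ⟨_, le_rfl, .setArr a i e s⟩
  | seq p q ihp ihq => exact (ihp hp.1 s).seq (ihq hp.2 _)
  | ite e p q ihp ihq =>
    by_cases he : e.eval s = 0
    · simp only [Program.exec, he, if_true]
      exact (RunsIn.ite_false he (ihq hp.2 s)).mono (by simp only [Program.time]; omega)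
    · simp only [Program.exec, he, if_false]
      exact (RunsIn.ite_true he (ihp hp.1 s)).mono (by simp only [Program.time]; omega)
  | loop e p => exact hp.elim

/-- A loop whose body has no loops. -/
theorem RunsIn.loop_exec {e : Expr} {p : Program} (hp : p.LoopFree) {I : Memory → Prop}
    {V : Memory → ℕ}
    (h : ∀ s, I s → e.eval s ≠ 0 → I (p.exec s) ∧ V (p.exec s) < V s) {s : Memory}
    (hs : I s) : ∃ s', RunsIn (.loop e p) s s' ((V s + 1) * (p.time + e.cost + 1)) ∧ I s' ∧
      e.eval s' = 0 :=
  RunsIn.loop (fun s hI he => ⟨p.exec s, p.runsIn_exec hp s, h s hI he⟩) hs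

@[simp] theorem Memory.setReg_reg (s : Memory) (x v y : ℕ) :
    (s.setReg x v).reg y = if y = x then v else s.reg y := by
  simp [Memory.setReg, Function.update_apply]

@[simp] theorem Memory.setReg_arr (s : Memory) (x v : ℕ) : (s.setReg x v).arr = s.arr := rfl

@[simp] theorem Memory.setArr_reg (s : Memory) (a i v : ℕ) : (s.setArr a i v).reg = s.reg := rfl

@[simp] theorem Memory.setArr_arr (s : Memory) (a i v b : ℕ) :
    (s.setArr a i v).arr b = if b = a then Function.update (s.arr a) i v else s.arr b := by
  by_cases hb : b = a
  · subst hb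
    simp [Memory.setArr]
  · simp [Memory.setArr, hb]

/-- The registers below `x` and the arrays below `a` agree. -/
def Agree (x a : ℕ) (s s' : Memory) : Prop :=
  (∀ y < x, s'.reg y = s.reg y) ∧ ∀ b < a, ∀ j, s'.arr b j = s.arr b j

theorem Agree.refl (x a : ℕ) (s : Memory) : Agree x a s s := ⟨fun _ _ => rfl, fun _ _ _ => rfl⟩

theorem Agree.trans {x a : ℕ} {s s' s'' : Memory} (h : Agree x a s s') (h' : Agree x a s' s'') :
    Agree x a s s'' :=
  ⟨fun y hy => (h'.1 y hy).trans (h.1 y hy), fun b hb j => (h'.2 b hb j).trans (h.2 b hb j)⟩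

theorem Agree.mono {x a x' a' : ℕ} {s s' : Memory} (h : Agree x a s s') (hx : x' ≤ x)
    (ha : a' ≤ a) : Agree x' a' s s' :=
  ⟨fun y hy => h.1 y (hy.trans_le hx), fun b hb j => h.2 b (hb.trans_le ha) j⟩

theorem Agree.setReg {x a y : ℕ} (s : Memory) (v : ℕ) (hy : x ≤ y) : Agree x a s (s.setReg y v) :=
  ⟨fun z hz => by simp; omega, fun _ _ _ => rfl⟩

theorem Agree.setArr {x a b : ℕ} (s : Memory) (i v : ℕ) (hb : a ≤ b) :
    Agree x a s (s.setArr b i v) :=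
  ⟨fun _ _ => rfl, fun c hc j => by rw [Memory.setArr_arr, if_neg (by omega)]⟩

/-- The registers that a program assigns are at least `x`, the arrays at least `a`. -/
def Program.WritesFrom (x a : ℕ) : Program → Prop
  | .skip => True
  | .setReg y _ => x ≤ y
  | .setArr b _ _ => a ≤ b
  | .seq p q => p.WritesFrom x a ∧ q.WritesFrom x a
  | .ite _ p q => p.WritesFrom x a ∧ q.WritesFrom x a
  | .loop _ p => p.WritesFrom x a

theorem Runs.agree {x a : ℕ} {p : Program} {s s' : Memory} {t : ℕ} (h : Runs p s s' t)
    (hp : p.WritesFrom x a) : Agree x a s s' := by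
  induction h with
  | skip s => exact Agree.refl _ _ _
  | setReg y e s => exact Agree.setReg _ _ hp
  | setArr b i e s => exact Agree.setArr _ _ _ hp
  | seq _ _ ih ih' => exact (ih hp.1).trans (ih' hp.2)
  | ite_true _ _ ih => exact ih hp.1
  | ite_false _ _ ih => exact ih hp.2
  | loop_done _ => exact Agree.refl _ _ _
  | loop_step _ _ _ ih ih' => exact (ih hp).trans (ih' hp)

theorem RunsIn.agree {x a : ℕ} {p : Program} {s s' : Memory} {T : ℕ} (h : RunsIn p s s' T)
    (hp : p.WritesFrom x a) : Agree x a s s' := by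
  obtain ⟨t, _, h⟩ := h
  exact h.agree hp

theorem Program.agree_exec {x a : ℕ} {p : Program} (hl : p.LoopFree) (hp : p.WritesFrom x a)
    (s : Memory) : Agree x a s (p.exec s) := (Program.runsIn_exec hl s).agree hp

end MatchingGap

/-! ### The search as a program -/

namespace MatchingGap
open Finset

/-! Conventions for the arrays: `3` and `4` hold the endpoints of the edge slots, `5` their flags,
`6` the mates, `7` the flags of the edges in use, `9` and `10` the entry times and labels of the
search. Register `16` holds the number of slots, register `17` the number of vertices. -/

/-- The edges in the slots that are flagged in array `h`. -/
def slotRel (s : Memory) (h : ℕ) (u v : ℕ) : Prop :=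
  ∃ p < s.reg 16, s.arr h p ≠ 0 ∧
    ((s.arr 3 p = u ∧ s.arr 4 p = v) ∨ (s.arr 3 p = v ∧ s.arr 4 p = u))

/-- The slots contain edges between vertices. -/
def ValidSlots (s : Memory) (h : ℕ) : Prop :=
  ∀ p < s.reg 16, s.arr 3 p < s.reg 17 ∧ s.arr 4 p < s.reg 17 ∧
    (s.arr h p ≠ 0 → s.arr 3 p ≠ s.arr 4 p)

theorem ValidSlots.isGraph {s : Memory} {h : ℕ} (hs : ValidSlots s h) :
    IsGraph (s.reg 17) (slotRel s h) where
  symm := by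
    rintro u v ⟨p, hp, h1, h2⟩
    exact ⟨p, hp, h1, h2.symm⟩
  ne := by
    rintro u v ⟨p, hp, h1, ⟨rfl, rfl⟩ | ⟨rfl, rfl⟩⟩
    · exact (hs p hp).2.2 h1
    · exact ((hs p hp).2.2 h1).symm
  lt := by
    rintro u v ⟨p, hp, h1, ⟨rfl, rfl⟩ | ⟨rfl, rfl⟩⟩
    · exact (hs p hp).1
    · exact (hs p hp).2.1

/-- The mate function in array `6`. -/
def mateFn (s : Memory) (v : ℕ) : ℕ := if v < s.reg 17 then s.arr 6 v else v

theorem mateFn_of_lt {s : Memory} {v : ℕ} (hv : v < s.reg 17) : mateFn s v = s.arr 6 v := if_pos hv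

theorem Agree.slotRel {x a h : ℕ} {s s' : Memory} (hs : Agree x a s s') (hx : 16 < x) (ha : 4 < a)
    (hh : h < a) : slotRel s' h = slotRel s h := by
  funext u v
  simp only [MatchingGap.slotRel, hs.1 16 hx, hs.2 h hh, hs.2 3 (by omega), hs.2 4 ha]

theorem Agree.validSlots {x a h : ℕ} {s s' : Memory} (hs : Agree x a s s') (hx : 17 < x)
    (ha : 4 < a) (hh : h < a) : ValidSlots s' h ↔ ValidSlots s h := by
  simp only [ValidSlots, hs.1 16 (by omega), hs.1 17 hx, hs.2 h hh, hs.2 3 (by omega), hs.2 4 ha]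

theorem Agree.mateFn {x a : ℕ} {s s' : Memory} (hs : Agree x a s s') (hx : 17 < x) (ha : 6 < a) :
    mateFn s' = mateFn s := by
  funext v
  simp only [MatchingGap.mateFn, hs.1 17 hx, hs.2 6 ha]

/-- Set the cells of array `a` below the value of register `b` to `0`, with counter `i`. -/
def clearCode (a b i : ℕ) : Program :=
  .seq (.setReg i (.const 0)) (.loop (.sub (.reg b) (.reg i))
    (.seq (.setArr a (.reg i) (.const 0)) (.setReg i (.add (.reg i) (.const 1)))))

theorem runsIn_clearCode {a b i : ℕ} (hbi : b ≠ i) (s : Memory) :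
    ∃ s', RunsIn (clearCode a b i) s s' (11 * s.reg b + 13) ∧ ∀ v < s.reg b, s'.arr a v = 0 := by
  obtain ⟨s', hr, ⟨hb, hi, h⟩, he⟩ := RunsIn.loop_exec (e := .sub (.reg b) (.reg i))
    (p := .seq (.setArr a (.reg i) (.const 0)) (.setReg i (.add (.reg i) (.const 1))))
    (by simp [Program.LoopFree])
    (I := fun s' => s'.reg b = s.reg b ∧ s'.reg i ≤ s.reg b ∧ ∀ v < s'.reg i, s'.arr a v = 0)
    (V := fun s' => s.reg b - s'.reg i) (by
      rintro s' ⟨h1, h2, h3⟩ he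
      simp only [Expr.eval, h1] at he
      refine ⟨⟨by simp [Program.exec, hbi, h1], by simp [Program.exec, Expr.eval]; omega, ?_⟩,
        by simp [Program.exec, Expr.eval]; omega⟩
      intro v hv
      simp only [Program.exec, Expr.eval, Memory.setReg_reg, if_true, Memory.setArr_reg] at hv
      simp only [Program.exec, Expr.eval, Memory.setReg_arr, Memory.setArr_arr, if_true,
        Function.update_apply]
      split_ifs
      · rfl
      · exact h3 v (by omega))
    (s := s.setReg i 0) (by simp [hbi])
  simp only [Expr.eval, hb] at he
  refine ⟨s', ((Program.runsIn_exec (p := .setReg i (.const 0)) trivial s).seq hr).mono ?_,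
    fun v hv => h v (by omega)⟩
  simp [Program.time, Expr.cost]
  omega

/-- Enter the vertex in register `36` into the search. -/
def enterCode : Program :=
  .ite (.arr 9 (.reg 36)) .skip
    (.seq (.setArr 9 (.reg 36) (.reg 31)) (.seq (.setArr 10 (.reg 36) (.reg 31))
      (.seq (.setReg 31 (.add (.reg 31) (.const 1))) (.setReg 35 (.const 1)))))

/-- The step of the search along the edge from register `x` to register `y`. -/
def edgeCode (x y : ℕ) : Program :=
  .ite (.arr 9 (.reg x))
    (.ite (.arr 9 (.reg y))
      (.ite (.sub (.arr 10 (.reg y)) (.arr 10 (.reg x)))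
        (.seq (.setArr 10 (.reg y) (.arr 10 (.reg x))) (.setReg 35 (.const 1))) .skip)
      (.seq (.setReg 36 (.arr 6 (.reg y))) enterCode)) .skip

/-- The step of the search from register `x` to its mate. -/
def mateCode (x : ℕ) : Program :=
  .ite (.sub (.arr 9 (.reg x)) (.arr 10 (.reg x)))
    (.seq (.setReg 36 (.arr 6 (.reg x))) enterCode) .skip

/-- The steps of the search for the slot in register `32`. -/
def slotCode : Program :=
  .seq (.setReg 33 (.arr 3 (.reg 32))) (.seq (.setReg 34 (.arr 4 (.reg 32)))
    (.seq (.setReg 35 (.const 0))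
      (.seq (.ite (.arr 7 (.reg 32))
          (.seq (edgeCode 33 34) (.seq (edgeCode 34 33) (.seq (mateCode 33) (mateCode 34)))) .skip)
        (.ite (.reg 35) (.setReg 32 (.const 0)) (.setReg 32 (.add (.reg 32) (.const 1)))))))

/-- Enter the vertex in register `32` if it is unsaturated. -/
def startCode : Program :=
  .seq (.ite (.add (.sub (.arr 6 (.reg 32)) (.reg 32)) (.sub (.reg 32) (.arr 6 (.reg 32)))) .skip
      (.seq (.setReg 36 (.reg 32)) enterCode))
    (.setReg 32 (.add (.reg 32) (.const 1)))

/-- Look for a contradiction at the vertex in register `32`. -/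
def verdictCode : Program :=
  .seq (.ite (.add (.sub (.arr 6 (.reg 32)) (.reg 32)) (.sub (.reg 32) (.arr 6 (.reg 32)))) .skip
      (.ite (.sub (.arr 9 (.reg 32)) (.arr 10 (.reg 32))) (.setReg 30 (.const 1)) .skip))
    (.setReg 32 (.add (.reg 32) (.const 1)))

/-- Decide whether the mates form a maximum matching of the flagged edges: register `30` becomes
`0` if they do, and `1` otherwise. -/
def testCode : Program :=
  .seq (clearCode 9 17 32) (.seq (.setReg 31 (.const 1)) (.seq (.setReg 32 (.const 0))
    (.seq (.loop (.sub (.reg 17) (.reg 32)) startCode) (.seq (.setReg 32 (.const 0))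
      (.seq (.loop (.sub (.reg 16) (.reg 32)) slotCode) (.seq (.setReg 30 (.const 0))
        (.seq (.setReg 32 (.const 0)) (.loop (.sub (.reg 17) (.reg 32)) verdictCode))))))))

/-- One step of the search: either nothing changes and `C` holds of the entry times and labels, or
the potential decreases. -/
structure SearchStep (N : ℕ) (R : ℕ → ℕ → Prop) (f : ℕ → ℕ) (C : (ℕ → ℕ) → (ℕ → ℕ) → Prop)
    (s s' : Memory) : Prop where
  search : Search N R f (s'.arr 9) (s'.arr 10) (s'.reg 31)
  entered : ∀ v, s.arr 9 v ≠ 0 → s'.arr 9 v ≠ 0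
  progress : (s'.reg 35 = s.reg 35 ∧ s'.arr 9 = s.arr 9 ∧ s'.arr 10 = s.arr 10 ∧
      C (s.arr 9) (s.arr 10)) ∨
    (s'.reg 35 = 1 ∧
      searchPotential N (s'.arr 9) (s'.arr 10) < searchPotential N (s.arr 9) (s.arr 10))

section

variable {N : ℕ} {R : ℕ → ℕ → Prop} {f : ℕ → ℕ} {C C' : (ℕ → ℕ) → (ℕ → ℕ) → Prop}
  {s s' s'' : Memory}

/-- If the first step changes nothing, the condition of the second speaks about the initial arrays.
Otherwise only the decrease of the potential has to be recorded. -/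
theorem SearchStep.trans (h : SearchStep N R f C s s') (h' : SearchStep N R f C' s' s'') :
    SearchStep N R f (fun t e => C t e ∧ C' t e) s s'' where
  search := h'.search
  entered := fun v hv => h'.entered v (h.entered v hv)
  progress := by
    rcases h.progress with ⟨a1, a2, a3, a4⟩ | ⟨a1, a2⟩ <;>
    rcases h'.progress with ⟨b1, b2, b3, b4⟩ | ⟨b1, b2⟩
    · exact .inl ⟨b1.trans a1, b2.trans a2, b3.trans a3, a4, by rwa [a2, a3] at b4⟩
    · exact .inr ⟨b1, by rw [← a2, ← a3]; exact b2⟩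
    · exact .inr ⟨b1.trans a1, by rw [b2, b3]; exact a2⟩
    · exact .inr ⟨b1, b2.trans a2⟩

theorem SearchStep.imp (h : SearchStep N R f C s s')
    (hC : C (s.arr 9) (s.arr 10) → C' (s.arr 9) (s.arr 10)) : SearchStep N R f C' s s' where
  search := h.search
  entered := h.entered
  progress := h.progress.imp (fun ⟨h1, h2, h3, h4⟩ => ⟨h1, h2, h3, hC h4⟩) id

theorem SearchStep.refl (h : Search N R f (s.arr 9) (s.arr 10) (s.reg 31))
    (hC : C (s.arr 9) (s.arr 10)) : SearchStep N R f C s s :=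
  ⟨h, fun _ hv => hv, .inl ⟨rfl, rfl, rfl, hC⟩⟩

end

section

variable {N : ℕ} {R : ℕ → ℕ → Prop} {f : ℕ → ℕ} {s : Memory}

theorem searchStep_enterCode (h : Search N R f (s.arr 9) (s.arr 10) (s.reg 31)) {z : ℕ}
    (hz : z < N) (hD : s.arr 9 z = 0 → ∀ B κ D, IsBarrier N R f B κ D → D z ∧
      ((f z = z ∨ f z ∈ B) ∨ ∃ x < N, s.arr 9 x ≠ 0 ∧ κ x = κ z)) :
    SearchStep N R f (fun t _ => t z ≠ 0) s (enterCode.exec (s.setReg 36 z)) := by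
  by_cases h0 : s.arr 9 z = 0
  · obtain ⟨h1, h2⟩ := h.enter hz h0 (hD h0)
    refine ⟨?_, fun v hv => ?_, .inr ?_⟩
    · simpa [enterCode, Program.exec, Expr.eval, h0] using h1
    · have := h.pos
      by_cases e : v = z
      · simp [enterCode, Program.exec, Expr.eval, h0, e]; omega
      · simpa [enterCode, Program.exec, Expr.eval, h0, e] using hv
    · simpa [enterCode, Program.exec, Expr.eval, h0] using h2
  · have e : enterCode.exec (s.setReg 36 z) = s.setReg 36 z := by
      simp [enterCode, Program.exec, Expr.eval, h0]
    rw [e]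
    exact ⟨by simpa using h, fun v hv => by simpa using hv, .inl (by simp [h0])⟩

theorem searchStep_edgeCode (hR : IsGraph N R) (hf : IsMate R f)
    (hsf : ∀ v < N, s.arr 6 v = f v) (h : Search N R f (s.arr 9) (s.arr 10) (s.reg 31)) {x y : ℕ}
    (hxy : R (s.reg x) (s.reg y)) :
    SearchStep N R f (fun t e => t (s.reg x) ≠ 0 →
      (t (s.reg y) = 0 → t (f (s.reg y)) ≠ 0) ∧ (t (s.reg y) ≠ 0 → e (s.reg y) ≤ e (s.reg x)))
      s ((edgeCode x y).exec s) := by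
  have hyN := hR.lt' hxy
  by_cases hx : s.arr 9 (s.reg x) = 0
  · have e : (edgeCode x y).exec s = s := by simp [edgeCode, Program.exec, Expr.eval, hx]
    rw [e]
    exact SearchStep.refl h fun h' => absurd hx h'
  · by_cases hy : s.arr 9 (s.reg y) = 0
    · have e : (edgeCode x y).exec s = enterCode.exec (s.setReg 36 (f (s.reg y))) := by
        rw [← hsf _ hyN]
        simp [edgeCode, Program.exec, Expr.eval, hx, hy]
      rw [e]
      refine (searchStep_enterCode h (hf.lt hR hyN) fun _ => h.enter_of_adj hR hf hxy hx hy).imp ?_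
      exact fun h1 _ => ⟨fun _ => h1, fun h2 => absurd hy h2⟩
    · by_cases hlt : s.arr 10 (s.reg x) < s.arr 10 (s.reg y)
      · have e : (edgeCode x y).exec s =
            (s.setArr 10 (s.reg y) (s.arr 10 (s.reg x))).setReg 35 1 := by
          have : s.arr 10 (s.reg y) - s.arr 10 (s.reg x) ≠ 0 := by omega
          simp [edgeCode, Program.exec, Expr.eval, hx, hy, this]
        rw [e]
        obtain ⟨h1, h2⟩ := h.relabel hR hxy hx hy hlt
        exact ⟨by simpa using h1, fun v hv => by simpa using hv, .inr (by simpa using h2)⟩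
      · have e : (edgeCode x y).exec s = s := by
          have : s.arr 10 (s.reg y) - s.arr 10 (s.reg x) = 0 := by omega
          simp [edgeCode, Program.exec, Expr.eval, hx, hy, this]
        rw [e]
        exact SearchStep.refl h fun _ => ⟨fun h' => absurd h' hy, fun _ => by omega⟩

theorem searchStep_mateCode (hR : IsGraph N R) (hf : IsMate R f)
    (hsf : ∀ v < N, s.arr 6 v = f v) (h : Search N R f (s.arr 9) (s.arr 10) (s.reg 31)) {x : ℕ}
    (hxN : s.reg x < N) :
    SearchStep N R f (fun t e => e (s.reg x) < t (s.reg x) → t (f (s.reg x)) ≠ 0)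
      s ((mateCode x).exec s) := by
  by_cases hlt : s.arr 10 (s.reg x) < s.arr 9 (s.reg x)
  · have e : (mateCode x).exec s = enterCode.exec (s.setReg 36 (f (s.reg x))) := by
      have : s.arr 9 (s.reg x) - s.arr 10 (s.reg x) ≠ 0 := by omega
      rw [← hsf _ hxN]
      simp [mateCode, Program.exec, Expr.eval, this]
    rw [e]
    exact (searchStep_enterCode h (hf.lt hR hxN) fun _ => h.enter_of_lt hf hxN hlt).imp
      fun h1 _ => h1
  · have e : (mateCode x).exec s = s := by
      have : s.arr 9 (s.reg x) - s.arr 10 (s.reg x) = 0 := by omega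
      simp [mateCode, Program.exec, Expr.eval, this]
    rw [e]
    exact SearchStep.refl h fun h' => absurd h' hlt

end

/-- The search has nothing left to do along the edge `x y`. -/
def EdgeClosed (f t e : ℕ → ℕ) (x y : ℕ) : Prop :=
  (t x ≠ 0 → (t y = 0 → t (f y) ≠ 0) ∧ (t y ≠ 0 → e y ≤ e x)) ∧ (e x < t x → t (f x) ≠ 0)

theorem edgeCode_reg (x y z : ℕ) (s : Memory) (hz : z ≠ 31 ∧ z ≠ 35 ∧ z ≠ 36) :
    ((edgeCode x y).exec s).reg z = s.reg z := by
  simp only [edgeCode, enterCode, Program.exec]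
  split_ifs <;> simp_all

theorem mateCode_reg (x z : ℕ) (s : Memory) (hz : z ≠ 31 ∧ z ≠ 35 ∧ z ≠ 36) :
    ((mateCode x).exec s).reg z = s.reg z := by
  simp only [mateCode, enterCode, Program.exec]
  split_ifs <;> simp_all

theorem agree_edgeCode (x y : ℕ) (s : Memory) : Agree 30 9 s ((edgeCode x y).exec s) :=
  Program.agree_exec (by simp [edgeCode, enterCode, Program.LoopFree])
    (by simp [edgeCode, enterCode, Program.WritesFrom]) s

theorem agree_mateCode (x : ℕ) (s : Memory) : Agree 30 9 s ((mateCode x).exec s) :=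
  Program.agree_exec (by simp [mateCode, enterCode, Program.LoopFree])
    (by simp [mateCode, enterCode, Program.WritesFrom]) s

theorem searchStep_edgeCodes {N : ℕ} {R : ℕ → ℕ → Prop} {f : ℕ → ℕ} {s : Memory}
    (hR : IsGraph N R) (hf : IsMate R f) (hsf : ∀ v < N, s.arr 6 v = f v)
    (h : Search N R f (s.arr 9) (s.arr 10) (s.reg 31)) (hxy : R (s.reg 33) (s.reg 34)) :
    SearchStep N R f (fun t e => EdgeClosed f t e (s.reg 33) (s.reg 34) ∧
        EdgeClosed f t e (s.reg 34) (s.reg 33)) s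
      ((mateCode 34).exec ((mateCode 33).exec ((edgeCode 34 33).exec ((edgeCode 33 34).exec s)))) := by
  have a1 := agree_edgeCode 33 34 s
  have r1 := fun z hz => edgeCode_reg 33 34 z s hz
  have h1 := searchStep_edgeCode hR hf hsf h hxy
  set s₁ := (edgeCode 33 34).exec s
  have a2 := agree_edgeCode 34 33 s₁
  have r2 := fun z hz => edgeCode_reg 34 33 z s₁ hz
  have hsf₁ : ∀ v < N, s₁.arr 6 v = f v := fun v hv => (a1.2 6 (by norm_num) v).trans (hsf v hv)
  have h2 := searchStep_edgeCode hR hf hsf₁ h1.search (x := 34) (y := 33) (by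
    rw [r1 33 (by norm_num), r1 34 (by norm_num)]; exact hR.symm _ _ hxy)
  rw [r1 33 (by norm_num), r1 34 (by norm_num)] at h2
  set s₂ := (edgeCode 34 33).exec s₁
  have a3 := agree_mateCode 33 s₂
  have r3 := fun z hz => mateCode_reg 33 z s₂ hz
  have hsf₂ : ∀ v < N, s₂.arr 6 v = f v := fun v hv => (a2.2 6 (by norm_num) v).trans (hsf₁ v hv)
  have e33 : s₂.reg 33 = s.reg 33 := by rw [r2 33 (by norm_num), r1 33 (by norm_num)]
  have e34 : s₂.reg 34 = s.reg 34 := by rw [r2 34 (by norm_num), r1 34 (by norm_num)]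
  have h3 := searchStep_mateCode hR hf hsf₂ h2.search (x := 33) (by
    rw [e33]; exact hR.lt _ _ hxy)
  rw [e33] at h3
  set s₃ := (mateCode 33).exec s₂
  have hsf₃ : ∀ v < N, s₃.arr 6 v = f v := fun v hv => (a3.2 6 (by norm_num) v).trans (hsf₂ v hv)
  have h4 := searchStep_mateCode hR hf hsf₃ h3.search (x := 34) (by
    rw [r3 34 (by norm_num), e34]; exact hR.lt' hxy)
  rw [r3 34 (by norm_num), e34] at h4
  exact (((h1.trans h2).trans h3).trans h4).imp fun ⟨⟨⟨b1, b2⟩, b3⟩, b4⟩ => ⟨⟨b1, b3⟩, b2, b4⟩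

theorem slotCode_exec (s : Memory) : slotCode.exec s =
    (fun s₂ : Memory => if s₂.reg 35 = 0 then s₂.setReg 32 (s₂.reg 32 + 1) else s₂.setReg 32 0)
    ((fun s₁ : Memory => if s.arr 7 (s.reg 32) = 0 then s₁ else
        (mateCode 34).exec ((mateCode 33).exec ((edgeCode 34 33).exec ((edgeCode 33 34).exec s₁))))
      (((s.setReg 33 (s.arr 3 (s.reg 32))).setReg 34 (s.arr 4 (s.reg 32))).setReg 35 0)) := by
  simp only [slotCode, Program.exec, Expr.eval, Memory.setReg_arr, Memory.setReg_reg]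
  norm_num

/-- The invariant of the main loop of the search. -/
structure SlotInv (s₀ s : Memory) : Prop where
  agree : Agree 30 9 s₀ s
  search : Search (s₀.reg 17) (slotRel s₀ 7) (mateFn s₀) (s.arr 9) (s.arr 10) (s.reg 31)
  entered : ∀ v < s₀.reg 17, mateFn s₀ v = v → s.arr 9 v ≠ 0
  le : s.reg 32 ≤ s₀.reg 16
  closed : ∀ p < s.reg 32, s₀.arr 7 p ≠ 0 →
    EdgeClosed (mateFn s₀) (s.arr 9) (s.arr 10) (s₀.arr 3 p) (s₀.arr 4 p) ∧
      EdgeClosed (mateFn s₀) (s.arr 9) (s.arr 10) (s₀.arr 4 p) (s₀.arr 3 p)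

/-- A change restarts the scan at slot 0, which the weight `reg 16 + 1` on the potential outweighs.
Without a change the current slot is closed, and earlier slots stay closed because times and labels
are untouched. -/
theorem SlotInv.step {s₀ s : Memory} (hv : ValidSlots s₀ 7)
    (hf : IsMate (slotRel s₀ 7) (mateFn s₀)) (h : SlotInv s₀ s) (hlt : s.reg 32 < s₀.reg 16) :
    SlotInv s₀ (slotCode.exec s) ∧
      searchPotential (s₀.reg 17) ((slotCode.exec s).arr 9) ((slotCode.exec s).arr 10) *
        (s₀.reg 16 + 1) + (s₀.reg 16 - (slotCode.exec s).reg 32) <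
      searchPotential (s₀.reg 17) (s.arr 9) (s.arr 10) * (s₀.reg 16 + 1) +
        (s₀.reg 16 - s.reg 32) := by
  have hagree : Agree 30 9 s₀ (slotCode.exec s) := h.agree.trans (Program.agree_exec
    (by simp [slotCode, edgeCode, mateCode, enterCode, Program.LoopFree])
    (by simp [slotCode, edgeCode, mateCode, enterCode, Program.WritesFrom]) s)
  have ha3 := h.agree.2 3 (by norm_num) (s.reg 32)
  have ha4 := h.agree.2 4 (by norm_num) (s.reg 32)
  have ha7 := h.agree.2 7 (by norm_num) (s.reg 32)
  rw [slotCode_exec] at hagree ⊢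
  set s₁ := ((s.setReg 33 (s.arr 3 (s.reg 32))).setReg 34 (s.arr 4 (s.reg 32))).setReg 35 0 with hs₁
  have e9 : s₁.arr = s.arr := rfl
  have e32 : s₁.reg 32 = s.reg 32 := by simp [hs₁]
  have e31 : s₁.reg 31 = s.reg 31 := by simp [hs₁]
  have e35 : s₁.reg 35 = 0 := by simp [hs₁]
  have e33 : s₁.reg 33 = s₀.arr 3 (s.reg 32) := by simp [hs₁, ha3]
  have e34 : s₁.reg 34 = s₀.arr 4 (s.reg 32) := by simp [hs₁, ha4]
  have hstep : ∃ s₂, (if s.arr 7 (s.reg 32) = 0 then s₁ else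
        (mateCode 34).exec ((mateCode 33).exec ((edgeCode 34 33).exec ((edgeCode 33 34).exec s₁))))
        = s₂ ∧ s₂.reg 32 = s.reg 32 ∧
      SearchStep (s₀.reg 17) (slotRel s₀ 7) (mateFn s₀) (fun t e => s₀.arr 7 (s.reg 32) ≠ 0 →
        EdgeClosed (mateFn s₀) t e (s₀.arr 3 (s.reg 32)) (s₀.arr 4 (s.reg 32)) ∧
        EdgeClosed (mateFn s₀) t e (s₀.arr 4 (s.reg 32)) (s₀.arr 3 (s.reg 32))) s₁ s₂ := by
    refine ⟨_, rfl, ?_, ?_⟩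
    · split_ifs
      · exact e32
      · rw [mateCode_reg _ _ _ (by norm_num), mateCode_reg _ _ _ (by norm_num),
          edgeCode_reg _ _ _ _ (by norm_num), edgeCode_reg _ _ _ _ (by norm_num), e32]
    · have hsearch : Search (s₀.reg 17) (slotRel s₀ 7) (mateFn s₀) (s₁.arr 9) (s₁.arr 10)
          (s₁.reg 31) := by rw [e9, e31]; exact h.search
      split_ifs with h7
      · exact SearchStep.refl hsearch fun h7' => absurd (ha7.symm.trans h7) h7'
      · have hR := hv.isGraph
        have := searchStep_edgeCodes hR hf (s := s₁) (fun v hv => by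
          rw [e9, h.agree.2 6 (by norm_num), mateFn_of_lt hv]) hsearch (by
          rw [e33, e34]
          exact ⟨s.reg 32, hlt, fun h0 => h7 (ha7.trans h0), .inl ⟨rfl, rfl⟩⟩)
        rw [e33, e34] at this
        exact this.imp fun h' _ => h'
  obtain ⟨s₂, hs₂, h32, hstep⟩ := hstep
  simp only [hs₂] at hagree ⊢
  have hent := hstep.entered
  rw [e9] at hent
  rcases hstep.progress with ⟨b1, b2, b3, b4⟩ | ⟨b1, b2⟩
  · have h0 : s₂.reg 35 = 0 := by rw [b1, e35]
    simp only [h0, if_true] at hagree ⊢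
    rw [e9] at b2 b3 b4
    refine ⟨⟨hagree, by simpa using hstep.search, fun v hvN hfv => hent v (h.entered v hvN hfv),
      by simp [h32]; omega, ?_⟩, ?_⟩
    · intro p hp
      simp only [Memory.setReg_reg, if_true, h32] at hp
      simp only [Memory.setReg_arr, b2, b3]
      rcases Nat.lt_succ_iff_lt_or_eq.1 hp with hp | rfl
      · exact h.closed p hp
      · exact b4
    · simp only [Memory.setReg_arr, b2, b3, Memory.setReg_reg, if_true, h32]
      omega
  · have h0 : ¬ s₂.reg 35 = 0 := by omega
    simp only [h0, if_false] at hagree ⊢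
    rw [e9] at b2
    refine ⟨⟨hagree, by simpa using hstep.search, fun v hvN hfv => hent v (h.entered v hvN hfv),
      by simp, by simp⟩, ?_⟩
    simp only [Memory.setReg_arr, Memory.setReg_reg, if_true]
    have h2 := Nat.mul_le_mul_right (s₀.reg 16 + 1) (Nat.succ_le_iff.2 b2)
    rw [Nat.succ_mul] at h2
    omega

theorem search_init (N : ℕ) (R : ℕ → ℕ → Prop) (f : ℕ → ℕ) {t : ℕ → ℕ} (e : ℕ → ℕ)
    (ht : ∀ v < N, t v = 0) : Search N R f t e 1 where
  pos := le_rfl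
  lt := fun v hv => by rw [ht v hv]; norm_num
  lab := fun v hv h => absurd (ht v hv) h
  inj := fun v hv _ _ h => absurd (ht v hv) h
  clock := by omega
  sound := fun _ _ _ _ v hv h => absurd (ht v hv) h

/-- Equality is tested by adding the two truncated differences. -/
theorem ite_ne_eq {s : Memory} {a b : Expr} {p q : Program} :
    (Program.ite (.add (.sub a b) (.sub b a)) p q).exec s =
      if a.eval s = b.eval s then q.exec s else p.exec s := by
  simp only [Program.exec, Expr.eval]
  have : (a.eval s - b.eval s + (b.eval s - a.eval s) = 0) = (a.eval s = b.eval s) := by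
    apply propext; omega
  simp only [this]

theorem startCode_step {s₀ s : Memory} (h1 : Agree 30 9 s₀ s)
    (h2 : Search (s₀.reg 17) (slotRel s₀ 7) (mateFn s₀) (s.arr 9) (s.arr 10) (s.reg 31))
    (h3 : ∀ v < s.reg 32, mateFn s₀ v = v → s.arr 9 v ≠ 0) (hlt : s.reg 32 < s₀.reg 17) :
    Search (s₀.reg 17) (slotRel s₀ 7) (mateFn s₀) ((startCode.exec s).arr 9)
      ((startCode.exec s).arr 10) ((startCode.exec s).reg 31) ∧
    (∀ v < (startCode.exec s).reg 32, mateFn s₀ v = v → (startCode.exec s).arr 9 v ≠ 0) ∧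
    (startCode.exec s).reg 32 = s.reg 32 + 1 := by
  have h6 : s.arr 6 (s.reg 32) = mateFn s₀ (s.reg 32) := by
    rw [h1.2 6 (by norm_num), mateFn_of_lt hlt]
  by_cases he : s.arr 6 (s.reg 32) = s.reg 32
  · have e : startCode.exec s = (enterCode.exec (s.setReg 36 (s.reg 32))).setReg 32
        ((enterCode.exec (s.setReg 36 (s.reg 32))).reg 32 + 1) := by
      rw [startCode, Program.exec, ite_ne_eq]
      simp [Expr.eval, he, Program.exec]
    have h4 := searchStep_enterCode h2 hlt fun _ B κ D hB =>
      ⟨hB.exposed _ hlt (h6.symm.trans he), .inl (.inl (h6.symm.trans he))⟩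
    have h5 : (enterCode.exec (s.setReg 36 (s.reg 32))).reg 32 = s.reg 32 := by
      simp only [enterCode, Program.exec]
      split_ifs <;> simp
    rw [e]
    refine ⟨by simpa using h4.search, ?_, by simp [h5]⟩
    intro v hv hfv
    simp only [Memory.setReg_reg, if_true, h5, Memory.setReg_arr] at hv ⊢
    rcases Nat.lt_succ_iff_lt_or_eq.1 hv with hv | rfl
    · exact h4.entered v (h3 v hv hfv)
    · rcases h4.progress with ⟨-, b2, -, b4⟩ | ⟨b1, b2⟩
      · rw [b2]; exact b4
      · by_cases h0 : s.arr 9 (s.reg 32) = 0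
        · have := h2.pos
          simp [enterCode, Program.exec, Expr.eval, h0]
          omega
        · exact h4.entered _ h0
  · have e : startCode.exec s = s.setReg 32 (s.reg 32 + 1) := by
      rw [startCode, Program.exec, ite_ne_eq]
      simp [Expr.eval, he, Program.exec]
    rw [e]
    refine ⟨by simpa using h2, ?_, by simp⟩
    intro v hv hfv
    simp only [Memory.setReg_reg, if_true, Memory.setReg_arr] at hv ⊢
    rcases Nat.lt_succ_iff_lt_or_eq.1 hv with hv | rfl
    · exact h3 v hv hfv
    · exact absurd (h6.trans hfv) he

theorem verdictCode_step (s : Memory) : (verdictCode.exec s).reg 32 = s.reg 32 + 1 ∧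
    ((verdictCode.exec s).reg 30 = 0 ↔ s.reg 30 = 0 ∧ (s.arr 6 (s.reg 32) = s.reg 32 →
      s.arr 9 (s.reg 32) ≤ s.arr 10 (s.reg 32))) ∧ (verdictCode.exec s).arr = s.arr := by
  by_cases he : s.arr 6 (s.reg 32) = s.reg 32
  · by_cases hle : s.arr 9 (s.reg 32) ≤ s.arr 10 (s.reg 32)
    · rw [verdictCode, Program.exec, ite_ne_eq]
      simp [Expr.eval, he, Program.exec, Nat.sub_eq_zero_of_le hle, hle]
    · have : s.arr 9 (s.reg 32) - s.arr 10 (s.reg 32) ≠ 0 := by omega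
      rw [verdictCode, Program.exec, ite_ne_eq]
      simp [Expr.eval, he, Program.exec, this, hle]
  · rw [verdictCode, Program.exec, ite_ne_eq]
    simp [Expr.eval, he, Program.exec]

end MatchingGap

/-! ### Correctness and running time of the maximality test -/

namespace MatchingGap
open Finset

theorem runsIn_setReg (x : ℕ) (e : Expr) (s : Memory) :
    RunsIn (.setReg x e) s (s.setReg x (e.eval s)) (e.cost + 1) := ⟨_, le_rfl, .setReg x e s⟩

/-- The running time of `testCode` for `N` vertices and `m` slots. -/
def testTime (N m : ℕ) : ℕ :=
  200 * (N + 1) + 200 * ((N * (N + 2) + 1) * (m + 1) + 1)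

/-- When the slot loop ends, all edges in use are closed in both directions, as `Search.optimal`
requires. `Search.le_of_optimal` shows that the verdict loop raises no objection to a maximum
matching. -/
theorem runsIn_testCode {s : Memory} (hv : ValidSlots s 7)
    (hf : IsMate (slotRel s 7) (mateFn s)) :
    ∃ s', RunsIn testCode s s' (testTime (s.reg 17) (s.reg 16)) ∧ Agree 30 9 s s' ∧
      (s'.reg 30 = 0 ↔
        (exposed (s.reg 17) (mateFn s)).card = deficiency (s.reg 17) (slotRel s 7)) := by
  have hR := hv.isGraph
  obtain ⟨s₁, hr₁, ht₁⟩ := runsIn_clearCode (a := 9) (b := 17) (i := 32) (by norm_num) s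
  have ha₁ : Agree 30 9 s s₁ := hr₁.agree (by simp [clearCode, Program.WritesFrom])
  have hr₂ := runsIn_setReg 31 (.const 1) s₁
  have ha₂ : Agree 30 9 s (s₁.setReg 31 1) := ha₁.trans (Agree.setReg _ _ (by norm_num))
  have hr₃ := runsIn_setReg 32 (.const 0) (s₁.setReg 31 1)
  have ha₃ : Agree 30 9 s ((s₁.setReg 31 1).setReg 32 0) :=
    ha₂.trans (Agree.setReg _ _ (by norm_num))
  obtain ⟨s₄, hr₄, ⟨ha₄, hs₄, he₄, hi₄⟩, hc₄⟩ := RunsIn.loop_exec (e := .sub (.reg 17) (.reg 32))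
    (p := startCode) (by simp [startCode, enterCode, Program.LoopFree])
    (I := fun s' => Agree 30 9 s s' ∧
      Search (s.reg 17) (slotRel s 7) (mateFn s) (s'.arr 9) (s'.arr 10) (s'.reg 31) ∧
      (∀ v < s'.reg 32, mateFn s v = v → s'.arr 9 v ≠ 0) ∧ s'.reg 32 ≤ s.reg 17)
    (V := fun s' => s.reg 17 - s'.reg 32) (by
      rintro s' ⟨h1, h2, h3, h4⟩ he
      simp only [Expr.eval, h1.1 17 (by norm_num)] at he
      obtain ⟨h5, h6, h7⟩ := startCode_step h1 h2 h3 (by omega)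
      exact ⟨⟨h1.trans (Program.agree_exec (by simp [startCode, enterCode, Program.LoopFree])
        (by simp [startCode, enterCode, Program.WritesFrom]) s'), h5, h6, by omega⟩, by omega⟩)
    (s := (s₁.setReg 31 1).setReg 32 0)
    ⟨ha₃, search_init _ _ _ _ (fun v hv => by simpa using ht₁ v hv), by simp, by simp⟩
  simp only [Expr.eval, ha₄.1 17 (by norm_num)] at hc₄
  have hr₅ := runsIn_setReg 32 (.const 0) s₄
  obtain ⟨s₆, hr₆, hI₆, hc₆⟩ := RunsIn.loop_exec (e := .sub (.reg 16) (.reg 32))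
    (p := slotCode) (by simp [slotCode, edgeCode, mateCode, enterCode, Program.LoopFree])
    (I := SlotInv s)
    (V := fun s' => searchPotential (s.reg 17) (s'.arr 9) (s'.arr 10) * (s.reg 16 + 1) +
        (s.reg 16 - s'.reg 32)) (by
      intro s' h he
      simp only [Expr.eval, h.agree.1 16 (by norm_num)] at he
      exact h.step hv hf (by omega))
    (s := s₄.setReg 32 0)
    ⟨ha₄.trans (Agree.setReg _ _ (by norm_num)), by simpa using hs₄,
      fun v hvN => by simpa using he₄ v (by omega), by simp, by simp⟩
  simp only [Expr.eval, hI₆.agree.1 16 (by norm_num)] at hc₆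
  have hr₇ := runsIn_setReg 30 (.const 0) s₆
  have hr₈ := runsIn_setReg 32 (.const 0) (s₆.setReg 30 0)
  have ha₈ : Agree 30 9 s ((s₆.setReg 30 0).setReg 32 0) :=
    (hI₆.agree.trans (Agree.setReg _ _ (by norm_num))).trans (Agree.setReg _ _ (by norm_num))
  obtain ⟨s₉, hr₉, ⟨ha₉, harr₉, hb₉, hi₉⟩, hc₉⟩ :=
    RunsIn.loop_exec (e := .sub (.reg 17) (.reg 32))
    (p := verdictCode) (by simp [verdictCode, Program.LoopFree])
    (I := fun s' => Agree 30 9 s s' ∧ s'.arr = s₆.arr ∧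
      (s'.reg 30 = 0 ↔ ∀ v < s'.reg 32, mateFn s v = v → s₆.arr 9 v ≤ s₆.arr 10 v) ∧
      s'.reg 32 ≤ s.reg 17)
    (V := fun s' => s.reg 17 - s'.reg 32) (by
      rintro s' ⟨h1, h2, h3, h4⟩ he
      simp only [Expr.eval, h1.1 17 (by norm_num)] at he
      obtain ⟨h5, h6, h7⟩ := verdictCode_step s'
      refine ⟨⟨h1.trans (Program.agree_exec (by simp [verdictCode, Program.LoopFree])
        (by simp [verdictCode, Program.WritesFrom]) s'), h7.trans h2, ?_, by omega⟩, by omega⟩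
      have h8 : s'.arr 6 (s'.reg 32) = mateFn s (s'.reg 32) := by
        rw [h1.2 6 (by norm_num), mateFn_of_lt (by omega)]
      rw [h6, h3, h5, h8, h2]
      constructor
      · rintro ⟨a1, a2⟩ v hv hfv
        rcases Nat.lt_succ_iff_lt_or_eq.1 hv with hv | rfl
        · exact a1 v hv hfv
        · exact a2 hfv
      · intro a1
        exact ⟨fun v hv => a1 v (by omega), fun hfv => a1 _ (by omega) hfv⟩)
    (s := (s₆.setReg 30 0).setReg 32 0) ⟨ha₈, rfl, by simp, by simp⟩
  simp only [Expr.eval, ha₉.1 17 (by norm_num)] at hc₉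
  refine ⟨s₉, (hr₁.seq (hr₂.seq (hr₃.seq (hr₄.seq (hr₅.seq (hr₆.seq (hr₇.seq
    (hr₈.seq hr₉)))))))).mono ?_, ha₉, ?_⟩
  · have h1 := hs₄.potential_le
    simp only [Memory.setReg_arr, Memory.setReg_reg, if_true]
    have h2 := Nat.mul_le_mul_right (s.reg 16 + 1) h1
    simp only [Program.time, Expr.cost, startCode, slotCode, verdictCode, edgeCode, mateCode,
      enterCode, testTime]
    rw [Nat.add_mul (s.reg 17 * (s.reg 17 + 2)) 1]
    omega
  · rw [hb₉]
    have hlt : ∀ v < s.reg 17, v < s₉.reg 32 := fun v hv => by omega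
    have hcl : ∀ x y, slotRel s 7 x y → EdgeClosed (mateFn s) (s₆.arr 9) (s₆.arr 10) x y := by
      rintro x y ⟨p, hp, h7, ⟨rfl, rfl⟩ | ⟨rfl, rfl⟩⟩
      · exact (hI₆.closed p (by omega) h7).1
      · exact (hI₆.closed p (by omega) h7).2
    constructor
    · intro h
      exact hI₆.search.optimal hR hf hI₆.entered (fun x y hxy => (hcl x y hxy).1)
        (fun x y hxy => (hcl x y hxy).2) (fun v hv => h v (hlt v hv))
    · intro h v hv hfv
      exact hI₆.search.le_of_optimal hR hf h (by omega) hfv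

end MatchingGap

/-! ### Deleting edges while the matching stays non-maximum -/

namespace MatchingGap
open Finset

/-- The matching `f` is a maximum matching. -/
def IsOptimal (N : ℕ) (R : ℕ → ℕ → Prop) (f : ℕ → ℕ) : Prop :=
  (exposed N f).card = deficiency N R

/-- Fewer edges cannot lower the deficiency, which `f` still attains. Hence a slot once found
necessary remains necessary after later deletions. -/
theorem IsOptimal.mono {N : ℕ} {R R' : ℕ → ℕ → Prop} {f : ℕ → ℕ} (h : IsOptimal N R f)
    (hf : IsMate R' f) (hR : ∀ u v, R' u v → R u v) : IsOptimal N R' f := by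
  obtain ⟨g, hg, hd⟩ := exists_deficiency N R'
  have h1 := deficiency_le (N := N) (hg.mono hR)
  have h2 := deficiency_le (N := N) hf
  unfold IsOptimal at *
  omega

theorem slotRel_mono {s s' : Memory} {h h' : ℕ} (h16 : s'.reg 16 = s.reg 16)
    (h3 : ∀ p, s'.arr 3 p = s.arr 3 p) (h4 : ∀ p, s'.arr 4 p = s.arr 4 p)
    (hh : ∀ p < s.reg 16, s'.arr h' p ≠ 0 → s.arr h p ≠ 0) (u v : ℕ) :
    slotRel s' h' u v → slotRel s h u v := by
  rintro ⟨p, hp, h7, hpq⟩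
  rw [h16] at hp
  rw [h3, h4] at hpq
  exact ⟨p, hp, hh p hp h7, hpq⟩

theorem ValidSlots.mono {s s' : Memory} {h h' : ℕ} (hs : ValidSlots s h)
    (h16 : s'.reg 16 = s.reg 16) (h17 : s'.reg 17 = s.reg 17)
    (h3 : ∀ p, s'.arr 3 p = s.arr 3 p) (h4 : ∀ p, s'.arr 4 p = s.arr 4 p)
    (hh : ∀ p < s.reg 16, s'.arr h' p ≠ 0 → s.arr h p ≠ 0) : ValidSlots s' h' := by
  intro p hp
  rw [h16] at hp
  obtain ⟨h1, h2, h5⟩ := hs p hp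
  rw [h3, h4, h17]
  exact ⟨h1, h2, fun h7 => h5 (hh p hp h7)⟩

/-- The slots of `H` that are needed for the matching `f` not to be maximum. -/
structure IsShrunk (s₀ s : Memory) (k : ℕ) : Prop where
  agree : Agree 20 7 s₀ s
  sub : ∀ p < s₀.reg 16, s.arr 7 p ≠ 0 → s₀.arr 7 p ≠ 0
  mate : IsMate (slotRel s 7) (mateFn s₀)
  not_optimal : ¬ IsOptimal (s₀.reg 17) (slotRel s 7) (mateFn s₀)
  needed : ∀ p < s₀.reg 16, p < k → s.arr 7 p ≠ 0 → mateFn s₀ (s₀.arr 3 p) ≠ s₀.arr 4 p →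
    IsOptimal (s₀.reg 17) (slotRel (s.setArr 7 p 0) 7) (mateFn s₀)

/-- Delete the slot in register `21` unless it is an edge of the matching or the matching becomes
maximum. -/
def shrinkBody : Program :=
  .seq (.ite (.arr 7 (.reg 21))
      (.ite (.add (.sub (.arr 6 (.arr 3 (.reg 21))) (.arr 4 (.reg 21)))
          (.sub (.arr 4 (.reg 21)) (.arr 6 (.arr 3 (.reg 21)))))
        (.seq (.setArr 7 (.reg 21) (.const 0))
          (.seq testCode (.ite (.reg 30) .skip (.setArr 7 (.reg 21) (.const 1))))) .skip) .skip)
    (.setReg 21 (.add (.reg 21) (.const 1)))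

/-- Delete slots as long as the matching does not become maximum. -/
def shrinkCode : Program :=
  .seq (.setReg 21 (.const 0)) (.loop (.sub (.reg 16) (.reg 21)) shrinkBody)

theorem IsMate.delete_slot {s : Memory} {f : ℕ → ℕ} {p : ℕ} (hf : IsMate (slotRel s 7) f)
    (hp : f (s.arr 3 p) ≠ s.arr 4 p) : IsMate (slotRel (s.setArr 7 p 0) 7) f := by
  refine ⟨hf.1, fun v hv => ?_⟩
  obtain ⟨q, hq, h7, hpq⟩ := hf.adj hv
  have hqp : q ≠ p := by
    rintro rfl
    rcases hpq with ⟨h1, h2⟩ | ⟨h1, h2⟩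
    · exact hp (by rw [h1, h2])
    · exact hp (by rw [h1, h2, hf.inv])
  exact ⟨q, hq, by simpa [hqp] using h7, by simpa using hpq⟩

theorem ite_ne_eq_eval {s : Memory} {a b : Expr} :
    (Expr.add (.sub a b) (.sub b a)).eval s = 0 ↔ a.eval s = b.eval s := by
  simp only [Expr.eval]
  omega

theorem IsShrunk.skip {s₀ s : Memory} (h : IsShrunk s₀ s (s.reg 21))
    (hskip : s.arr 7 (s.reg 21) = 0 ∨ mateFn s₀ (s₀.arr 3 (s.reg 21)) = s₀.arr 4 (s.reg 21)) :
    IsShrunk s₀ (s.setReg 21 (s.reg 21 + 1)) (s.reg 21 + 1) where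
  agree := h.agree.trans (Agree.setReg _ _ (by norm_num))
  sub := h.sub
  mate := h.mate
  not_optimal := h.not_optimal
  needed := fun p hp hpk h7 hne => by
    rcases Nat.lt_succ_iff_lt_or_eq.1 hpk with hpk | rfl
    · exact h.needed p hp hpk h7 hne
    · rcases hskip with h' | h'
      · exact absurd h' h7
      · exact absurd h' hne

theorem runsIn_shrinkBody {s₀ s : Memory} (hv : ValidSlots s₀ 7)
    (h : IsShrunk s₀ s (s.reg 21)) (hlt : s.reg 21 < s₀.reg 16) :
    ∃ s', RunsIn shrinkBody s s' (testTime (s₀.reg 17) (s₀.reg 16) + 60) ∧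
      s'.reg 21 = s.reg 21 + 1 ∧ IsShrunk s₀ s' (s'.reg 21) := by
  have a16 := h.agree.1 16 (by norm_num)
  have a17 := h.agree.1 17 (by norm_num)
  have a3 := h.agree.2 3 (by norm_num)
  have a4 := h.agree.2 4 (by norm_num)
  have a6 := h.agree.2 6 (by norm_num)
  have hm : mateFn s₀ (s₀.arr 3 (s.reg 21)) = s.arr 6 (s.arr 3 (s.reg 21)) := by
    rw [a6, a3, mateFn_of_lt (hv _ hlt).1]
  have hinc := runsIn_setReg 21 (.add (.reg 21) (.const 1))
  by_cases h7 : s.arr 7 (s.reg 21) = 0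
  · refine ⟨s.setReg 21 (s.reg 21 + 1), ?_, by simp, ?_⟩
    · exact ((RunsIn.ite_false (by simpa [Expr.eval] using h7) ⟨1, le_rfl, .skip s⟩).seq
        (hinc s)).mono (by simp only [Expr.cost]; omega)
    · simpa using h.skip (.inl h7)
  · by_cases heq : mateFn s₀ (s₀.arr 3 (s.reg 21)) = s₀.arr 4 (s.reg 21)
    · refine ⟨s.setReg 21 (s.reg 21 + 1), ?_, by simp, ?_⟩
      · exact ((RunsIn.ite_true (by simpa [Expr.eval] using h7) (RunsIn.ite_false
          (ite_ne_eq_eval.2 (by simp only [Expr.eval]; rw [← hm, heq, a4]))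
          ⟨1, le_rfl, .skip s⟩)).seq (hinc s)).mono (by simp only [Expr.cost]; omega)
      · simpa using h.skip (.inr heq)
    · set s₁ := s.setArr 7 (s.reg 21) 0 with hs₁
      have g₁ : Agree 20 7 s₀ s₁ := h.agree.trans (Agree.setArr _ _ _ (by norm_num))
      have hmate₁ : IsMate (slotRel s₁ 7) (mateFn s₀) := h.mate.delete_slot (by rwa [a3, a4])
      have hm₁ : mateFn s₁ = mateFn s₀ := g₁.mateFn (by norm_num) (by norm_num)
      have hsub₁ : ∀ p, s₁.arr 7 p ≠ 0 → s.arr 7 p ≠ 0 := by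
        intro p hp
        simp only [hs₁, Memory.setArr_arr, if_true, Function.update_apply] at hp
        split_ifs at hp
        · exact absurd rfl hp
        · exact hp
      have hv₁ : ValidSlots s₁ 7 := hv.mono a16 a17 (g₁.2 3 (by norm_num)) (g₁.2 4 (by norm_num))
        fun p hp h7 => h.sub p hp (hsub₁ p h7)
      obtain ⟨s₂, hr₂, g₂, hb⟩ := runsIn_testCode hv₁ (by rwa [hm₁])
      have e16 : s₁.reg 16 = s₀.reg 16 := g₁.1 16 (by norm_num)
      have e17 : s₁.reg 17 = s₀.reg 17 := g₁.1 17 (by norm_num)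
      have e21 : s₂.reg 21 = s.reg 21 := g₂.1 21 (by norm_num)
      have e7 : ∀ p, s₂.arr 7 p = s₁.arr 7 p := g₂.2 7 (by norm_num)
      have hrel₂ : slotRel s₂ 7 = slotRel s₁ 7 := g₂.slotRel (by norm_num) (by norm_num) (by norm_num)
      rw [hm₁, e17] at hb
      rw [e16, e17] at hr₂
      have hcond : (Expr.add (.sub (.arr 6 (.arr 3 (.reg 21))) (.arr 4 (.reg 21)))
          (.sub (.arr 4 (.reg 21)) (.arr 6 (.arr 3 (.reg 21))))).eval s ≠ 0 := by
        rw [Ne, ite_ne_eq_eval]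
        simp only [Expr.eval]
        rw [← hm, a4]
        exact heq
      have hset : RunsIn (.setArr 7 (.reg 21) (.const 0)) s s₁ 3 :=
        ⟨_, le_rfl, .setArr 7 (.reg 21) (.const 0) s⟩
      have g₂' : Agree 20 7 s₀ s₂ := g₁.trans (g₂.mono (by norm_num) (by norm_num))
      have mono₂ : ∀ p, ∀ s' : Memory, Agree 20 7 s₀ s' →
          (∀ q, s'.arr 7 q ≠ 0 → s.arr 7 q ≠ 0) → ∀ u v,
          slotRel (s'.setArr 7 p 0) 7 u v → slotRel (s.setArr 7 p 0) 7 u v := by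
        intro p s' g' hs'
        apply slotRel_mono
        · exact (g'.1 16 (by norm_num)).trans a16.symm
        · intro q; exact (g'.2 3 (by norm_num) q).trans (a3 q).symm
        · intro q; exact (g'.2 4 (by norm_num) q).trans (a4 q).symm
        · intro q _ hq
          simp only [Memory.setArr_arr, if_true, Function.update_apply] at hq ⊢
          split_ifs at hq ⊢
          · exact hq
          · exact hs' q hq
      by_cases hb0 : s₂.reg 30 = 0
      -- The slot is restored, and the positive test answer is exactly its entry in `needed`. The
      -- flag 1 may differ from the original value, but only its being nonzero matters.
      · set s₃ := s₂.setArr 7 (s.reg 21) 1 with hs₃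
        have hf₃ : ∀ p, s₃.arr 7 p ≠ 0 ↔ s.arr 7 p ≠ 0 := by
          intro p
          simp only [hs₃, Memory.setArr_arr, if_true, Function.update_apply, e7, hs₁]
          split_ifs with e
          · simp [e, h7]
          · rfl
        have g₃ : Agree 20 7 s₀ s₃ := g₂'.trans (Agree.setArr _ _ _ (by norm_num))
        have hrel₃ : slotRel s₃ 7 = slotRel s 7 := by
          funext u v
          apply propext
          constructor
          · exact slotRel_mono ((g₃.1 16 (by norm_num)).trans a16.symm)
              (fun q => (g₃.2 3 (by norm_num) q).trans (a3 q).symm)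
              (fun q => (g₃.2 4 (by norm_num) q).trans (a4 q).symm) (fun q _ => (hf₃ q).1) u v
          · exact slotRel_mono (a16.trans (g₃.1 16 (by norm_num)).symm)
              (fun q => (a3 q).trans (g₃.2 3 (by norm_num) q).symm)
              (fun q => (a4 q).trans (g₃.2 4 (by norm_num) q).symm) (fun q _ => (hf₃ q).2) u v
        refine ⟨s₃.setReg 21 (s.reg 21 + 1), ?_, by simp, ?_⟩
        · have h3 : RunsIn (.setArr 7 (.reg 21) (.const 1)) s₂ s₃ 3 := by
            have := Runs.setArr 7 (.reg 21) (.const 1) s₂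
            simp only [Expr.eval, e21] at this
            exact ⟨_, le_rfl, this⟩
          have h4 := hinc s₃
          have e21' : s₃.reg 21 = s.reg 21 := e21
          simp only [Expr.eval, e21'] at h4
          exact ((RunsIn.ite_true (by simpa [Expr.eval] using h7) (RunsIn.ite_true hcond
            (hset.seq (hr₂.seq (RunsIn.ite_false (by simpa [Expr.eval] using hb0) h3))))).seq
              h4).mono (by simp only [Expr.cost]; omega)
        · rw [Memory.setReg_reg, if_pos rfl]
          refine ⟨g₃.trans (Agree.setReg _ _ (by norm_num)), fun p hp h' => h.sub p hp ((hf₃ p).1 h'),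
            ?_, ?_, ?_⟩
          · change IsMate (slotRel s₃ 7) _
            rw [hrel₃]; exact h.mate
          · change ¬ IsOptimal _ (slotRel s₃ 7) _
            rw [hrel₃]; exact h.not_optimal
          · intro p hp hpk h7' hne
            change IsOptimal _ (slotRel (s₃.setArr 7 p 0) 7) _
            have hmate : IsMate (slotRel (s₃.setArr 7 p 0) 7) (mateFn s₀) := by
              apply IsMate.delete_slot
              · rw [hrel₃]; exact h.mate
              · rw [g₃.2 3 (by norm_num), g₃.2 4 (by norm_num)]; exact hne
            have hmono := mono₂ p s₃ g₃ fun q => (hf₃ q).1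
            rcases Nat.lt_succ_iff_lt_or_eq.1 hpk with hpk | rfl
            · exact (h.needed p hp hpk ((hf₃ p).1 h7') hne).mono hmate hmono
            · exact IsOptimal.mono (hb.1 hb0) hmate hmono
      -- The matching is still not maximum, so the slot stays deleted and `needed` asks nothing of
      -- it.
      · refine ⟨s₂.setReg 21 (s.reg 21 + 1), ?_, by simp, ?_⟩
        · have h4 := hinc s₂
          simp only [Expr.eval, e21] at h4
          exact ((RunsIn.ite_true (by simpa [Expr.eval] using h7) (RunsIn.ite_true hcond
            (hset.seq (hr₂.seq (RunsIn.ite_true (by simpa [Expr.eval] using hb0)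
              ⟨1, le_rfl, .skip s₂⟩))))).seq h4).mono (by simp only [Expr.cost]; omega)
        · rw [Memory.setReg_reg, if_pos rfl]
          have hsub₂ : ∀ p, s₂.arr 7 p ≠ 0 → s.arr 7 p ≠ 0 := fun p hp => hsub₁ p (by rwa [← e7])
          refine ⟨g₂'.trans (Agree.setReg _ _ (by norm_num)), fun p hp h' => h.sub p hp (hsub₂ p h'),
            ?_, ?_, ?_⟩
          · change IsMate (slotRel s₂ 7) _
            rw [hrel₂]; exact hmate₁
          · change ¬ IsOptimal _ (slotRel s₂ 7) _
            rw [hrel₂]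
            exact fun h' => hb0 (hb.2 h')
          · intro p hp hpk h7' hne
            change IsOptimal _ (slotRel (s₂.setArr 7 p 0) 7) _
            change s₂.arr 7 p ≠ 0 at h7'
            have hmate : IsMate (slotRel (s₂.setArr 7 p 0) 7) (mateFn s₀) := by
              apply IsMate.delete_slot
              · rw [hrel₂]; exact hmate₁
              · rw [g₂'.2 3 (by norm_num), g₂'.2 4 (by norm_num)]; exact hne
            rcases Nat.lt_succ_iff_lt_or_eq.1 hpk with hpk | rfl
            · exact (h.needed p hp hpk (hsub₂ p h7') hne).mono hmate (mono₂ p s₂ g₂' hsub₂)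
            · exfalso
              apply h7'
              rw [e7]
              simp [hs₁]

theorem runsIn_shrinkCode {s : Memory} (hv : ValidSlots s 7) (hf : IsMate (slotRel s 7) (mateFn s))
    (hopt : ¬ IsOptimal (s.reg 17) (slotRel s 7) (mateFn s)) :
    ∃ s', RunsIn shrinkCode s s' ((s.reg 16 + 1) * (testTime (s.reg 17) (s.reg 16) + 64) + 2) ∧
      IsShrunk s s' (s.reg 16) := by
  obtain ⟨s', hr, ⟨h, hle⟩, hc⟩ := RunsIn.loop (e := .sub (.reg 16) (.reg 21)) (p := shrinkBody)
    (I := fun s' => IsShrunk s s' (s'.reg 21) ∧ s'.reg 21 ≤ s.reg 16)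
    (V := fun s' => s.reg 16 - s'.reg 21) (T := testTime (s.reg 17) (s.reg 16) + 60) (by
      rintro s' ⟨h, hle⟩ he
      simp only [Expr.eval, h.agree.1 16 (by norm_num)] at he
      obtain ⟨s'', hr, h21, h'⟩ := runsIn_shrinkBody hv h (by omega)
      exact ⟨s'', hr, ⟨h', by omega⟩, by omega⟩)
    (s := s.setReg 21 0) ⟨⟨Agree.setReg _ _ (by norm_num), fun p _ h => h, hf, hopt, by simp⟩, by simp⟩
  simp only [Expr.eval, h.agree.1 16 (by norm_num)] at hc
  have e : s'.reg 21 = s.reg 16 := by omega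
  rw [e] at h
  refine ⟨s', ((runsIn_setReg 21 (.const 0) s).seq hr).mono ?_, h⟩
  simp only [Expr.cost, Memory.setReg_reg, if_true]
  rw [Nat.sub_zero]
  apply le_of_eq
  ring

end MatchingGap

/-! ### Reading off a larger matching -/

namespace MatchingGap
open Finset

/-- The mate function obtained from `f` by matching each marked vertex `v` to `k v - 1`. -/
def rematch (f k : ℕ → ℕ) (v : ℕ) : ℕ :=
  if k v = 0 then (if k (f v) = 0 then f v else v) else k v - 1

/-- All edges of `H` lie in `P` or in `f`, and `g` contains `P`. A vertex saturated by `g` is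
therefore either marked, and receives its partner in `P`, or shares its mate with `f`; that mate is
then unmarked and the edge is kept. Marks are shifted by one so that 0 means unmarked. -/
theorem isMate_rematch {N : ℕ} {H : ℕ → ℕ → Prop} (hH : IsGraph N H) {f g k : ℕ → ℕ}
    (hf : IsMate H f) (hg : IsMate H g) {P : ℕ → ℕ → Prop} (hPs : ∀ v w, P v w → P w v)
    (hPH : ∀ v w, P v w → H v w) (hHP : ∀ v w, H v w → P v w ∨ f v = w)
    (hPg : ∀ v w, P v w → g v = w) (hPk : ∀ v w, P v w → k v = w + 1)
    (hkP : ∀ v, k v ≠ 0 → P v (k v - 1)) :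
    IsMate H (rematch f k) ∧ exposed N (rematch f k) ⊆ exposed N g := by
  refine ⟨⟨fun v => ?_, fun v hv => ?_⟩, fun v hv => ?_⟩
  · by_cases hk : k v = 0
    · by_cases hk' : k (f v) = 0
      · have e : rematch f k v = f v := by simp [rematch, hk, hk']
        rw [e]; simp [rematch, hk', hf.inv, hk]
      · have e : rematch f k v = v := by simp [rematch, hk, hk']
        rw [e, e]
    · have e : rematch f k v = k v - 1 := by simp [rematch, hk]
      have h1 := hPk _ _ (hPs _ _ (hkP v hk))
      rw [e]; simp [rematch, h1]
  · by_cases hk : k v = 0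
    · by_cases hk' : k (f v) = 0
      · have e : rematch f k v = f v := by simp [rematch, hk, hk']
        rw [e] at hv ⊢
        exact hf.adj hv
      · exact absurd (by simp [rematch, hk, hk']) hv
    · have e : rematch f k v = k v - 1 := by simp [rematch, hk]
      rw [e]
      exact hPH _ _ (hkP v hk)
  · obtain ⟨hvN, hv⟩ := mem_exposed.1 hv
    refine mem_exposed.2 ⟨hvN, ?_⟩
    by_contra hgv
    by_cases hk : k v = 0
    · have h1 : f v = g v := by
        rcases hHP v (g v) (hg.adj hgv) with h | h
        · have := hPk _ _ h; omega
        · exact h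
      by_cases hk' : k (f v) = 0
      · have e : rematch f k v = f v := by simp [rematch, hk, hk']
        rw [← h1] at hgv
        exact hgv (e.symm.trans hv)
      · have h2 := hkP _ hk'
        have h3 := hPg _ _ h2
        rw [h1, hg.inv] at h3
        rw [h1] at h2
        have := hPk _ _ (hPs _ _ h2)
        rw [← h3] at this
        omega
    · have e : rematch f k v = k v - 1 := by simp [rematch, hk]
      have h1 := hPH _ _ (hkP v hk)
      rw [← e, hv] at h1
      exact hH.ne _ _ h1 rfl

/-- `v w` is an edge of a flagged slot before `k` that is not in the matching. -/
def UnmatchedSlot (s : Memory) (k v w : ℕ) : Prop :=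
  ∃ p < k, s.arr 7 p ≠ 0 ∧ mateFn s (s.arr 3 p) ≠ s.arr 4 p ∧
    ((s.arr 3 p = v ∧ s.arr 4 p = w) ∨ (s.arr 3 p = w ∧ s.arr 4 p = v))

/-- A maximum matching `g` of the remaining graph that avoided an unmatched slot would survive its
deletion, and the old matching could not become maximum. So `g` contains every remaining edge
outside the old matching. -/
theorem IsShrunk.exists_better {s₀ s : Memory} (h : IsShrunk s₀ s (s₀.reg 16)) :
    ∃ g, IsMate (slotRel s 7) g ∧ (exposed (s₀.reg 17) g).card <
      (exposed (s₀.reg 17) (mateFn s₀)).card ∧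
      ∀ v w, UnmatchedSlot s (s₀.reg 16) v w → g v = w := by
  have hm : mateFn s = mateFn s₀ := h.agree.mateFn (by norm_num) (by norm_num)
  obtain ⟨g, hg, hd⟩ := exists_deficiency (s₀.reg 17) (slotRel s 7)
  have hlt : (exposed (s₀.reg 17) g).card < (exposed (s₀.reg 17) (mateFn s₀)).card := by
    have h1 := deficiency_le (N := s₀.reg 17) h.mate
    have h2 := h.not_optimal
    unfold IsOptimal at h2
    omega
  refine ⟨g, hg, hlt, ?_⟩
  have key : ∀ p < s₀.reg 16, s.arr 7 p ≠ 0 → mateFn s (s.arr 3 p) ≠ s.arr 4 p →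
      g (s.arr 3 p) = s.arr 4 p := by
    intro p hp h7 hne
    by_contra hgp
    have h1 := h.needed p hp hp h7 (by
      rw [← hm, ← h.agree.2 3 (by norm_num), ← h.agree.2 4 (by norm_num)]; exact hne)
    have h2 := deficiency_le (N := s₀.reg 17) (hg.delete_slot hgp)
    unfold IsOptimal at h1
    omega
  rintro v w ⟨p, hp, h7, hne, ⟨rfl, rfl⟩ | ⟨rfl, rfl⟩⟩
  · exact key p hp h7 hne
  · rw [← key p hp h7 hne, hg.inv]

/-- Mark the endpoints of the slot in register `21` with each other unless it is in the
matching. -/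
def markBody : Program :=
  .seq (.ite (.arr 7 (.reg 21))
      (.ite (.add (.sub (.arr 6 (.arr 3 (.reg 21))) (.arr 4 (.reg 21)))
          (.sub (.arr 4 (.reg 21)) (.arr 6 (.arr 3 (.reg 21)))))
        (.seq (.setArr 8 (.arr 3 (.reg 21)) (.add (.arr 4 (.reg 21)) (.const 1)))
          (.setArr 8 (.arr 4 (.reg 21)) (.add (.arr 3 (.reg 21)) (.const 1)))) .skip) .skip)
    (.setReg 21 (.add (.reg 21) (.const 1)))

/-- Update the mate of the vertex in register `21` according to the marks. -/
def rematchBody : Program :=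
  .seq (.ite (.arr 8 (.reg 21)) (.setArr 6 (.reg 21) (.sub (.arr 8 (.reg 21)) (.const 1)))
      (.ite (.arr 8 (.arr 6 (.reg 21))) (.setArr 6 (.reg 21) (.reg 21)) .skip))
    (.setReg 21 (.add (.reg 21) (.const 1)))

/-- Replace the matching by the one that contains all flagged edges outside of it. -/
def augmentCode : Program :=
  .seq (clearCode 8 17 21) (.seq (.setReg 21 (.const 0))
    (.seq (.loop (.sub (.reg 16) (.reg 21)) markBody) (.seq (.setReg 21 (.const 0))
      (.loop (.sub (.reg 17) (.reg 21)) rematchBody))))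

/-- All unmatched edges lie in the single matching `g`, so two slots that mark the same vertex write
the same value and no mark is corrupted. -/
theorem markBody_step {s₀ s : Memory} {g : ℕ → ℕ} (hv : ValidSlots s₀ 7)
    (hg : ∀ v w, UnmatchedSlot s₀ (s₀.reg 16) v w → g v = w) (ha : Agree 20 8 s₀ s)
    (h1 : ∀ v w, UnmatchedSlot s₀ (s.reg 21) v w → s.arr 8 v = w + 1)
    (h2 : ∀ v < s₀.reg 17, s.arr 8 v ≠ 0 → UnmatchedSlot s₀ (s₀.reg 16) v (s.arr 8 v - 1))
    (hlt : s.reg 21 < s₀.reg 16) :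
    (∀ v w, UnmatchedSlot s₀ (s.reg 21 + 1) v w → (markBody.exec s).arr 8 v = w + 1) ∧
    (∀ v < s₀.reg 17, (markBody.exec s).arr 8 v ≠ 0 →
      UnmatchedSlot s₀ (s₀.reg 16) v ((markBody.exec s).arr 8 v - 1)) ∧
    (markBody.exec s).reg 21 = s.reg 21 + 1 := by
  have a3 := ha.2 3 (by norm_num) (s.reg 21)
  have a4 := ha.2 4 (by norm_num) (s.reg 21)
  have a6 := ha.2 6 (by norm_num)
  have a7 := ha.2 7 (by norm_num) (s.reg 21)
  have hm : mateFn s₀ (s₀.arr 3 (s.reg 21)) = s.arr 6 (s.arr 3 (s.reg 21)) := by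
    rw [a6, a3, mateFn_of_lt (hv _ hlt).1]
  have hskip : (s₀.arr 7 (s.reg 21) = 0 ∨ mateFn s₀ (s₀.arr 3 (s.reg 21)) = s₀.arr 4 (s.reg 21)) →
      ∀ v w, UnmatchedSlot s₀ (s.reg 21 + 1) v w → s.arr 8 v = w + 1 := by
    rintro hs v w ⟨p, hp, h7, hne, hpq⟩
    rcases Nat.lt_succ_iff_lt_or_eq.1 hp with hp | rfl
    · exact h1 v w ⟨p, hp, h7, hne, hpq⟩
    · rcases hs with hs | hs
      · exact absurd hs h7
      · exact absurd hs hne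
  by_cases h7 : s.arr 7 (s.reg 21) = 0
  · have e : markBody.exec s = s.setReg 21 (s.reg 21 + 1) := by
      simp [markBody, Program.exec, Expr.eval, h7]
    rw [e]
    exact ⟨hskip (.inl (by rw [← a7, h7])), h2, by simp⟩
  · by_cases heq : s.arr 6 (s.arr 3 (s.reg 21)) = s.arr 4 (s.reg 21)
    · have e : markBody.exec s = s.setReg 21 (s.reg 21 + 1) := by
        simp [markBody, Program.exec, Expr.eval, h7, heq]
      rw [e]
      exact ⟨hskip (.inr (by rw [hm, heq, a4])), h2, by simp⟩
    · have e : markBody.exec s = ((s.setArr 8 (s.arr 3 (s.reg 21)) (s.arr 4 (s.reg 21) + 1)).setArr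
          8 (s.arr 4 (s.reg 21)) (s.arr 3 (s.reg 21) + 1)).setReg 21 (s.reg 21 + 1) := by
        have hc : ¬ (s.arr 6 (s.arr 3 (s.reg 21)) - s.arr 4 (s.reg 21) = 0 ∧
            s.arr 4 (s.reg 21) - s.arr 6 (s.arr 3 (s.reg 21)) = 0) := by omega
        simp only [markBody, Program.exec, Expr.eval, h7, Nat.add_eq_zero_iff, hc, if_false]
        simp
      have hslot : ∀ v w, (s₀.arr 3 (s.reg 21) = v ∧ s₀.arr 4 (s.reg 21) = w) ∨
          (s₀.arr 3 (s.reg 21) = w ∧ s₀.arr 4 (s.reg 21) = v) →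
          UnmatchedSlot s₀ (s₀.reg 16) v w := fun v w h =>
        ⟨_, hlt, by rwa [← a7], by rwa [hm, ← a4], h⟩
      rw [e]
      simp only [Memory.setReg_arr, Memory.setArr_arr, if_true, Function.update_apply, a3, a4,
        Memory.setReg_reg]
      refine ⟨?_, ?_, trivial⟩
      · intro v w hvw
        have hgw : g v = w := by
          obtain ⟨p, hp, hrest⟩ := hvw
          exact hg v w ⟨p, by omega, hrest⟩
        split_ifs with e1 e2
        · rw [← hgw, hg v _ (hslot v _ (.inr ⟨rfl, e1.symm⟩))]
        · rw [← hgw, hg v _ (hslot v _ (.inl ⟨e2.symm, rfl⟩))]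
        · obtain ⟨p, hp, h7, hne, hpq⟩ := hvw
          rcases Nat.lt_succ_iff_lt_or_eq.1 hp with hp | rfl
          · exact h1 v w ⟨p, hp, h7, hne, hpq⟩
          · rcases hpq with ⟨rfl, rfl⟩ | ⟨rfl, rfl⟩
            · exact absurd rfl e2
            · exact absurd rfl e1
      · intro v hvN hne
        split_ifs at hne ⊢ with e1 e2
        · exact hslot _ _ (.inr ⟨rfl, e1.symm⟩)
        · exact hslot _ _ (.inl ⟨e2.symm, rfl⟩)
        · exact h2 v hvN hne

theorem rematchBody_step (s : Memory) : (rematchBody.exec s).reg 21 = s.reg 21 + 1 ∧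
    (rematchBody.exec s).arr 6 =
      Function.update (s.arr 6) (s.reg 21) (rematch (s.arr 6) (s.arr 8) (s.reg 21)) ∧
    (rematchBody.exec s).arr 8 = s.arr 8 := by
  by_cases h8 : s.arr 8 (s.reg 21) = 0
  · by_cases h8' : s.arr 8 (s.arr 6 (s.reg 21)) = 0
    · simp [rematchBody, Program.exec, Expr.eval, h8, h8', rematch]
    · simp [rematchBody, Program.exec, Expr.eval, h8, h8', rematch]
  · simp [rematchBody, Program.exec, Expr.eval, h8, rematch]

/-- The running time of `augmentCode`. -/
def augmentTime (N m : ℕ) : ℕ := 100 * (N + 1) + 100 * (m + 1)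

/-- Updating the mates in place is safe: the new value at a vertex depends only on its own old mate
and on the marks, which the second loop leaves alone. -/
theorem runsIn_augmentCode {s₀ s : Memory} (hv : ValidSlots s₀ 7)
    (h : IsShrunk s₀ s (s₀.reg 16)) :
    ∃ s', RunsIn augmentCode s s' (augmentTime (s₀.reg 17) (s₀.reg 16)) ∧ Agree 20 6 s s' ∧
      IsMate (slotRel s 7) (mateFn s') ∧ (exposed (s₀.reg 17) (mateFn s')).card <
        (exposed (s₀.reg 17) (mateFn s₀)).card := by
  have e16 : s.reg 16 = s₀.reg 16 := h.agree.1 16 (by norm_num)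
  have e17 : s.reg 17 = s₀.reg 17 := h.agree.1 17 (by norm_num)
  have hvs : ValidSlots s 7 := hv.mono e16 e17 (h.agree.2 3 (by norm_num))
    (h.agree.2 4 (by norm_num)) h.sub
  have hm : mateFn s = mateFn s₀ := h.agree.mateFn (by norm_num) (by norm_num)
  obtain ⟨g, hg, hlt, hPg⟩ := h.exists_better
  rw [← e16, ← e17] at *
  obtain ⟨s₁, hr₁, ht₁⟩ := runsIn_clearCode (a := 8) (b := 17) (i := 21) (by norm_num) s
  have ha₁ : Agree 20 8 s s₁ := hr₁.agree (by simp [clearCode, Program.WritesFrom])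
  have hr₂ := runsIn_setReg 21 (.const 0) s₁
  obtain ⟨s₃, hr₃, ⟨ha₃, h1₃, h2₃, hi₃⟩, hc₃⟩ := RunsIn.loop_exec (e := .sub (.reg 16) (.reg 21))
    (p := markBody) (by simp [markBody, Program.LoopFree])
    (I := fun s' => Agree 20 8 s s' ∧
      (∀ v w, UnmatchedSlot s (s'.reg 21) v w → s'.arr 8 v = w + 1) ∧
      (∀ v < s.reg 17, s'.arr 8 v ≠ 0 → UnmatchedSlot s (s.reg 16) v (s'.arr 8 v - 1)) ∧
      s'.reg 21 ≤ s.reg 16)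
    (V := fun s' => s.reg 16 - s'.reg 21) (by
      rintro s' ⟨h1, h2, h3, h4⟩ he
      simp only [Expr.eval, h1.1 16 (by norm_num)] at he
      obtain ⟨h5, h6, h7⟩ := markBody_step hvs hPg h1 h2 h3 (by omega)
      refine ⟨⟨h1.trans (Program.agree_exec (by simp [markBody, Program.LoopFree])
        (by simp [markBody, Program.WritesFrom]) s'), by rwa [h7], h6, by omega⟩, by omega⟩)
    (s := s₁.setReg 21 0)
    ⟨ha₁.trans (Agree.setReg _ _ (by norm_num)),
      fun v w ⟨p, hp, _⟩ => absurd hp (by simp),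
      fun v hv h0 => absurd (ht₁ v hv) h0, by simp⟩
  simp only [Expr.eval, ha₃.1 16 (by norm_num)] at hc₃
  have e21 : s₃.reg 21 = s.reg 16 := by omega
  rw [e21] at h1₃
  have hr₄ := runsIn_setReg 21 (.const 0) s₃
  have hH := hvs.isGraph
  obtain ⟨s₅, hr₅, ⟨ha₅, h8₅, h1₅, h2₅, hi₅⟩, hc₅⟩ :=
    RunsIn.loop_exec (e := .sub (.reg 17) (.reg 21))
    (p := rematchBody) (by simp [rematchBody, Program.LoopFree])
    (I := fun s' => Agree 20 6 s s' ∧ s'.arr 8 = s₃.arr 8 ∧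
      (∀ v < s'.reg 21, s'.arr 6 v = rematch (s.arr 6) (s₃.arr 8) v) ∧
      (∀ v, s'.reg 21 ≤ v → s'.arr 6 v = s.arr 6 v) ∧ s'.reg 21 ≤ s.reg 17)
    (V := fun s' => s.reg 17 - s'.reg 21) (by
      rintro s' ⟨h1, h2, h3, h4, h5⟩ he
      simp only [Expr.eval, h1.1 17 (by norm_num)] at he
      obtain ⟨h6, h7, h8⟩ := rematchBody_step s'
      refine ⟨⟨h1.trans (Program.agree_exec (by simp [rematchBody, Program.LoopFree])
        (by simp [rematchBody, Program.WritesFrom]) s'), h8.trans h2, ?_, ?_, by omega⟩, by omega⟩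
      · intro v hv
        rw [h7, Function.update_apply]
        split_ifs with e
        · rw [rematch, rematch, h4 _ le_rfl, h2, e]
        · exact h3 v (by omega)
      · intro v hv
        rw [h7, Function.update_apply, if_neg (by omega)]
        exact h4 v (by omega))
    (s := s₃.setReg 21 0)
    ⟨(ha₃.mono (by norm_num) (by norm_num)).trans (Agree.setReg _ _ (by norm_num)), rfl, by simp,
      fun v _ => ha₃.2 6 (by norm_num) v, by simp⟩
  simp only [Expr.eval, ha₅.1 17 (by norm_num)] at hc₅
  refine ⟨s₅, (hr₁.seq (hr₂.seq (hr₃.seq (hr₄.seq hr₅)))).mono ?_, ha₅, ?_⟩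
  · simp only [Program.time, Expr.cost, markBody, rematchBody, augmentTime, Memory.setReg_reg,
      if_true]
    omega
  · let k : ℕ → ℕ := fun v => if v < s.reg 17 then s₃.arr 8 v else 0
    have hfN : ∀ v < s.reg 17, s.arr 6 v < s.reg 17 := by
      intro v hv
      have := h.mate.lt hH hv
      rwa [← hm, mateFn_of_lt hv] at this
    have hmate : mateFn s₅ = rematch (mateFn s₀) k := by
      funext v
      rw [← hm]
      by_cases hv : v < s.reg 17
      · rw [mateFn_of_lt (by rw [ha₅.1 17 (by norm_num)]; exact hv), h1₅ v (by omega)]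
        simp only [rematch, k, mateFn_of_lt hv, hv, hfN v hv, if_true]
      · have h3 : mateFn s v = v := by simp [mateFn, hv]
        have h4 : mateFn s₅ v = v := by simp [mateFn, ha₅.1 17 (by norm_num), hv]
        simp [rematch, k, h3, h4, hv]
    have hPN : ∀ v w, UnmatchedSlot s (s.reg 16) v w → slotRel s 7 v w := by
      rintro v w ⟨p, hp, h7, _, hpq⟩
      exact ⟨p, hp, h7, hpq⟩
    obtain ⟨r1, r2⟩ := isMate_rematch hH (k := k) h.mate hg
      (P := UnmatchedSlot s (s.reg 16))
      (fun v w ⟨p, hp, h7, hne, hpq⟩ => ⟨p, hp, h7, hne, hpq.symm⟩) hPN (by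
        rintro v w ⟨p, hp, h7, hpq⟩
        by_cases hne : mateFn s (s.arr 3 p) = s.arr 4 p
        · right
          rcases hpq with ⟨rfl, rfl⟩ | ⟨rfl, rfl⟩
          · rw [← hm, hne]
          · rw [← hne, hm, h.mate.inv]
        · exact .inl ⟨p, hp, h7, hne, hpq⟩) hPg (by
        intro v w hvw
        have := hH.lt _ _ (hPN v w hvw)
        simp only [k, this, if_true]
        exact h1₃ v w hvw) (by
        intro v hk
        by_cases hv : v < s.reg 17
        · simp only [k, hv, if_true] at hk ⊢
          exact h2₃ v hv hk
        · simp [k, hv] at hk)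
    rw [hmate]
    exact ⟨r1, lt_of_le_of_lt (Finset.card_le_card r2) hlt⟩

end MatchingGap

/-! ### Computing the deficiency -/

namespace MatchingGap
open Finset

/-- Set the cells of array `a` below the value of register `b` to the values of `e`, with
counter `i`. -/
def fillCode (a b i : ℕ) (e : Expr) : Program :=
  .seq (.setReg i (.const 0)) (.loop (.sub (.reg b) (.reg i))
    (.seq (.setArr a (.reg i) e) (.setReg i (.add (.reg i) (.const 1)))))

theorem runsIn_fillCode {a b i : ℕ} {e : Expr} (hbi : b ≠ i) (s : Memory) {F : ℕ → ℕ}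
    (hF : ∀ s' : Memory, (∀ c ≠ a, s'.arr c = s.arr c) → e.eval s' = F (s'.reg i)) :
    ∃ s', RunsIn (fillCode a b i e) s s' ((s.reg b + 1) * (e.cost + 10) + 2) ∧
      ∀ v < s.reg b, s'.arr a v = F v := by
  obtain ⟨s', hr, ⟨hb, ha, hi, h⟩, he⟩ := RunsIn.loop_exec (e := .sub (.reg b) (.reg i))
    (p := .seq (.setArr a (.reg i) e) (.setReg i (.add (.reg i) (.const 1))))
    (by simp [Program.LoopFree])
    (I := fun s' => s'.reg b = s.reg b ∧ (∀ c ≠ a, s'.arr c = s.arr c) ∧ s'.reg i ≤ s.reg b ∧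
      ∀ v < s'.reg i, s'.arr a v = F v)
    (V := fun s' => s.reg b - s'.reg i) (by
      rintro s' ⟨h1, ha, h2, h3⟩ he
      simp only [Expr.eval, h1] at he
      refine ⟨⟨by simp [Program.exec, hbi, h1], fun c hc => by simp [Program.exec, hc, ha],
        by simp [Program.exec, Expr.eval]; omega, ?_⟩,
        by simp [Program.exec, Expr.eval]; omega⟩
      intro v hv
      simp only [Program.exec, Expr.eval, Memory.setReg_reg, if_true, Memory.setArr_reg] at hv
      simp only [Program.exec, Expr.eval, Memory.setReg_arr, Memory.setArr_arr, if_true,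
        Function.update_apply]
      split_ifs with e
      · rw [hF s' ha, e]
      · exact h3 v (by omega))
    (s := s.setReg i 0) (by simp [hbi])
  simp only [Expr.eval, hb] at he
  refine ⟨s', ((runsIn_setReg i (.const 0) s).seq hr).mono ?_, fun v hv => h v (by omega)⟩
  simp only [Program.time, Expr.cost, Memory.setReg_reg, if_true]
  rw [Nat.add_comm (1 + 1)]
  exact Nat.add_le_add (Nat.mul_le_mul (by omega) (by omega)) le_rfl

/-- Improve the matching in array `6` if it is not maximum; register `30` becomes `0` if it is. -/
def improveCode : Program :=
  .seq (fillCode 7 16 21 (.arr 5 (.reg 21))) (.seq testCode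
    (.ite (.reg 30) (.seq shrinkCode (.seq augmentCode (.setReg 30 (.const 1)))) .skip))

/-- The running time of `improveCode`. -/
def improveTime (N m : ℕ) : ℕ :=
  20 * (m + 1) + testTime N m + (m + 1) * (testTime N m + 64) + augmentTime N m + 10

theorem runsIn_improveCode {s : Memory} (hv : ValidSlots s 5)
    (hf : IsMate (slotRel s 5) (mateFn s)) :
    ∃ s', RunsIn improveCode s s' (improveTime (s.reg 17) (s.reg 16)) ∧ Agree 20 6 s s' ∧
      IsMate (slotRel s 5) (mateFn s') ∧
      ((s'.reg 30 = 0 ∧ mateFn s' = mateFn s ∧ IsOptimal (s.reg 17) (slotRel s 5) (mateFn s)) ∨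
        (s'.reg 30 = 1 ∧
          (exposed (s.reg 17) (mateFn s')).card < (exposed (s.reg 17) (mateFn s)).card)) := by
  obtain ⟨s₁, hr₁, h7⟩ := runsIn_fillCode (a := 7) (b := 16) (i := 21) (e := .arr 5 (.reg 21))
    (by norm_num) s (F := s.arr 5) fun s' h => by simp [Expr.eval, h 5 (by norm_num)]
  have a₁ : Agree 20 7 s s₁ := hr₁.agree (by simp [fillCode, Program.WritesFrom])
  have e16 : s₁.reg 16 = s.reg 16 := a₁.1 16 (by norm_num)
  have e17 : s₁.reg 17 = s.reg 17 := a₁.1 17 (by norm_num)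
  have hv₁ : ValidSlots s₁ 7 := hv.mono e16 e17 (a₁.2 3 (by norm_num)) (a₁.2 4 (by norm_num))
    fun p hp h => by rwa [← h7 p hp]
  have hm₁ : mateFn s₁ = mateFn s := a₁.mateFn (by norm_num) (by norm_num)
  have hrel : slotRel s₁ 7 = slotRel s 5 := by
    funext u v
    apply propext
    constructor
    · exact slotRel_mono e16 (a₁.2 3 (by norm_num)) (a₁.2 4 (by norm_num))
        (fun p hp h => by rwa [← h7 p hp]) u v
    · exact slotRel_mono e16.symm (fun p => (a₁.2 3 (by norm_num) p).symm)
        (fun p => (a₁.2 4 (by norm_num) p).symm)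
        (fun p hp h => by rwa [h7 p (by rwa [← e16])]) u v
  obtain ⟨s₂, hr₂, a₂, ht⟩ := runsIn_testCode hv₁ (by rwa [hm₁, hrel])
  rw [hm₁, hrel, e17] at ht
  rw [e16, e17] at hr₂
  have a₂' : Agree 20 7 s s₂ := a₁.trans (a₂.mono (by norm_num) (by norm_num))
  have hm₂ : mateFn s₂ = mateFn s := a₂'.mateFn (by norm_num) (by norm_num)
  by_cases h0 : s₂.reg 30 = 0
  · refine ⟨s₂, (hr₁.seq (hr₂.seq (RunsIn.ite_false (by simpa [Expr.eval] using h0)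
      ⟨1, le_rfl, .skip _⟩))).mono ?_, a₂'.mono le_rfl (by norm_num), by rwa [hm₂],
      .inl ⟨h0, hm₂, ht.1 h0⟩⟩
    simp only [Expr.cost, improveTime]
    omega
  · have hv₂ : ValidSlots s₂ 7 := (a₂.validSlots (by norm_num) (by norm_num) (by norm_num)).2 hv₁
    have hrel₂ : slotRel s₂ 7 = slotRel s 5 :=
      (a₂.slotRel (by norm_num) (by norm_num) (by norm_num)).trans hrel
    have e16₂ : s₂.reg 16 = s.reg 16 := a₂'.1 16 (by norm_num)
    have e17₂ : s₂.reg 17 = s.reg 17 := a₂'.1 17 (by norm_num)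
    obtain ⟨s₃, hr₃, h₃⟩ := runsIn_shrinkCode hv₂ (by rwa [hm₂, hrel₂])
      (by rw [hm₂, hrel₂, e17₂]; exact fun h => h0 (ht.2 h))
    obtain ⟨s₄, hr₄, a₄, hf₄, hlt⟩ := runsIn_augmentCode hv₂ h₃
    rw [e16₂, e17₂] at hr₃ hr₄
    rw [hm₂, e17₂] at hlt
    have a₅ : Agree 20 6 s (s₄.setReg 30 1) :=
      (((a₂'.trans h₃.agree).mono le_rfl (by norm_num)).trans a₄).trans
        (Agree.setReg _ _ (by norm_num))
    refine ⟨s₄.setReg 30 1, (hr₁.seq (hr₂.seq (RunsIn.ite_true (by simpa [Expr.eval] using h0)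
      (hr₃.seq (hr₄.seq (runsIn_setReg 30 (.const 1) s₄)))))).mono ?_, a₅, ?_,
      .inr ⟨by simp, hlt⟩⟩
    · simp only [Expr.cost, improveTime]
      omega
    · refine hf₄.mono fun u v h => ?_
      rw [← hrel₂]
      exact slotRel_mono (h₃.agree.1 16 (by norm_num)) (h₃.agree.2 3 (by norm_num))
        (h₃.agree.2 4 (by norm_num)) h₃.sub u v h

/-- Count the vertex in register `21` if it is its own mate. -/
def countBody : Program :=
  .seq (.ite (.add (.sub (.arr 6 (.reg 21)) (.reg 21)) (.sub (.reg 21) (.arr 6 (.reg 21))))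
      .skip (.setReg 20 (.add (.reg 20) (.const 1))))
    (.setReg 21 (.add (.reg 21) (.const 1)))

theorem countBody_step (s : Memory) : (countBody.exec s).reg 21 = s.reg 21 + 1 ∧
    (countBody.exec s).reg 20 = s.reg 20 + if s.arr 6 (s.reg 21) = s.reg 21 then 1 else 0 := by
  rw [countBody, Program.exec, ite_ne_eq]
  split_ifs with h <;> simp_all [Program.exec, Expr.eval]

/-- Compute the deficiency of the graph in the slots flagged in array `5` in register `20`. -/
def deficiencyCode : Program :=
  .seq (fillCode 6 17 20 (.reg 20)) (.seq (.setReg 30 (.const 1)) (.seq (.loop (.reg 30) improveCode)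
    (.seq (.setReg 20 (.const 0)) (.seq (.setReg 21 (.const 0))
      (.loop (.sub (.reg 17) (.reg 21)) countBody)))))

/-- The running time of `deficiencyCode`. -/
def deficiencyTime (N m : ℕ) : ℕ :=
  100 * (N + 1) + (N + 2) * (improveTime N m + 2)

theorem runsIn_deficiencyCode {s : Memory} (hv : ValidSlots s 5) :
    ∃ s', RunsIn deficiencyCode s s' (deficiencyTime (s.reg 17) (s.reg 16)) ∧
      s'.reg 20 = deficiency (s.reg 17) (slotRel s 5) := by
  obtain ⟨s₁, hr₁, h6⟩ := runsIn_fillCode (a := 6) (b := 17) (i := 20) (e := .reg 20)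
    (by norm_num) s (F := fun v => v) fun s' _ => by simp [Expr.eval]
  have a₁ : Agree 20 6 s s₁ := hr₁.agree (by simp [fillCode, Program.WritesFrom])
  have hm₁ : mateFn s₁ = fun v => v := by
    funext v
    simp only [mateFn, a₁.1 17 (by norm_num)]
    split_ifs with h
    · exact h6 v h
    · rfl
  have hr₂ := runsIn_setReg 30 (.const 1) s₁
  obtain ⟨s₃, hr₃, ⟨a₃, hf₃, hopt⟩, hc₃⟩ := RunsIn.loop (e := .reg 30) (p := improveCode)
    (I := fun s' => Agree 20 6 s s' ∧ IsMate (slotRel s 5) (mateFn s') ∧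
      (s'.reg 30 = 0 → IsOptimal (s.reg 17) (slotRel s 5) (mateFn s')))
    -- The additional 1 pays for the last round, which only confirms that the matching is maximum.
    (V := fun s' => (exposed (s.reg 17) (mateFn s')).card + if s'.reg 30 = 0 then 0 else 1)
    (T := improveTime (s.reg 17) (s.reg 16)) (by
      rintro s' ⟨a, hf, hopt⟩ he
      simp only [Expr.eval] at he
      have hrel : slotRel s' 5 = slotRel s 5 := a.slotRel (by norm_num) (by norm_num) (by norm_num)
      obtain ⟨s'', hr, a', hf', h⟩ := runsIn_improveCode
        ((a.validSlots (by norm_num) (by norm_num) (by norm_num)).2 hv) (by rwa [hrel])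
      rw [a.1 16 (by norm_num), a.1 17 (by norm_num)] at hr
      rw [a.1 17 (by norm_num), hrel] at h
      rw [hrel] at hf'
      refine ⟨s'', hr, ⟨a.trans a', hf', ?_⟩, ?_⟩
      · rcases h with ⟨_, h2, h3⟩ | ⟨h1, _⟩
        · rw [h2]; exact fun _ => h3
        · omega
      · rw [if_neg he]
        rcases h with ⟨h1, h2, _⟩ | ⟨h1, h2⟩
        · rw [h1, h2]; simp
        · rw [h1]; simpa using h2)
    (s := s₁.setReg 30 1) ⟨a₁.trans (Agree.setReg _ _ (by norm_num)), by
      change IsMate _ (mateFn s₁)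
      rw [hm₁]
      exact isMate_id _, by simp⟩
  have hr₄ := runsIn_setReg 20 (.const 0) s₃
  have hr₅ := runsIn_setReg 21 (.const 0) (s₃.setReg 20 0)
  have e17 : s₃.reg 17 = s.reg 17 := a₃.1 17 (by norm_num)
  obtain ⟨s₆, hr₆, ⟨h17, h6₆, hi, h20⟩, hc₆⟩ := RunsIn.loop_exec (e := .sub (.reg 17) (.reg 21))
    (p := countBody) (by simp [countBody, Program.LoopFree])
    (I := fun s' => s'.reg 17 = s.reg 17 ∧ s'.arr 6 = s₃.arr 6 ∧ s'.reg 21 ≤ s.reg 17 ∧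
      s'.reg 20 = ((range (s'.reg 21)).filter fun v => s₃.arr 6 v = v).card)
    (V := fun s' => s.reg 17 - s'.reg 21) (by
      rintro s' ⟨h1, h2, h3, h4⟩ he
      simp only [Expr.eval, h1] at he
      obtain ⟨h5, h6⟩ := countBody_step s'
      have a := Program.agree_exec (x := 20) (a := 7) (p := countBody)
        (by simp [countBody, Program.LoopFree]) (by simp [countBody, Program.WritesFrom]) s'
      refine ⟨⟨(a.1 17 (by norm_num)).trans h1, (funext (a.2 6 (by norm_num))).trans h2,
        by omega, ?_⟩, by omega⟩
      rw [h6, h5, range_add_one, filter_insert, h2, h4]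
      split_ifs
      · rw [card_insert_of_notMem (by simp)]
      · rfl)
    (s := (s₃.setReg 20 0).setReg 21 0) ⟨by simpa using e17, rfl, by simp, by simp⟩
  simp only [Expr.eval, h17] at hc₆ hc₃
  refine ⟨s₆, (hr₁.seq (hr₂.seq (hr₃.seq (hr₄.seq (hr₅.seq hr₆))))).mono ?_, ?_⟩
  · have hx : (exposed (s.reg 17) (mateFn (s₁.setReg 30 1))).card ≤ s.reg 17 :=
      (card_le_card (filter_subset _ _)).trans (card_range _).le
    simp only [Program.time, Expr.cost, countBody, Memory.setReg_reg, if_true, deficiencyTime,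
      Nat.one_ne_zero, if_false]
    have h1 : ((exposed (s.reg 17) (mateFn (s₁.setReg 30 1))).card + 1 + 1) *
        (improveTime (s.reg 17) (s.reg 16) + 1 + 1) ≤
        (s.reg 17 + 2) * (improveTime (s.reg 17) (s.reg 16) + 2) :=
      Nat.mul_le_mul (by omega) le_rfl
    omega
  · rw [h20, ← hopt hc₃]
    have e : s₆.reg 21 = s.reg 17 := by omega
    rw [e]
    congr 1
    ext v
    rw [mem_exposed, mem_filter, mem_range]
    constructor
    · rintro ⟨h1, h2⟩
      exact ⟨h1, by rwa [mateFn_of_lt (by rwa [e17])]⟩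
    · rintro ⟨h1, h2⟩
      exact ⟨h1, by rwa [mateFn_of_lt (by rwa [e17])] at h2⟩

end MatchingGap

/-! ### Writing the restricted and the doubled graph into slots -/

namespace MatchingGap
open Finset

/-- The flagged slots, as ordered pairs. -/
def slotEntry (s : Memory) (u v : ℕ) : Prop :=
  ∃ p < s.reg 16, s.arr 5 p ≠ 0 ∧ s.arr 3 p = u ∧ s.arr 4 p = v

theorem slotRel_iff_slotEntry {s : Memory} {u v : ℕ} :
    slotRel s 5 u v ↔ slotEntry s u v ∨ slotEntry s v u := by
  constructor
  · rintro ⟨p, hp, h5, h | h⟩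
    · exact .inl ⟨p, hp, h5, h⟩
    · exact .inr ⟨p, hp, h5, h⟩
  · rintro (⟨p, hp, h5, h⟩ | ⟨p, hp, h5, h⟩)
    · exact ⟨p, hp, h5, .inl h⟩
    · exact ⟨p, hp, h5, .inr h⟩

/-- The endpoints in the slots are vertices. -/
def SlotsLt (s : Memory) : Prop :=
  ∀ p < s.reg 16, s.arr 3 p < s.reg 17 ∧ s.arr 4 p < s.reg 17

/-- Append a slot with endpoints `a` and `b` and flag `h`. -/
def pushCode (a b h : Expr) : Program :=
  .seq (.setArr 3 (.reg 16) a) (.seq (.setArr 4 (.reg 16) b) (.seq (.setArr 5 (.reg 16) h)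
    (.setReg 16 (.add (.reg 16) (.const 1)))))

/-- The effect of appending a slot. -/
structure IsPush (s s' : Memory) (a b h : ℕ) : Prop where
  reg : ∀ y ≠ 16, s'.reg y = s.reg y
  count : s'.reg 16 = s.reg 16 + 1
  agree : Agree 16 3 s s'
  lt : SlotsLt s → a < s.reg 17 → b < s.reg 17 → SlotsLt s'
  entry : ∀ u v, slotEntry s' u v ↔ slotEntry s u v ∨ (h ≠ 0 ∧ u = a ∧ v = b)

theorem isPush_pushCode {a b h : Expr} (s : Memory)
    (hb : ∀ s' : Memory, s'.reg = s.reg → b.eval s' = b.eval s)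
    (hh : ∀ s' : Memory, s'.reg = s.reg → h.eval s' = h.eval s) :
    IsPush s ((pushCode a b h).exec s) (a.eval s) (b.eval s) (h.eval s) := by
  have e : (pushCode a b h).exec s = (((s.setArr 3 (s.reg 16) (a.eval s)).setArr 4 (s.reg 16)
      (b.eval s)).setArr 5 (s.reg 16) (h.eval s)).setReg 16 (s.reg 16 + 1) := by
    simp only [pushCode, Program.exec, Expr.eval, Memory.setArr_reg]
    rw [hb _ (by simp), hh _ (by simp)]
  rw [e]
  refine ⟨fun y hy => by simp [hy], by simp, ?_, ?_, ?_⟩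
  · exact (((Agree.setArr _ _ _ (by norm_num)).trans (Agree.setArr _ _ _ (by norm_num))).trans
      (Agree.setArr _ _ _ (by norm_num))).trans (Agree.setReg _ _ le_rfl)
  · intro hlt h1 h2 p hp
    simp only [Memory.setReg_reg, if_true] at hp
    by_cases hps : p = s.reg 16
    · subst hps
      simpa using ⟨h1, h2⟩
    · have := hlt p (by omega)
      simpa [hps] using this
  · intro u v
    constructor
    · rintro ⟨p, hp, h5, h3, h4⟩
      simp only [Memory.setReg_reg, if_true] at hp
      by_cases hps : p = s.reg 16
      · subst hps
        right
        simpa [eq_comm] using And.intro h5 (And.intro h3 h4)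
      · left
        refine ⟨p, by omega, ?_⟩
        simpa [hps] using And.intro h5 (And.intro h3 h4)
    · rintro (⟨p, hp, h5, h3, h4⟩ | ⟨h0, rfl, rfl⟩)
      · have hps : p ≠ s.reg 16 := by omega
        refine ⟨p, by simp; omega, ?_⟩
        simpa [hps] using And.intro h5 (And.intro h3 h4)
      · exact ⟨s.reg 16, by simp, by simpa using h0, by simp, by simp⟩

/-- Decide in register `24` whether the pair in registers `20` and `21` is an edge of the
restriction, and record edges into the deleted set in register `23`. -/
def flagCode : Program :=
  .seq (.setReg 24 (.const 0)) (.ite (.arr 0 (.reg 22))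
    (.ite (.arr 2 (.reg 21)) (.setReg 23 (.const 1))
      (.ite (.arr 2 (.reg 20)) .skip
        (.ite (.arr 2 (.add (.reg 20) (.reg 0)))
          (.ite (.arr 2 (.add (.reg 21) (.reg 0))) (.setReg 24 (.const 1)) .skip)
          (.ite (.arr 2 (.add (.reg 21) (.reg 0))) .skip (.setReg 24 (.const 1)))))) .skip)

theorem flagCode_step (s : Memory) :
    (∀ y, y ≠ 23 → y ≠ 24 → (flagCode.exec s).reg y = s.reg y) ∧
    (flagCode.exec s).arr = s.arr ∧
    ((flagCode.exec s).reg 24 ≠ 0 ↔ s.arr 0 (s.reg 22) ≠ 0 ∧ ¬ s.arr 2 (s.reg 20) ≠ 0 ∧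
      ¬ s.arr 2 (s.reg 21) ≠ 0 ∧
      (s.arr 2 (s.reg 20 + s.reg 0) ≠ 0 ↔ s.arr 2 (s.reg 21 + s.reg 0) ≠ 0)) ∧
    ((flagCode.exec s).reg 23 ≠ 0 ↔ s.reg 23 ≠ 0 ∨
      (s.arr 0 (s.reg 22) ≠ 0 ∧ s.arr 2 (s.reg 21) ≠ 0)) := by
  by_cases h1 : s.arr 0 (s.reg 22) = 0
  · refine ⟨fun y h h' => ?_, ?_, ?_, ?_⟩ <;> simp_all [flagCode, Program.exec, Expr.eval]
  by_cases h2 : s.arr 2 (s.reg 21) = 0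
  · by_cases h3 : s.arr 2 (s.reg 20) = 0
    · by_cases h4 : s.arr 2 (s.reg 20 + s.reg 0) = 0 <;>
      by_cases h5 : s.arr 2 (s.reg 21 + s.reg 0) = 0 <;>
      refine ⟨fun y h h' => ?_, ?_, ?_, ?_⟩ <;>
      simp_all [flagCode, Program.exec, Expr.eval]
    · refine ⟨fun y h h' => ?_, ?_, ?_, ?_⟩ <;> simp_all [flagCode, Program.exec, Expr.eval]
  · refine ⟨fun y h h' => ?_, ?_, ?_, ?_⟩ <;> simp_all [flagCode, Program.exec, Expr.eval]

/-- Append the slots for the pair in registers `20` and `21`. -/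
def pairCode : Program :=
  .seq flagCode (.seq (pushCode (.reg 20) (.reg 21) (.reg 24))
    (.seq (.ite (.reg 15) .skip (.setReg 24 (.const 0)))
    (.seq (pushCode (.add (.reg 20) (.reg 0)) (.add (.reg 21) (.reg 0)) (.reg 24))
    (.seq (.setReg 21 (.add (.reg 21) (.const 1))) (.setReg 22 (.add (.reg 22) (.const 1)))))))

/-- Append the slot for the vertex in register `20` and its copy. -/
def linkCode : Program :=
  .seq (.setReg 24 (.const 0)) (.seq (.ite (.reg 15) (.ite (.arr 2 (.add (.reg 20) (.reg 0))) .skip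
      (.ite (.reg 23) .skip (.setReg 24 (.const 1)))) .skip)
    (.seq (pushCode (.reg 20) (.add (.reg 20) (.reg 0)) (.reg 24))
    (.seq (.setReg 20 (.add (.reg 20) (.const 1))) (.seq (.setReg 21 (.const 0))
      (.setReg 23 (.const 0))))))

/-- Write the slots of `restrictRel` or, if register `15` is nonzero, of `doubleRel`. -/
def buildCode : Program :=
  .seq (.setReg 16 (.const 0)) (.seq (.setReg 17 (.add (.reg 0) (.reg 0)))
    (.seq (.setReg 20 (.const 0)) (.seq (.setReg 21 (.const 0)) (.seq (.setReg 22 (.const 0))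
    (.seq (.setReg 23 (.const 0)) (.loop (.sub (.reg 0) (.reg 20))
      (.ite (.sub (.reg 0) (.reg 21)) pairCode linkCode)))))))

/-- The pairs before `i j` in the lexicographic order. -/
def Before (i j u v : ℕ) : Prop := u < i ∨ (u = i ∧ v < j)

/-- The state of `buildCode` between two pairs. -/
structure IsBuilding (n : ℕ) (R : ℕ → ℕ → Prop) (S T : ℕ → Prop) (s₀ s : Memory) : Prop where
  agree : Agree 16 3 s₀ s
  verts : s.reg 17 = n + n
  row : s.reg 20 ≤ n
  col : s.reg 21 ≤ n
  cell : s.reg 22 = s.reg 20 * n + s.reg 21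
  count : s.reg 16 + 2 * ((n - s.reg 20) * (n + 1) + (n - s.reg 21)) ≤ 2 * (n * (n + 1) + n)
  lt : SlotsLt s
  deleted : s.reg 23 ≠ 0 ↔ ∃ x < s.reg 21, R (s.reg 20) x ∧ S x
  entry : ∀ u v, slotEntry s u v ↔
    (restrictRel R S T u v ∧ Before (s.reg 20) (s.reg 21) u v) ∨
    (s₀.reg 15 ≠ 0 ∧ n ≤ u ∧ n ≤ v ∧ restrictRel R S T (u - n) (v - n) ∧
      Before (s.reg 20) (s.reg 21) (u - n) (v - n)) ∨
    (s₀.reg 15 ≠ 0 ∧ linkRel n R S T u v ∧ u < s.reg 20)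

variable {n : ℕ} {R : ℕ → ℕ → Prop} {S T : ℕ → Prop} {s₀ s : Memory}

/-- Register 22 carries the cell index as a running counter because the machine has no
multiplication. Both slots are appended whether or not the pair is an edge; the flags decide, so the
number of slots depends only on the position. -/
theorem IsBuilding.pair (h : IsBuilding n R S T s₀ s) (hn : s₀.reg 0 = n)
    (hR : ∀ u < n, ∀ v < n, s₀.arr 0 (u * n + v) ≠ 0 ↔ R u v)
    (hS : ∀ u < n, s₀.arr 2 u ≠ 0 ↔ S u) (hT : ∀ u < n, s₀.arr 2 (u + n) ≠ 0 ↔ T u)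
    (hi : s.reg 20 < n) (hj : s.reg 21 < n) :
    IsBuilding n R S T s₀ (pairCode.exec s) ∧ (pairCode.exec s).reg 20 = s.reg 20 ∧
      (pairCode.exec s).reg 21 = s.reg 21 + 1 := by
  obtain ⟨f1, f2, f3, f4⟩ := flagCode_step s
  set s₁ := flagCode.exec s with hs₁
  have n0 : s.reg 0 = n := (h.agree.1 0 (by norm_num)).trans hn
  have g₁ : Agree 16 3 s s₁ := ⟨fun y hy => f1 y (by omega) (by omega), fun b _ _ => by rw [f2]⟩
  rw [n0, h.agree.2 0 (by norm_num), h.agree.2 2 (by norm_num), h.agree.2 2 (by norm_num),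
    h.agree.2 2 (by norm_num), h.agree.2 2 (by norm_num), h.cell, hR _ hi _ hj, hS _ hi, hS _ hj,
    hT _ hi, hT _ hj] at f3
  rw [h.agree.2 0 (by norm_num), h.agree.2 2 (by norm_num), h.cell, hR _ hi _ hj, hS _ hj] at f4
  have p₂ := isPush_pushCode (a := .reg 20) (b := .reg 21) (h := .reg 24) s₁
    (fun s' e => by simp [Expr.eval, e])
    (fun s' e => by simp [Expr.eval, e])
  set s₂ := (pushCode (.reg 20) (.reg 21) (.reg 24)).exec s₁ with hs₂
  set s₃ := (Program.ite (.reg 15) .skip (.setReg 24 (.const 0))).exec s₂ with hs₃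
  have r₃ : (∀ y ≠ 24, s₃.reg y = s₂.reg y) ∧ s₃.arr = s₂.arr ∧
      (s₃.reg 24 ≠ 0 ↔ s₂.reg 15 ≠ 0 ∧ s₂.reg 24 ≠ 0) := by
    by_cases h15 : s₂.reg 15 = 0
    · simp +contextual [hs₃, Program.exec, Expr.eval, h15]
    · simp [hs₃, Program.exec, Expr.eval, h15]
  have p₄ := isPush_pushCode (a := .add (.reg 20) (.reg 0)) (b := .add (.reg 21) (.reg 0))
    (h := .reg 24) s₃ (fun s' e => by simp [Expr.eval, e])
    (fun s' e => by simp [Expr.eval, e])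
  set s₄ := (pushCode (.add (.reg 20) (.reg 0)) (.add (.reg 21) (.reg 0)) (.reg 24)).exec s₃ with hs₄
  have e₅ : pairCode.exec s = (s₄.setReg 21 (s₄.reg 21 + 1)).setReg 22 (s₄.reg 22 + 1) := by
    simp [pairCode, Program.exec, Expr.eval, hs₄, hs₃, hs₂, hs₁]
    rfl
  have reg₄ : ∀ y, y ≠ 16 → y ≠ 23 → y ≠ 24 → s₄.reg y = s.reg y := fun y h1 h2 h3 => by
    rw [p₄.reg y h1, r₃.1 y h3, p₂.reg y h1, f1 y h2 h3]
  have e23 : s₄.reg 23 = s₁.reg 23 := by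
    rw [p₄.reg _ (by norm_num), r₃.1 _ (by norm_num), p₂.reg _ (by norm_num)]
  have e16 : s₄.reg 16 = s.reg 16 + 2 := by
    rw [p₄.count, r₃.1 _ (by norm_num), p₂.count, f1 _ (by norm_num) (by norm_num)]
  have e15 : s₂.reg 15 = s₀.reg 15 := by
    rw [p₂.reg _ (by norm_num), f1 _ (by norm_num) (by norm_num), h.agree.1 _ (by norm_num)]
  have e24 : s₂.reg 24 = s₁.reg 24 := p₂.reg _ (by norm_num)
  have hent₃ : ∀ u v, slotEntry s₃ u v ↔ slotEntry s₂ u v := fun u v => by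
    simp only [slotEntry, r₃.2.1, r₃.1 16 (by norm_num)]
  have hent₁ : ∀ u v, slotEntry s₁ u v ↔ slotEntry s u v := fun u v => by
    simp only [slotEntry, f2, f1 16 (by norm_num) (by norm_num)]
  rw [e₅]
  refine ⟨⟨?_, ?_, ?_, ?_, ?_, ?_, ?_, ?_, ?_⟩, ?_, ?_⟩
  · refine ((((((h.agree.trans g₁).trans p₂.agree).trans ⟨fun y hy => r₃.1 y (by omega),
      fun b _ _ => by rw [r₃.2.1]⟩).trans p₄.agree).trans
      (Agree.setReg _ _ (by norm_num))).trans (Agree.setReg _ _ (by norm_num)))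
  · simpa [reg₄] using h.verts
  · simpa [reg₄] using h.row
  · simpa [reg₄] using hj
  · simp [reg₄, h.cell, Nat.add_assoc]
  · have := h.count
    simp [reg₄, e16]
    omega
  · have l₁ : SlotsLt s₁ := by
      simpa only [SlotsLt, f2, f1 16 (by norm_num) (by norm_num), f1 17 (by norm_num) (by norm_num)]
        using h.lt
    have l₂ := p₂.lt l₁ (by simp [Expr.eval, f1, h.verts]; omega)
      (by simp [Expr.eval, f1, h.verts]; omega)
    have l₃ : SlotsLt s₃ := by
      simpa only [SlotsLt, r₃.2.1, r₃.1 16 (by norm_num), r₃.1 17 (by norm_num)] using l₂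
    exact p₄.lt l₃ (by simp [Expr.eval, r₃.1, p₂.reg, f1, h.verts, n0]; omega)
      (by simp [Expr.eval, r₃.1, p₂.reg, f1, h.verts, n0]; omega)
  · simp only [Memory.setReg_reg]
    simp only [reg₄, e23, f4, h.deleted, ne_eq, not_false_eq_true, if_true, if_false,
      Nat.reduceEqDiff]
    constructor
    · rintro (⟨x, hx, h1⟩ | h1)
      · exact ⟨x, by omega, h1⟩
      · exact ⟨_, by omega, h1⟩
    · rintro ⟨x, hx, h1⟩
      rcases Nat.lt_succ_iff_lt_or_eq.1 hx with hx | rfl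
      · exact .inl ⟨x, hx, h1⟩
      · exact .inr h1
  · intro u v
    change slotEntry s₄ u v ↔ _
    rw [p₄.entry, hent₃, p₂.entry, hent₁, h.entry]
    simp only [Expr.eval, r₃.2.2, e15, e24, f3, Memory.setReg_reg, reg₄, ne_eq, not_false_eq_true,
      if_true, if_false, Nat.reduceEqDiff, r₃.1, p₂.reg, f1, n0]
    change ((_ ∨ restrictRel R S T (s.reg 20) (s.reg 21) ∧ _) ∨
      (_ ∧ restrictRel R S T (s.reg 20) (s.reg 21)) ∧ _) ↔ _
    have hb : ∀ x y, Before (s.reg 20) (s.reg 21 + 1) x y ↔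
        Before (s.reg 20) (s.reg 21) x y ∨ (x = s.reg 20 ∧ y = s.reg 21) := by
      intro x y
      simp only [Before]
      omega
    simp only [hb]
    constructor
    · rintro ((h1 | ⟨h1, rfl, rfl⟩) | ⟨⟨h1, h2⟩, rfl, rfl⟩)
      · rcases h1 with h1 | h1 | h1
        · exact .inl ⟨h1.1, .inl h1.2⟩
        · exact .inr (.inl ⟨h1.1, h1.2.1, h1.2.2.1, h1.2.2.2.1, .inl h1.2.2.2.2⟩)
        · exact .inr (.inr h1)
      · exact .inl ⟨h1, .inr ⟨rfl, rfl⟩⟩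
      · exact .inr (.inl ⟨h1, by omega, by omega, by simpa using h2, .inr (by simp)⟩)
    · rintro (⟨h1, h2 | ⟨rfl, rfl⟩⟩ | ⟨h1, h2, h3, h4, h5 | ⟨h5, h6⟩⟩ | h1)
      · exact .inl (.inl (.inl ⟨h1, h2⟩))
      · exact .inl (.inr ⟨h1, rfl, rfl⟩)
      · exact .inl (.inl (.inr (.inl ⟨h1, h2, h3, h4, h5⟩)))
      · exact .inr ⟨⟨h1, by rwa [h5, h6] at h4⟩, by omega, by omega⟩
      · exact .inl (.inl (.inr (.inr h1)))
  · simp [reg₄]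
  · simp [reg₄]

/-- At the end of a row, register 23 has seen all neighbours of the row's vertex and settles the
condition on `S` in `linkRel`. The positions (i, n) and (i + 1, 0) have the same predecessors among
pairs with second entry below `n`. -/
theorem IsBuilding.link (h : IsBuilding n R S T s₀ s) (hn : s₀.reg 0 = n) (hG : IsGraph n R)
    (hT : ∀ u < n, s₀.arr 2 (u + n) ≠ 0 ↔ T u)
    (hi : s.reg 20 < n) (hj : s.reg 21 = n) :
    IsBuilding n R S T s₀ (linkCode.exec s) ∧ (linkCode.exec s).reg 20 = s.reg 20 + 1 ∧
      (linkCode.exec s).reg 21 = 0 := by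
  have n0 : s.reg 0 = n := (h.agree.1 0 (by norm_num)).trans hn
  have e15 : s.reg 15 = s₀.reg 15 := h.agree.1 15 (by norm_num)
  set s₁ := (Program.seq (.setReg 24 (.const 0)) (.ite (.reg 15)
    (.ite (.arr 2 (.add (.reg 20) (.reg 0))) .skip
      (.ite (.reg 23) .skip (.setReg 24 (.const 1)))) .skip)).exec s with hs₁
  have r₁ : (∀ y ≠ 24, s₁.reg y = s.reg y) ∧ s₁.arr = s.arr ∧
      (s₁.reg 24 ≠ 0 ↔ s.reg 15 ≠ 0 ∧ ¬ s.arr 2 (s.reg 20 + n) ≠ 0 ∧ ¬ s.reg 23 ≠ 0) := by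
    by_cases h15 : s.reg 15 = 0
    · simp +contextual [hs₁, Program.exec, Expr.eval, h15]
    · by_cases h2 : s.arr 2 (s.reg 20 + n) = 0
      · by_cases h3 : s.reg 23 = 0 <;>
        simp +contextual [hs₁, Program.exec, Expr.eval, h15, n0, h2, h3]
      · simp +contextual [hs₁, Program.exec, Expr.eval, h15, n0, h2]
  have hlink : s₁.reg 24 ≠ 0 ↔ s₀.reg 15 ≠ 0 ∧ linkRel n R S T (s.reg 20) (s.reg 20 + n) := by
    rw [r₁.2.2, e15, h.agree.2 2 (by norm_num), hT _ hi, h.deleted, hj]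
    constructor
    · rintro ⟨h1, h2, h3⟩
      exact ⟨h1, hi, rfl, h2, fun w hw hS => h3 ⟨w, hG.lt _ _ (hG.symm _ _ hw), hw, hS⟩⟩
    · rintro ⟨h1, _, _, h2, h3⟩
      exact ⟨h1, h2, fun ⟨w, _, hw, hS⟩ => h3 w hw hS⟩
  have p₂ := isPush_pushCode (a := .reg 20) (b := .add (.reg 20) (.reg 0)) (h := .reg 24) s₁
    (fun s' e => by simp [Expr.eval, e]) (fun s' e => by simp [Expr.eval, e])
  set s₂ := (pushCode (.reg 20) (.add (.reg 20) (.reg 0)) (.reg 24)).exec s₁ with hs₂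
  have e₃ : linkCode.exec s = ((s₂.setReg 20 (s₂.reg 20 + 1)).setReg 21 0).setReg 23 0 := by
    simp [linkCode, Program.exec, Expr.eval, hs₂, hs₁]
  have reg₂ : ∀ y, y ≠ 16 → y ≠ 24 → s₂.reg y = s.reg y := fun y h1 h2 => by
    rw [p₂.reg y h1, r₁.1 y h2]
  have hent₁ : ∀ u v, slotEntry s₁ u v ↔ slotEntry s u v := fun u v => by
    simp only [slotEntry, r₁.2.1, r₁.1 16 (by norm_num)]
  rw [e₃]
  refine ⟨⟨?_, ?_, ?_, ?_, ?_, ?_, ?_, ?_, ?_⟩, ?_, ?_⟩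
  · exact ((((h.agree.trans ⟨fun y hy => r₁.1 y (by omega), fun b _ _ => by rw [r₁.2.1]⟩).trans
      p₂.agree).trans (Agree.setReg _ _ (by norm_num))).trans (Agree.setReg _ _ (by norm_num))).trans
      (Agree.setReg _ _ (by norm_num))
  · simpa [reg₂] using h.verts
  · simpa [reg₂] using hi
  · simp
  · simp [reg₂, h.cell, hj, Nat.add_mul]
  · have := h.count
    obtain ⟨d, hd⟩ : ∃ d, n - s.reg 20 = d + 1 := ⟨n - s.reg 20 - 1, by omega⟩
    have hd' : n - (s.reg 20 + 1) = d := by omega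
    rw [hd, hj, Nat.add_mul] at this
    simp [reg₂, p₂.count, r₁.1, hd']
    omega
  · have l₁ : SlotsLt s₁ := by
      simpa only [SlotsLt, r₁.2.1, r₁.1 16 (by norm_num), r₁.1 17 (by norm_num)] using h.lt
    exact p₂.lt l₁ (by simp [Expr.eval, r₁.1, h.verts]; omega)
      (by simp [Expr.eval, r₁.1, h.verts, n0]; omega)
  · simp
  · intro u v
    change slotEntry s₂ u v ↔ _
    rw [p₂.entry, hent₁, h.entry]
    simp only [Expr.eval, hlink, Memory.setReg_reg, reg₂, ne_eq, not_false_eq_true,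
      if_true, if_false, Nat.reduceEqDiff, r₁.1, n0, hj]
    have hb : ∀ x y, y < n → (Before (s.reg 20 + 1) 0 x y ↔ Before (s.reg 20) n x y) := by
      intro x y hy
      simp only [Before]
      omega
    have hlt : ∀ x y, restrictRel R S T x y → y < n := fun x y hxy => hG.lt' hxy.1
    constructor
    · rintro ((h1 | h1 | h1) | ⟨⟨h1, h2⟩, rfl, rfl⟩)
      · exact .inl ⟨h1.1, (hb _ _ (hlt _ _ h1.1)).2 h1.2⟩
      · exact .inr (.inl ⟨h1.1, h1.2.1, h1.2.2.1, h1.2.2.2.1,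
          (hb _ _ (hlt _ _ h1.2.2.2.1)).2 h1.2.2.2.2⟩)
      · exact .inr (.inr ⟨h1.1, h1.2.1, by omega⟩)
      · exact .inr (.inr ⟨h1, h2, by omega⟩)
    · rintro (h1 | h1 | ⟨h1, h2, h3⟩)
      · exact .inl (.inl ⟨h1.1, (hb _ _ (hlt _ _ h1.1)).1 h1.2⟩)
      · exact .inl (.inr (.inl ⟨h1.1, h1.2.1, h1.2.2.1, h1.2.2.2.1,
          (hb _ _ (hlt _ _ h1.2.2.2.1)).1 h1.2.2.2.2⟩))
      · rcases Nat.lt_succ_iff_lt_or_eq.1 h3 with h3 | rfl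
        · exact .inl (.inr (.inr ⟨h1, h2, h3⟩))
        · exact .inr ⟨⟨h1, by rwa [← h2.2.1]⟩, rfl, h2.2.1⟩
  · simp [reg₂]
  · simp

/-- The running time of `buildCode`. -/
def buildTime (n : ℕ) : ℕ := 200 * (n * (n + 1) + n + 1)

theorem runsIn_buildCode (hn : s₀.reg 0 = n) (hG : IsGraph n R)
    (hR : ∀ u < n, ∀ v < n, s₀.arr 0 (u * n + v) ≠ 0 ↔ R u v)
    (hS : ∀ u < n, s₀.arr 2 u ≠ 0 ↔ S u) (hT : ∀ u < n, s₀.arr 2 (u + n) ≠ 0 ↔ T u) :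
    ∃ s', RunsIn buildCode s₀ s' (buildTime n) ∧ s'.reg 17 = n + n ∧
      s'.reg 16 ≤ 2 * (n * (n + 1) + n) ∧ ValidSlots s' 5 ∧
      (s₀.reg 15 = 0 → slotRel s' 5 = restrictRel R S T) ∧
      (s₀.reg 15 ≠ 0 → slotRel s' 5 = doubleRel n R S T) := by
  subst hn
  obtain ⟨s, hr, h, hc⟩ := RunsIn.loop_exec (e := .sub (.reg 0) (.reg 20))
    (p := .ite (.sub (.reg 0) (.reg 21)) pairCode linkCode)
    (by simp [pairCode, linkCode, flagCode, pushCode, Program.LoopFree])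
    (I := IsBuilding (s₀.reg 0) R S T s₀)
    -- A row takes `n` pair steps and one link step, hence the factor `n + 1`.
    (V := fun s => (s₀.reg 0 - s.reg 20) * (s₀.reg 0 + 1) + (s₀.reg 0 - s.reg 21)) (by
      intro s h he
      have n0 : s.reg 0 = s₀.reg 0 := h.agree.1 0 (by norm_num)
      simp only [Expr.eval, n0] at he
      simp only [Program.exec, Expr.eval, n0]
      have hcol := h.col
      by_cases hj : s.reg 21 < s₀.reg 0
      · rw [if_neg (by omega)]
        obtain ⟨h1, h2, h3⟩ := h.pair rfl hR hS hT (by omega) hj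
        refine ⟨h1, ?_⟩
        rw [h2, h3]
        omega
      · rw [if_pos (by omega)]
        obtain ⟨h1, h2, h3⟩ := h.link rfl hG hT (by omega) (by omega)
        refine ⟨h1, ?_⟩
        obtain ⟨d, hd⟩ : ∃ d, s₀.reg 0 - s.reg 20 = d + 1 := ⟨s₀.reg 0 - s.reg 20 - 1, by omega⟩
        have hd' : s₀.reg 0 - (s.reg 20 + 1) = d := by omega
        rw [h2, h3, hd, hd', Nat.add_mul]
        omega)
    (s := ((((((s₀.setReg 16 0).setReg 17 (s₀.reg 0 + s₀.reg 0)).setReg 20 0).setReg 21 0).setReg 22 0).setReg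
      23 0)) ⟨by
        refine ⟨fun y hy => ?_, fun _ _ _ => rfl⟩
        have h1 : y ≠ 16 ∧ y ≠ 17 ∧ y ≠ 20 ∧ y ≠ 21 ∧ y ≠ 22 ∧ y ≠ 23 := by omega
        simp [h1], by simp, by simp, by simp, by simp, by simp, fun p hp => by simp at hp, by simp, by
        intro u v
        simp [slotEntry, Before]⟩
  have n0 : s.reg 0 = s₀.reg 0 := h.agree.1 0 (by norm_num)
  simp only [Expr.eval, n0] at hc
  have e20 : s.reg 20 = s₀.reg 0 := by have := h.row; omega
  have hent := h.entry
  have hb : ∀ x y, restrictRel R S T x y → Before (s₀.reg 0) (s.reg 21) x y := fun x y hxy =>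
    .inl (hG.lt _ _ hxy.1)
  rw [e20] at hent
  have h0 : s₀.reg 15 = 0 → slotRel s 5 = restrictRel R S T := by
    intro h15
    funext u v
    apply propext
    simp only [slotRel_iff_slotEntry, hent, h15, ne_eq, not_true_eq_false, false_and, or_false]
    constructor
    · rintro (h1 | h1)
      · exact h1.1
      · exact (hG.restrict S T).symm _ _ h1.1
    · exact fun h1 => .inl ⟨h1, hb _ _ h1⟩
  have h1 : s₀.reg 15 ≠ 0 → slotRel s 5 = doubleRel (s₀.reg 0) R S T := by
    intro h15
    funext u v
    apply propext
    simp only [slotRel_iff_slotEntry, hent, h15, ne_eq, not_false_eq_true, true_and]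
    have hD := (hG.double S T).symm
    constructor
    · rintro (h1 | h1)
      · rcases h1 with h1 | h1 | h1
        · exact .inl h1.1
        · exact .inr (.inl ⟨h1.1, h1.2.1, h1.2.2.1⟩)
        · exact .inr (.inr (.inl h1.1))
      · apply hD
        rcases h1 with h1 | h1 | h1
        · exact .inl h1.1
        · exact .inr (.inl ⟨h1.1, h1.2.1, h1.2.2.1⟩)
        · exact .inr (.inr (.inl h1.1))
    · rintro (h1 | h1 | h1 | h1)
      · exact .inl (.inl ⟨h1, hb _ _ h1⟩)
      · exact .inl (.inr (.inl ⟨h1.1, h1.2.1, h1.2.2, hb _ _ h1.2.2⟩))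
      · exact .inl (.inr (.inr ⟨h1, h1.1⟩))
      · exact .inr (.inr (.inr ⟨h1, h1.1⟩))
  refine ⟨s, ?_, h.verts, by have := h.count; omega, ?_, h0, h1⟩
  · refine ((runsIn_setReg 16 (.const 0) _).seq ((runsIn_setReg 17 (.add (.reg 0) (.reg 0)) _).seq
      ((runsIn_setReg 20 (.const 0) _).seq ((runsIn_setReg 21 (.const 0) _).seq
      ((runsIn_setReg 22 (.const 0) _).seq ((runsIn_setReg 23 (.const 0) _).seq hr)))))).mono ?_
    simp [Program.time, Expr.cost, pairCode, linkCode, flagCode, pushCode, buildTime]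
    omega
  · intro p hp
    obtain ⟨h3, h4⟩ := h.lt p hp
    refine ⟨h3, h4, fun h5 => ?_⟩
    have hrel : slotRel s 5 (s.arr 3 p) (s.arr 4 p) := ⟨p, hp, h5, .inl ⟨rfl, rfl⟩⟩
    by_cases h15 : s₀.reg 15 = 0
    · rw [h0 h15] at hrel
      exact (hG.restrict S T).ne _ _ hrel
    · rw [h1 h15] at hrel
      exact (hG.double S T).ne _ _ hrel

end MatchingGap

/-! ### Counting in base b -/

namespace MatchingGap
open Finset

/-- The digit `i` of `x` in base `b`. -/
def digit (b x i : ℕ) : ℕ := x / b ^ i % b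

theorem exists_digit_eq {b : ℕ} {L : ℕ} {d : ℕ → ℕ} (hd : ∀ i < L, d i < b) :
    ∃ x < b ^ L, ∀ i < L, digit b x i = d i := by
  induction L generalizing d with
  | zero => exact ⟨0, by simp, by simp⟩
  | succ L ih =>
    obtain ⟨x, hx, h⟩ := ih (d := fun i => d (i + 1)) fun i hi => hd _ (by omega)
    have h0 := hd 0 (by omega)
    refine ⟨d 0 + b * x, ?_, fun i hi => ?_⟩
    · calc d 0 + b * x < b * (x + 1) := by rw [Nat.mul_add]; omega
        _ ≤ b * b ^ L := Nat.mul_le_mul_left _ hx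
        _ = b ^ (L + 1) := (pow_succ' _ _).symm
    · cases i with
      | zero => simp [digit, Nat.mod_eq_of_lt h0]
      | succ i =>
        rw [← h i (by omega), digit, digit, pow_succ', ← Nat.div_div_eq_div_mul,
          Nat.add_mul_div_left _ _ (by omega), Nat.div_eq_of_lt h0, Nat.zero_add]

theorem succ_eq_of_digit_eq {b x i : ℕ} (h : ∀ k < i, digit b x k + 1 = b) :
    x + 1 = (x / b ^ i + 1) * b ^ i := by
  induction i with
  | zero => simp
  | succ i ih =>
    have h1 := ih fun k hk => h k (by omega)
    have h2 := h i (by omega)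
    have h3 := Nat.div_add_mod (x / b ^ i) b
    rw [digit] at h2
    rw [h1, pow_succ, ← Nat.div_div_eq_div_mul]
    have h4 : x / b ^ i + 1 = (x / b ^ i / b + 1) * b := by
      rw [Nat.add_mul, Nat.mul_comm _ b]
      omega
    rw [h4]
    ring

/-- If the digits below `i` are maximal, `x + 1` equals `(x / b ^ i + 1) * b ^ i`: they become 0.
Since digit `i` is not maximal, no carry passes it. -/
theorem digit_succ {b x i : ℕ} (hb : 0 < b) (h : ∀ k < i, digit b x k + 1 = b)
    (hi : digit b x i + 1 < b) (k : ℕ) :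
    digit b (x + 1) k = if k < i then 0 else if k = i then digit b x i + 1 else digit b x k := by
  have h1 := succ_eq_of_digit_eq h
  have hbi : 0 < b ^ i := Nat.pow_pos hb
  have h2 : (x + 1) / b ^ i = x / b ^ i + 1 := by
    conv_lhs => rw [h1]
    exact Nat.mul_div_cancel _ hbi
  have h3 : (x / b ^ i + 1) % b = digit b x i + 1 := by
    rw [Nat.add_mod, digit]
    rw [digit] at hi
    rw [Nat.mod_eq_of_lt (a := 1) (by omega), Nat.mod_eq_of_lt hi]
  split_ifs with hk hk'
  · obtain ⟨d, rfl⟩ : ∃ d, i = k + 1 + d := ⟨i - k - 1, by omega⟩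
    rw [digit, h1, pow_add _ (k + 1), pow_succ,
      show (x / (b ^ k * b * b ^ d) + 1) * (b ^ k * b * b ^ d) =
        b ^ k * (b * ((x / (b ^ k * b * b ^ d) + 1) * b ^ d)) by ring,
      Nat.mul_div_cancel_left _ (Nat.pow_pos hb), Nat.mul_mod_right]
  · subst hk'
    rw [digit, h2, h3]
  · obtain ⟨d, rfl⟩ : ∃ d, k = i + (d + 1) := ⟨k - i - 1, by omega⟩
    have h4 : (x / b ^ i + 1) / b = x / b ^ i / b := by
      have h5 := Nat.div_add_mod (x / b ^ i) b
      have h6 := Nat.div_add_mod (x / b ^ i + 1) b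
      rw [h3, digit] at h6
      have h7 : b * ((x / b ^ i + 1) / b) = b * (x / b ^ i / b) := by omega
      exact Nat.eq_of_mul_eq_mul_left hb h7
    rw [digit, digit, pow_add, ← Nat.div_div_eq_div_mul, ← Nat.div_div_eq_div_mul, h2, pow_succ',
      ← Nat.div_div_eq_div_mul, ← Nat.div_div_eq_div_mul, h4]

/-- A loop with an invariant that is indexed by a number that decreases. -/
theorem RunsIn.loop_of_lt {e : Expr} {p : Program} {I : ℕ → Memory → Prop} {T : ℕ}
    (h : ∀ m s, I m s → e.eval s ≠ 0 → ∃ s', RunsIn p s s' T ∧ ∃ m' < m, I m' s') {m : ℕ}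
    {s : Memory} (hs : I m s) : ∃ s', RunsIn (.loop e p) s s' ((m + 1) * (T + e.cost + 1)) ∧
      (∃ m', I m' s') ∧ e.eval s' = 0 := by
  induction m using Nat.strong_induction_on generalizing s with
  | _ m ih =>
    by_cases he : e.eval s = 0
    · refine ⟨s, ⟨e.cost + 1, ?_, .loop_done he⟩, ⟨m, hs⟩, he⟩
      calc e.cost + 1 ≤ 1 * (T + e.cost + 1) := by omega
        _ ≤ _ := Nat.mul_le_mul_right _ (by omega)
    · obtain ⟨s₁, ⟨t₁, ht₁, hr⟩, m', hlt, hI⟩ := h m s hs he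
      obtain ⟨s₂, ⟨t₂, ht₂, hr₂⟩, hI₂, he₂⟩ := ih _ hlt hI
      refine ⟨s₂, ⟨_, ?_, .loop_step he hr hr₂⟩, hI₂, he₂⟩
      have h1 : (m' + 1) * (T + e.cost + 1) ≤ m * (T + e.cost + 1) :=
        Nat.mul_le_mul_right _ (by omega)
      rw [Nat.add_mul]
      omega

/-- Increase the number whose digits are in array `1`; register `2` holds the largest digit. -/
def incrementCode : Program :=
  .seq (.setReg 10 (.const 0)) (.seq (.loop (.sub (.const 1) (.sub (.reg 2) (.arr 1 (.reg 10))))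
      (.seq (.setArr 1 (.reg 10) (.const 0)) (.setReg 10 (.add (.reg 10) (.const 1)))))
    (.setArr 1 (.reg 10) (.add (.arr 1 (.reg 10)) (.const 1))))

theorem runsIn_incrementCode {s : Memory} {b L x : ℕ} (hb : s.reg 2 + 1 = b) (hb' : 2 ≤ b)
    (hx : x < b ^ L) (hd : ∀ i ≤ L, s.arr 1 i = digit b x i) :
    ∃ s', RunsIn incrementCode s s' (15 * (L + 1) + 20) ∧
      ∀ i ≤ L, s'.arr 1 i = digit b (x + 1) i := by
  have hlt : ∀ i, digit b x i < b := fun i => Nat.mod_lt _ (by omega)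
  -- The digit at `L` is 0, which is not maximal as `b ≥ 2`, so the carry stops at `L` at the
  -- latest.
  have hL : digit b x L = 0 := by simp [digit, Nat.div_eq_of_lt hx]
  obtain ⟨s₁, hr₁, ⟨h2, hi, hk, hd₁⟩, hc⟩ :=
    RunsIn.loop_exec (e := .sub (.const 1) (.sub (.reg 2) (.arr 1 (.reg 10))))
    (p := .seq (.setArr 1 (.reg 10) (.const 0)) (.setReg 10 (.add (.reg 10) (.const 1))))
    (by simp [Program.LoopFree])
    (I := fun s' => s'.reg 2 = s.reg 2 ∧ s'.reg 10 ≤ L ∧ (∀ k < s'.reg 10, digit b x k + 1 = b) ∧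
      ∀ k ≤ L, s'.arr 1 k = if k < s'.reg 10 then 0 else digit b x k)
    (V := fun s' => L - s'.reg 10) (by
      rintro s' ⟨h1, h2, h3, h4⟩ he
      have h5 := h4 _ h2
      rw [if_neg (by omega)] at h5
      simp only [Expr.eval, h1, h5] at he
      have h6 := hlt (s'.reg 10)
      have h7 : s'.reg 10 ≠ L := by
        intro e
        rw [e, hL] at he
        omega
      simp only [Program.exec, Expr.eval, Memory.setReg_reg, Memory.setReg_arr, Memory.setArr_reg,
        Memory.setArr_arr, if_true, Function.update_apply]
      refine ⟨⟨by simpa using h1, by omega, ?_, ?_⟩, by omega⟩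
      · intro k hk
        rcases Nat.lt_succ_iff_lt_or_eq.1 hk with hk | rfl
        · exact h3 k hk
        · omega
      · intro k hk
        rw [h4 k hk]
        split_ifs <;> first | rfl | omega)
    (s := s.setReg 10 0) ⟨by simp, by simp, by simp, by simpa using hd⟩
  refine ⟨s₁.setArr 1 (s₁.reg 10) (s₁.arr 1 (s₁.reg 10) + 1), ((runsIn_setReg 10 (.const 0) s).seq
    (hr₁.seq ⟨_, le_rfl, .setArr 1 (.reg 10) (.add (.arr 1 (.reg 10)) (.const 1)) s₁⟩)).mono ?_, ?_⟩
  · simp [Program.time, Expr.cost]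
    omega
  · intro k hkL
    have h5 := hd₁ _ hi
    rw [if_neg (by omega)] at h5
    simp only [Expr.eval, h5, h2] at hc
    have h6 := hlt (s₁.reg 10)
    rw [digit_succ (by omega) hk (by omega)]
    simp only [Memory.setArr_arr, if_true, Function.update_apply, h5, hd₁ k hkL]
    split_ifs <;> first | rfl | omega

end MatchingGap

/-! ### Encoding and checking certificates -/

namespace MatchingGap
open Finset

/-- Compute the deficiency of the graph described by the marks in array `2` in register `20`. -/
def gaugeCode : Program := .seq buildCode deficiencyCode

/-- The running time of `gaugeCode`. -/
def gaugeTime (n : ℕ) : ℕ := buildTime n + deficiencyTime (n + n) (2 * (n * (n + 1) + n))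

theorem deficiencyTime_mono (N : ℕ) {m m' : ℕ} (h : m ≤ m') :
    deficiencyTime N m ≤ deficiencyTime N m' := by
  unfold deficiencyTime improveTime augmentTime testTime
  gcongr

theorem writesFrom_gaugeCode : gaugeCode.WritesFrom 16 3 := by
  simp [gaugeCode, buildCode, pairCode, linkCode, flagCode, pushCode,
    deficiencyCode, fillCode, improveCode, countBody, shrinkCode, shrinkBody, augmentCode,
    markBody, rematchBody, clearCode, Program.WritesFrom, testCode, startCode, verdictCode,
    slotCode, edgeCode, mateCode, enterCode]

/-- The memory holds the constants of the search and the adjacency matrix. -/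
structure IsReady (n : ℕ) (R : ℕ → ℕ → Prop) (s : Memory) : Prop where
  size : s.reg 0 = n
  maxDigit : s.reg 2 = n + n + 1
  base : s.reg 3 = n + n + 2
  adj : ∀ u < n, ∀ v < n, s.arr 0 (u * n + v) ≠ 0 ↔ R u v

variable {n : ℕ} {R : ℕ → ℕ → Prop} {s : Memory}

theorem IsReady.of_agree {s' : Memory} {x a : ℕ} (h : IsReady n R s) (ha : Agree x a s s')
    (hx : 3 < x) (ha' : 0 < a) : IsReady n R s' where
  size := (ha.1 0 (by omega)).trans h.size
  maxDigit := (ha.1 2 (by omega)).trans h.maxDigit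
  base := (ha.1 3 (by omega)).trans h.base
  adj := fun u hu v hv => by rw [ha.2 0 ha']; exact h.adj u hu v hv

/-- With register 15 equal to 0, the `n` copies remain as isolated vertices and add `n` to the
deficiency. -/
theorem runsIn_gaugeCode {S T : ℕ → Prop} (hn : s.reg 0 = n) (hG : IsGraph n R)
    (hR : ∀ u < n, ∀ v < n, s.arr 0 (u * n + v) ≠ 0 ↔ R u v)
    (hS : ∀ u < n, s.arr 2 u ≠ 0 ↔ S u) (hT : ∀ u < n, s.arr 2 (u + n) ≠ 0 ↔ T u) :
    ∃ s', RunsIn gaugeCode s s' (gaugeTime n) ∧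
      (s.reg 15 = 0 → s'.reg 20 = deficiency n (restrictRel R S T) + n) ∧
      (s.reg 15 ≠ 0 → s'.reg 20 = deficiency (n + n) (doubleRel n R S T)) := by
  obtain ⟨s₁, hr₁, e17, e16, hv, h0, h1⟩ := runsIn_buildCode hn hG hR hS hT
  obtain ⟨s₂, hr₂, h20⟩ := runsIn_deficiencyCode hv
  refine ⟨s₂, (hr₁.seq hr₂).mono (Nat.add_le_add_left ?_ _), fun h => ?_, fun h => ?_⟩
  · rw [e17]
    exact deficiencyTime_mono _ e16
  · rw [h20, h0 h, e17, deficiency_add (hG.restrict S T)]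
  · rw [h20, h1 h, e17]

/-- The vertices marked as deleted by the digits of `x`. -/
def markS (n L x v : ℕ) : Prop := v < n ∧ ∃ i < L, digit (n + n + 2) x i = v

/-- The vertices marked as separated by the digits of `x`. -/
def markT (n L x v : ℕ) : Prop := v < n ∧ ∃ i < L, digit (n + n + 2) x i = v + n

/-- The digits of `x` describe a certificate for the matching gap being at least `j`. -/
def Certifies (n : ℕ) (R : ℕ → ℕ → Prop) (j L x : ℕ) : Prop :=
  deficiency n R + 2 * j ≤ deficiency n (restrictRel R (markS n L x) (markT n L x)) ∧
    deficiency (n + n) (doubleRel n R (markS n L x) (markT n L x)) = 0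

theorem exists_certifies_iff (G : SimpleGraph (Fin n)) (j : ℕ) :
    (∃ x < (n + n + 2) ^ (8 * j), Certifies n (natRel G) j (8 * j) x) ↔ j ≤ matchingGap G := by
  constructor
  · rintro ⟨x, _, h1, h2⟩
    -- Any certificate proves the gap, whatever its size; the bound 8j matters only for finding one.
    exact (le_matchingGap_iff G j).2 (exists_maximalMate_of_certificate (isGraph_natRel G) h1 h2)
  · intro h
    obtain ⟨S, T, hS, hT, hc, h1, h2⟩ := (le_matchingGap_iff_certificate G j).1 h
    set l := (S ∪ T.image (· + n)).toList with hl
    have hlen : l.length ≤ 8 * j := by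
      rw [hl, length_toList]
      exact ((card_union_le _ _).trans (Nat.add_le_add_left card_image_le _)).trans hc
    have hmem : ∀ v, v ∈ l ↔ v ∈ S ∨ ∃ w ∈ T, w + n = v := by
      intro v
      rw [hl, mem_toList, mem_union, mem_image]
    -- A digit `v < n` puts `v` into `S`, a digit `v + n` puts `v` into `T`, and `2n` is padding
    -- that marks nothing. The base `2n + 2` is at least 2 even when `n = 0`.
    obtain ⟨x, hx, hd⟩ := exists_digit_eq (b := n + n + 2) (L := 8 * j)
      (d := fun i => (l[i]?).getD (n + n)) (by
        intro i _
        by_cases hi : i < l.length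
        · rw [List.getElem?_eq_getElem hi]
          rcases (hmem _).1 (List.getElem_mem hi) with h | ⟨w, hw, h⟩
          · have := mem_range.1 (hS h)
            simp only [Option.getD_some]
            omega
          · have := mem_range.1 (hT hw)
            simp only [Option.getD_some]
            omega
        · rw [List.getElem?_eq_none (by omega)]
          simp)
    have key : ∀ v < n + n, (∃ i < 8 * j, digit (n + n + 2) x i = v) ↔ v ∈ l := by
      intro v hv
      constructor
      · rintro ⟨i, hi, e⟩
        rw [hd i hi] at e
        by_cases hil : i < l.length
        · rw [List.getElem?_eq_getElem hil, Option.getD_some] at e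
          exact e ▸ List.getElem_mem hil
        · rw [List.getElem?_eq_none (by omega), Option.getD_none] at e
          omega
      · intro hvl
        obtain ⟨i, hil, e⟩ := List.mem_iff_getElem.1 hvl
        refine ⟨i, by omega, ?_⟩
        rw [hd i (by omega)]
        simp [List.getElem?_eq_getElem hil, e]
    have eS : markS n (8 * j) x = (· ∈ S) := by
      funext v
      apply propext
      constructor
      · rintro ⟨hv, h⟩
        rcases (hmem v).1 ((key v (by omega)).1 h) with h | ⟨w, _, h⟩
        · exact h
        · omega
      · intro h
        have hv := mem_range.1 (hS h)
        exact ⟨hv, (key v (by omega)).2 ((hmem v).2 (.inl h))⟩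
    have eT : markT n (8 * j) x = (· ∈ T) := by
      funext v
      apply propext
      constructor
      · rintro ⟨hv, h⟩
        rcases (hmem _).1 ((key (v + n) (by omega)).1 h) with h | ⟨w, hw, h⟩
        · have := mem_range.1 (hS h)
          omega
        · have e : w = v := by omega
          exact e ▸ hw
      · intro h
        have hv := mem_range.1 (hT h)
        exact ⟨hv, (key (v + n) (by omega)).2 ((hmem _).2 (.inr ⟨v, h, rfl⟩))⟩
    refine ⟨x, hx, ?_⟩
    rw [Certifies, eS, eT]
    exact ⟨h1, h2⟩

/-- Mark the values of the digits in array `1` in array `2`. -/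
def decodeCode : Program :=
  .seq (clearCode 2 3 10) (.seq (.setReg 10 (.const 0)) (.loop (.sub (.reg 6) (.reg 10))
    (.seq (.setArr 2 (.arr 1 (.reg 10)) (.const 1)) (.setReg 10 (.add (.reg 10) (.const 1))))))

theorem runsIn_decodeCode (s : Memory) : ∃ s', RunsIn decodeCode s s'
    (11 * s.reg 3 + 20 * (s.reg 6 + 1) + 20) ∧
    ∀ v < s.reg 3, s'.arr 2 v ≠ 0 ↔ ∃ i < s.reg 6, s.arr 1 i = v := by
  obtain ⟨s₁, hr₁, h0⟩ := runsIn_clearCode (a := 2) (b := 3) (i := 10) (by norm_num) s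
  have a₁ : Agree 10 2 s s₁ := hr₁.agree (by simp [clearCode, Program.WritesFrom])
  obtain ⟨s₂, hr₂, ⟨a₂, hi, h⟩, hc⟩ := RunsIn.loop_exec (e := .sub (.reg 6) (.reg 10))
    (p := .seq (.setArr 2 (.arr 1 (.reg 10)) (.const 1)) (.setReg 10 (.add (.reg 10) (.const 1))))
    (by simp [Program.LoopFree])
    (I := fun s' => Agree 10 2 s s' ∧ s'.reg 10 ≤ s.reg 6 ∧
      ∀ v < s.reg 3, s'.arr 2 v ≠ 0 ↔ ∃ i < s'.reg 10, s.arr 1 i = v)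
    (V := fun s' => s.reg 6 - s'.reg 10) (by
      rintro s' ⟨h1, h2, h3⟩ he
      simp only [Expr.eval, h1.1 6 (by norm_num)] at he
      refine ⟨⟨h1.trans (Program.agree_exec (by simp [Program.LoopFree])
        (by simp [Program.WritesFrom]) s'), ?_, ?_⟩, ?_⟩
      · simp [Program.exec, Expr.eval]
        omega
      · intro v hv
        simp only [Program.exec, Expr.eval, Memory.setReg_reg, Memory.setReg_arr, Memory.setArr_reg,
          Memory.setArr_arr, if_true, Function.update_apply, h1.2 1 (by norm_num)]
        split_ifs with e
        · simp only [ne_eq, one_ne_zero, not_false_eq_true, true_iff]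
          exact ⟨_, Nat.lt_succ_self _, e.symm⟩
        · rw [h3 v hv]
          constructor
          · rintro ⟨i, hi, h⟩
            exact ⟨i, by omega, h⟩
          · rintro ⟨i, hi, rfl⟩
            rcases Nat.lt_succ_iff_lt_or_eq.1 hi with hi | rfl
            · exact ⟨i, hi, rfl⟩
            · exact absurd rfl e
      · simp [Program.exec, Expr.eval]
        omega)
    (s := s₁.setReg 10 0) ⟨a₁.trans (Agree.setReg _ _ le_rfl), by simp, fun v hv => by
      simp [h0 v hv]⟩
  simp only [Expr.eval, a₂.1 6 (by norm_num)] at hc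
  have e : s₂.reg 10 = s.reg 6 := by omega
  rw [e] at h
  refine ⟨s₂, (hr₁.seq ((runsIn_setReg 10 (.const 0) s₁).seq hr₂)).mono ?_, h⟩
  simp [Program.time, Expr.cost]
  omega

/-- Set register `9` to `1` if the digits in array `1` describe a certificate. -/
def checkCode : Program :=
  .seq decodeCode (.seq (.setReg 15 (.const 0)) (.seq gaugeCode (.ite (.sub (.reg 5) (.reg 20)) .skip
    (.seq (.setReg 15 (.const 1)) (.seq gaugeCode (.ite (.reg 20) .skip (.setReg 9 (.const 1))))))))

/-- The running time of `checkCode` for `L` digits. -/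
def checkTime (n L : ℕ) : ℕ := 11 * (n + n + 2) + 20 * (L + 1) + 2 * gaugeTime n + 40

theorem writesFrom_checkCode : checkCode.WritesFrom 9 2 := by
  simp [checkCode, decodeCode, gaugeCode, buildCode, pairCode, linkCode, flagCode, pushCode,
    deficiencyCode, fillCode, improveCode, countBody, shrinkCode, shrinkBody, augmentCode,
    markBody, rematchBody, clearCode, Program.WritesFrom, testCode, startCode, verdictCode,
    slotCode, edgeCode, mateCode, enterCode]

-- The target in register 5 contains the same additional `n` as the computed deficiency, so the
-- truncated difference vanishes exactly when the first condition of `Certifies` holds. The second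
-- is checked only then.
open Classical in
theorem runsIn_checkCode {j x : ℕ} (h : IsReady n R s) (hG : IsGraph n R)
    (hd : ∀ i < s.reg 6, s.arr 1 i = digit (n + n + 2) x i)
    (ht : s.reg 5 = deficiency n R + n + 2 * j) :
    ∃ s', RunsIn checkCode s s' (checkTime n (s.reg 6)) ∧
      s'.reg 9 = if Certifies n R j (s.reg 6) x then 1 else s.reg 9 := by
  obtain ⟨s₁, hr₁, hm⟩ := runsIn_decodeCode s
  have a₁ : Agree 10 2 s s₁ := hr₁.agree (by simp [decodeCode, clearCode, Program.WritesFrom])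
  have hb := h.base
  have hd' : ∀ v, (∃ i < s.reg 6, s.arr 1 i = v) ↔ ∃ i < s.reg 6, digit (n + n + 2) x i = v :=
    fun v => ⟨fun ⟨i, hi, e⟩ => ⟨i, hi, by rw [← hd i hi, e]⟩,
      fun ⟨i, hi, e⟩ => ⟨i, hi, by rw [hd i hi, e]⟩⟩
  have hS : ∀ u < n, s₁.arr 2 u ≠ 0 ↔ markS n (s.reg 6) x u := fun u hu => by
    rw [hm u (by omega), hd', markS]
    simp [hu]
  have hT : ∀ u < n, s₁.arr 2 (u + n) ≠ 0 ↔ markT n (s.reg 6) x u := fun u hu => by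
    rw [hm (u + n) (by omega), hd', markT]
    simp [hu]
  have r₁ : IsReady n R s₁ := h.of_agree a₁ (by norm_num) (by norm_num)
  obtain ⟨s₂, hr₂, h20, -⟩ := runsIn_gaugeCode (s := s₁.setReg 15 0) r₁.size hG r₁.adj hS hT
  replace h20 := h20 (by simp)
  have a₂ : Agree 15 3 s₁ s₂ := (Agree.setReg (y := 15) s₁ 0 le_rfl).trans
    ((hr₂.agree writesFrom_gaugeCode).mono (by norm_num) le_rfl)
  have e5 : s₂.reg 5 = s.reg 5 := (a₂.1 5 (by norm_num)).trans (a₁.1 5 (by norm_num))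
  have e9 : s₂.reg 9 = s.reg 9 := (a₂.1 9 (by norm_num)).trans (a₁.1 9 (by norm_num))
  have q₂ := runsIn_setReg 15 (.const 0) s₁
  by_cases hc : s₂.reg 5 - s₂.reg 20 = 0
  · have r₂ : IsReady n R s₂ := r₁.of_agree a₂ (by norm_num) (by norm_num)
    obtain ⟨s₃, hr₃, -, h20'⟩ := runsIn_gaugeCode (s := s₂.setReg 15 1)
      (S := markS n (s.reg 6) x) (T := markT n (s.reg 6) x) r₂.size hG r₂.adj
      (fun u hu => by rw [← hS u hu]; simp [a₂.2 2 (by norm_num)])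
      (fun u hu => by rw [← hT u hu]; simp [a₂.2 2 (by norm_num)])
    replace h20' := h20' (by simp)
    have a₃ : Agree 15 3 s₂ s₃ := (Agree.setReg (y := 15) s₂ 1 le_rfl).trans
      ((hr₃.agree writesFrom_gaugeCode).mono (by norm_num) le_rfl)
    have e9' : s₃.reg 9 = s.reg 9 := (a₃.1 9 (by norm_num)).trans e9
    have q₃ := runsIn_setReg 15 (.const 1) s₂
    by_cases h0 : s₃.reg 20 = 0
    · refine ⟨s₃.setReg 9 1, (hr₁.seq (q₂.seq (hr₂.seq
        (RunsIn.ite_false (e := .sub (.reg 5) (.reg 20)) hc (q₃.seq (hr₃.seq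
          (RunsIn.ite_false (e := .reg 20) h0 (runsIn_setReg 9 (.const 1) s₃)))))))).mono ?_, ?_⟩
      · simp only [Expr.cost, checkTime, hb]
        omega
      · rw [if_pos ⟨by omega, by omega⟩]
        simp
    · refine ⟨s₃, (hr₁.seq (q₂.seq (hr₂.seq
        (RunsIn.ite_false (e := .sub (.reg 5) (.reg 20)) hc (q₃.seq (hr₃.seq
          (RunsIn.ite_true (e := .reg 20) h0 ⟨1, le_rfl, .skip s₃⟩))))))).mono ?_, ?_⟩
      · simp only [Expr.cost, checkTime, hb]
        omega
      · rw [if_neg (fun h => by have := h.2; omega), e9']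
  · refine ⟨s₂, (hr₁.seq (q₂.seq (hr₂.seq
        (RunsIn.ite_true (e := .sub (.reg 5) (.reg 20)) hc ⟨1, le_rfl, .skip s₂⟩)))).mono ?_, ?_⟩
    · simp only [Expr.cost, checkTime, hb]
      omega
    · rw [if_neg (fun h => by have := h.1; omega), e9]

end MatchingGap

/-! ### Exhaustive search, level by level -/

namespace MatchingGap
open Finset

/-- Check all digit vectors. -/
def enumerateCode : Program :=
  .loop (.sub (.const 1) (.arr 1 (.reg 6))) (.seq checkCode incrementCode)

/-- The running time of `enumerateCode`. -/
def enumerateTime (n L : ℕ) : ℕ :=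
  ((n + n + 2) ^ L + 1) * (checkTime n L + 15 * (L + 1) + 30)

variable {n : ℕ} {R : ℕ → ℕ → Prop} {s : Memory}

-- Digit `L` is an overflow flag: it is 0 while `x < (2n + 2) ^ L` and becomes 1 at equality, so it
-- alone tells when all vectors have been checked. The index `m` of the invariant counts the vectors
-- left.
open Classical in
theorem runsIn_enumerateCode {j L : ℕ} (h : IsReady n R s) (hG : IsGraph n R) (hL : s.reg 6 = L)
    (hd : ∀ i ≤ L, s.arr 1 i = 0) (ht : s.reg 5 = deficiency n R + n + 2 * j) (h9 : s.reg 9 = 0) :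
    ∃ s', RunsIn enumerateCode s s' (enumerateTime n L) ∧ Agree 9 1 s s' ∧
      s'.reg 9 = if ∃ x < (n + n + 2) ^ L, Certifies n R j L x then 1 else 0 := by
  obtain ⟨s', hr, ⟨m, ha, x, hmx, hd', h9'⟩, hc⟩ :=
    RunsIn.loop_of_lt (e := .sub (.const 1) (.arr 1 (.reg 6)))
    (p := .seq checkCode incrementCode) (T := checkTime n L + (15 * (L + 1) + 20))
    (I := fun m s' => Agree 9 1 s s' ∧ ∃ x, m + x = (n + n + 2) ^ L ∧
      (∀ i ≤ L, s'.arr 1 i = digit (n + n + 2) x i) ∧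
      s'.reg 9 = if ∃ y < x, Certifies n R j L y then 1 else 0) (by
      rintro m s' ⟨ha, x, hmx, hd', h9'⟩ he
      have e6 : s'.reg 6 = L := (ha.1 6 (by norm_num)).trans hL
      simp only [Expr.eval, e6, hd' L le_rfl] at he
      have hx : x < (n + n + 2) ^ L := by
        by_contra hx
        have e : x = (n + n + 2) ^ L := by omega
        rw [e, digit, Nat.div_self (by positivity), Nat.mod_eq_of_lt (by omega)] at he
        omega
      obtain ⟨s₁, hr₁, h9₁⟩ := runsIn_checkCode (j := j) (x := x)
        (h.of_agree ha (by norm_num) (by norm_num)) hG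
        (fun i hi => hd' i (by omega)) ((ha.1 5 (by norm_num)).trans ht)
      have a₁ := hr₁.agree writesFrom_checkCode
      rw [e6] at hr₁ h9₁
      obtain ⟨s₂, hr₂, hd₂⟩ := runsIn_incrementCode (s := s₁) (b := n + n + 2) (L := L) (x := x)
        (by rw [a₁.1 2 (by norm_num), ha.1 2 (by norm_num), h.maxDigit]) (by omega) hx
        (fun i hi => by rw [a₁.2 1 (by norm_num), hd' i hi])
      have a₂ : Agree 10 1 s₁ s₂ := hr₂.agree (by simp [incrementCode, Program.WritesFrom])
      refine ⟨s₂, hr₁.seq hr₂, m - 1, by omega, ?_, x + 1, by omega, hd₂, ?_⟩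
      · exact (ha.trans (a₁.mono le_rfl (by norm_num))).trans (a₂.mono (by norm_num) le_rfl)
      · rw [a₂.1 9 (by norm_num), h9₁, h9']
        have hsucc : (∃ y < x + 1, Certifies n R j L y) ↔
            Certifies n R j L x ∨ ∃ y < x, Certifies n R j L y := by
          constructor
          · rintro ⟨y, hy, h⟩
            rcases Nat.lt_succ_iff_lt_or_eq.1 hy with hy | rfl
            · exact .inr ⟨y, hy, h⟩
            · exact .inl h
          · rintro (h | ⟨y, hy, h⟩)
            · exact ⟨x, by omega, h⟩
            · exact ⟨y, by omega, h⟩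
        by_cases h1 : Certifies n R j L x <;> by_cases h2 : ∃ y < x, Certifies n R j L y <;>
          simp only [hsucc, h1, h2, if_true, if_false, or_true, or_false])
    (m := (n + n + 2) ^ L) (s := s) ⟨Agree.refl _ _ _, 0, rfl, by simpa [digit] using hd, by simpa using h9⟩
  have e6 : s'.reg 6 = L := (ha.1 6 (by norm_num)).trans hL
  simp only [Expr.eval, e6, hd' L le_rfl] at hc
  have hx : x = (n + n + 2) ^ L := by
    by_contra hx
    rw [digit, Nat.div_eq_of_lt (by omega)] at hc
    simp at hc
  refine ⟨s', hr.mono ?_, ha, ?_⟩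
  · simp only [enumerateTime, Expr.cost]
    exact Nat.mul_le_mul le_rfl (by omega)
  · rw [h9', hx]

/-- Decide whether the matching gap exceeds the number in register `4`, and increase that number. -/
def levelCode : Program :=
  .seq (.setReg 9 (.const 0)) (.seq (.setReg 6 (.add (.reg 6) (.const 8)))
    (.seq (.setReg 7 (.add (.reg 6) (.const 1))) (.seq (.setReg 5 (.add (.reg 5) (.const 2)))
    (.seq (clearCode 1 7 10) (.seq enumerateCode (.setReg 4 (.add (.reg 4) (.const 1))))))))

/-- The running time of `levelCode`. -/
def levelTime (n L : ℕ) : ℕ := 11 * (L + 1) + 40 + enumerateTime n L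

theorem levelTime_mono (n : ℕ) {L L' : ℕ} (h : L ≤ L') : levelTime n L ≤ levelTime n L' := by
  unfold levelTime enumerateTime checkTime
  have h2 : 1 ≤ n + n + 2 := by omega
  gcongr

/-- The state of the main loop: the matching gap is at least the number in register `4`, as long
as register `9` is not `0`. -/
structure IsMain (G : SimpleGraph (Fin n)) (k : ℕ) (s : Memory) : Prop where
  ready : IsReady n (natRel G) s
  bound : s.reg 1 = k
  target : s.reg 5 = deficiency n (natRel G) + n + 2 * s.reg 4
  digits : s.reg 6 = 8 * s.reg 4
  le : s.reg 4 ≤ k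
  yes_or_no : (s.reg 9 = 1 ∧ s.reg 4 ≤ matchingGap G) ∨
    (s.reg 9 = 0 ∧ s.reg 4 = matchingGap G + 1)

/-- By `exists_certifies_iff`, the enumeration for j + 1 leaves in register 9 the answer to whether
the gap is at least j + 1. One cell beyond the 8(j + 1) digits is cleared for the overflow. -/
theorem IsMain.level {G : SimpleGraph (Fin n)} {k : ℕ} (h : IsMain G k s) (hk : s.reg 4 < k)
    (hμ : s.reg 4 ≤ matchingGap G) :
    ∃ s', RunsIn levelCode s s' (levelTime n (8 * (s.reg 4 + 1))) ∧ IsMain G k s' ∧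
      s'.reg 4 = s.reg 4 + 1 := by
  set j := s.reg 4 with hj
  set s₁ := (((s.setReg 9 0).setReg 6 (s.reg 6 + 8)).setReg 7 (s.reg 6 + 8 + 1)).setReg 5
    (s.reg 5 + 2) with hs₁
  have q₁ := runsIn_setReg 9 (.const 0) s
  have q₂ := runsIn_setReg 6 (.add (.reg 6) (.const 8)) (s.setReg 9 0)
  have q₃ := runsIn_setReg 7 (.add (.reg 6) (.const 1)) ((s.setReg 9 0).setReg 6 (s.reg 6 + 8))
  have q₄ := runsIn_setReg 5 (.add (.reg 5) (.const 2))
    (((s.setReg 9 0).setReg 6 (s.reg 6 + 8)).setReg 7 (s.reg 6 + 8 + 1))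
  have a₁ : Agree 4 1 s s₁ := (((Agree.setReg _ _ (by norm_num)).trans
    (Agree.setReg _ _ (by norm_num))).trans (Agree.setReg _ _ (by norm_num))).trans
    (Agree.setReg _ _ (by norm_num))
  obtain ⟨s₂, hr₂, h0⟩ := runsIn_clearCode (a := 1) (b := 7) (i := 10) (by norm_num) s₁
  have a₂ : Agree 10 1 s₁ s₂ := hr₂.agree (by simp [clearCode, Program.WritesFrom])
  have e7 : s₁.reg 7 = 8 * (j + 1) + 1 := by simp [hs₁, h.digits, hj]; omega
  rw [e7] at hr₂ h0
  have r₂ : IsReady n (natRel G) s₂ :=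
    (h.ready.of_agree a₁ (by norm_num) (by norm_num)).of_agree a₂ (by norm_num) (by norm_num)
  have e6 : s₂.reg 6 = 8 * (j + 1) := by
    rw [a₂.1 6 (by norm_num)]; simp [hs₁, h.digits, hj]; omega
  have e5 : s₂.reg 5 = deficiency n (natRel G) + n + 2 * (j + 1) := by
    rw [a₂.1 5 (by norm_num)]; simp [hs₁, h.target, hj]; omega
  obtain ⟨s₃, hr₃, a₃, h9⟩ := runsIn_enumerateCode (j := j + 1) r₂ (isGraph_natRel G) e6
    (fun i hi => h0 i (by omega)) e5 (by rw [a₂.1 9 (by norm_num)]; simp [hs₁])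
  have e4 : s₃.reg 4 = j := by
    rw [a₃.1 4 (by norm_num), a₂.1 4 (by norm_num)]; simp [hs₁, hj]
  have q₅ := runsIn_setReg 4 (.add (.reg 4) (.const 1)) s₃
  refine ⟨s₃.setReg 4 (s₃.reg 4 + 1),
    (q₁.seq (q₂.seq (q₃.seq (q₄.seq (hr₂.seq (hr₃.seq q₅)))))).mono ?_, ?_, by simp [e4]⟩
  · simp only [Expr.cost, levelTime]
    omega
  · refine ⟨?_, ?_, ?_, ?_, ?_, ?_⟩
    · exact (r₂.of_agree a₃ (by norm_num) (by norm_num)).of_agree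
        (Agree.setReg (x := 4) (a := 1) s₃ _ le_rfl) (by norm_num) (by norm_num)
    · simp [a₃.1 1, a₂.1 1, a₁.1 1, h.bound]
    · simp [a₃.1 5, e5, e4]
    · simp [a₃.1 6, e6, e4]
    · simpa [e4] using hk
    · simp only [Memory.setReg_reg, Nat.reduceEqDiff, if_true, if_false, e4, h9, exists_certifies_iff]
      by_cases hle : j + 1 ≤ matchingGap G
      · simp [hle]
      · simp [hle]
        omega

/-- Decide `MatchingGap`. -/
def gapCode : Program :=
  .seq (.setReg 2 (.add (.add (.reg 0) (.reg 0)) (.const 1)))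
    (.seq (.setReg 3 (.add (.reg 2) (.const 1))) (.seq gaugeCode (.seq (.setReg 5 (.reg 20))
    (.seq (.setReg 9 (.const 1)) (.seq
      (.loop (.sub (.reg 9) (.sub (.const 1) (.sub (.reg 1) (.reg 4)))) levelCode)
      (.setReg 0 (.reg 9)))))))

theorem restrictRel_false (R : ℕ → ℕ → Prop) :
    restrictRel R (fun _ => False) (fun _ => False) = R := by
  funext u v
  simp [restrictRel]

theorem inputMemory_arr (G : SimpleGraph (Fin n)) (k : ℕ) {u v : ℕ} (hu : u < n) (hv : v < n) :
    (inputMemory G k).arr 0 (u * n + v) ≠ 0 ↔ natRel G u v := by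
  have : (∃ i j : Fin n, u * n + v = i * n + j ∧ G.Adj i j) ↔ natRel G u v := by
    constructor
    · rintro ⟨i, j, e, h⟩
      have h1 : u = i := by
        have := congrArg (· / n) e
        simpa [Nat.add_div_of_dvd_right, Nat.mul_div_cancel _ (show 0 < n by omega),
          Nat.div_eq_of_lt hv, Nat.div_eq_of_lt j.2] using this
      subst h1
      have h2 : v = j := by omega
      subst h2
      exact ⟨i.2, j.2, h⟩
    · rintro ⟨h1, h2, h⟩
      exact ⟨⟨u, h1⟩, ⟨v, h2⟩, rfl, h⟩
  rw [← this]
  simp [inputMemory]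

/-- The running time of `gapCode` for a graph with matching gap `μ`. -/
def gapTime (n μ : ℕ) : ℕ := gaugeTime n + 30 + (μ + 2) * (levelTime n (8 * (μ + 1)) + 10)

/-- The loop test is nonzero exactly when the last level succeeded and register 4 is below `k`. The
loop thus stops at `k` or after the first failure, which occurs at level μ + 1, so the time depends
on μ and not on `k`. -/
theorem runsIn_gapCode (G : SimpleGraph (Fin n)) (k : ℕ) :
    ∃ s, RunsIn gapCode (inputMemory G k) s (gapTime n (matchingGap G)) ∧
      (k ≤ matchingGap G → s.reg 0 = 1) ∧ (¬ k ≤ matchingGap G → s.reg 0 = 0) := by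
  set s₀ := inputMemory G k with hs₀
  have z0 : s₀.reg 0 = n := by simp [hs₀, inputMemory]
  have z1 : s₀.reg 1 = k := by simp [hs₀, inputMemory]
  have z : ∀ y, 2 ≤ y → s₀.reg y = 0 := fun y hy => by
    simp only [hs₀, inputMemory]
    rw [if_neg (by omega), if_neg (by omega)]
  have z2 : ∀ v, s₀.arr 2 v = 0 := fun v => by simp [hs₀, inputMemory]
  have q₁ := runsIn_setReg 2 (.add (.add (.reg 0) (.reg 0)) (.const 1)) s₀
  simp only [Expr.eval, z0] at q₁
  have q₂ := runsIn_setReg 3 (.add (.reg 2) (.const 1)) (s₀.setReg 2 (n + n + 1))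
  simp only [Expr.eval, Memory.setReg_reg, if_true] at q₂
  set s₁ := (s₀.setReg 2 (n + n + 1)).setReg 3 (n + n + 1 + 1) with hs₁
  have r₁ : IsReady n (natRel G) s₁ :=
    ⟨by simp [hs₁, z0], by simp [hs₁], by simp [hs₁], fun u hu v hv => inputMemory_arr G k hu hv⟩
  obtain ⟨s₂, hr₂, h20, -⟩ := runsIn_gaugeCode (s := s₁) (S := fun _ => False) (T := fun _ => False)
    r₁.size (isGraph_natRel G) r₁.adj (fun u _ => by simp [hs₁, z2]) (fun u _ => by simp [hs₁, z2])
  replace h20 := h20 (by simp [hs₁, z])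
  rw [restrictRel_false] at h20
  have a₂ := hr₂.agree writesFrom_gaugeCode
  have q₃ := runsIn_setReg 5 (.reg 20) s₂
  have q₄ := runsIn_setReg 9 (.const 1) (s₂.setReg 5 (s₂.reg 20))
  have e4 : s₂.reg 4 = 0 := by rw [a₂.1 4 (by norm_num)]; simp [hs₁, z]
  have a₄ : Agree 4 1 s₂ ((s₂.setReg 5 (s₂.reg 20)).setReg 9 1) :=
    (Agree.setReg _ _ (by norm_num)).trans (Agree.setReg _ _ (by norm_num))
  have hI : IsMain G k ((s₂.setReg 5 (s₂.reg 20)).setReg 9 1) := by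
    refine ⟨(r₁.of_agree a₂ (by norm_num) (by norm_num)).of_agree a₄ (by norm_num) (by norm_num),
      ?_, ?_, ?_, ?_, ?_⟩
    · simp [a₂.1 1, hs₁, z1]
    · simp [h20, e4]
    · simp [a₂.1 6, e4, hs₁, z]
    · simp [e4]
    · simp [e4]
  obtain ⟨s₅, hr₅, h₅, hc₅⟩ := RunsIn.loop
    (e := .sub (.reg 9) (.sub (.const 1) (.sub (.reg 1) (.reg 4)))) (p := levelCode)
    (I := IsMain G k) (V := fun s => matchingGap G + 1 - s.reg 4)
    (T := levelTime n (8 * (matchingGap G + 1))) (by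
      intro s h he
      simp only [Expr.eval, h.bound] at he
      have h9 := h.yes_or_no
      obtain ⟨s', hr, h', e⟩ := h.level (by omega) (by omega)
      exact ⟨s', hr.mono (levelTime_mono n (by omega)), h', by omega⟩) hI
  simp only [Expr.eval, h₅.bound] at hc₅
  have q₆ := runsIn_setReg 0 (.reg 9) s₅
  refine ⟨s₅.setReg 0 (s₅.reg 9),
    (q₁.seq (q₂.seq (hr₂.seq (q₃.seq (q₄.seq (hr₅.seq q₆)))))).mono ?_, ?_⟩
  · simp only [Expr.cost, gapTime, Memory.setReg_reg]
    simp [e4]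
    have : (matchingGap G + 1 + 1) * (levelTime n (8 * (matchingGap G + 1)) + 7 + 1) ≤
        (matchingGap G + 2) * (levelTime n (8 * (matchingGap G + 1)) + 10) :=
      Nat.mul_le_mul le_rfl (by omega)
    omega
  · have h9 := h₅.yes_or_no
    have h4 := h₅.le
    simp only [Memory.setReg_reg, if_true]
    constructor <;> intro hk <;> omega

/-! ### Bounds for the running time -/

/-- Functions bounded by a power of the number of vertices. -/
def PolyBounded (f : ℕ → ℕ) : Prop := ∃ c, ∀ n, f n ≤ (max n 2) ^ c

namespace PolyBounded

variable {f g : ℕ → ℕ}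

theorem id : PolyBounded fun n => n := ⟨1, fun _ => by simp⟩

theorem const (a : ℕ) : PolyBounded fun _ => a :=
  ⟨a, fun _ => (Nat.lt_two_pow_self (n := a)).le.trans (Nat.pow_le_pow_left (le_max_right _ _) _)⟩

theorem mul (hf : PolyBounded f) (hg : PolyBounded g) : PolyBounded fun n => f n * g n := by
  obtain ⟨c, hc⟩ := hf
  obtain ⟨d, hd⟩ := hg
  exact ⟨c + d, fun n => by rw [pow_add]; exact Nat.mul_le_mul (hc n) (hd n)⟩

theorem add (hf : PolyBounded f) (hg : PolyBounded g) : PolyBounded fun n => f n + g n := by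
  obtain ⟨c, hc⟩ := hf
  obtain ⟨d, hd⟩ := hg
  refine ⟨c + d + 1, fun n => ?_⟩
  have hz : 2 ≤ max n 2 := le_max_right _ _
  have h1 := (hc n).trans (Nat.pow_le_pow_right (by omega) (show c ≤ c + d by omega))
  have h2 := (hd n).trans (Nat.pow_le_pow_right (by omega) (show d ≤ c + d by omega))
  calc f n + g n ≤ (max n 2) ^ (c + d) * 2 := by omega
    _ ≤ _ := by rw [pow_succ]; exact Nat.mul_le_mul_left _ hz

end PolyBounded

section

open PolyBounded

variable {N m : ℕ → ℕ}

theorem polyBounded_testTime (hN : PolyBounded N) (hm : PolyBounded m) :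
    PolyBounded fun n => testTime (N n) (m n) :=
  ((const 200).mul (hN.add (const 1))).add ((const 200).mul
    ((((hN.mul (hN.add (const 2))).add (const 1)).mul (hm.add (const 1))).add (const 1)))

theorem polyBounded_augmentTime (hN : PolyBounded N) (hm : PolyBounded m) :
    PolyBounded fun n => augmentTime (N n) (m n) :=
  ((const 100).mul (hN.add (const 1))).add ((const 100).mul (hm.add (const 1)))

theorem polyBounded_improveTime (hN : PolyBounded N) (hm : PolyBounded m) :
    PolyBounded fun n => improveTime (N n) (m n) :=
  have ht := polyBounded_testTime hN hm
  (((((const 20).mul (hm.add (const 1))).add ht).add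
    ((hm.add (const 1)).mul (ht.add (const 64)))).add (polyBounded_augmentTime hN hm)).add (const 10)

theorem polyBounded_deficiencyTime (hN : PolyBounded N) (hm : PolyBounded m) :
    PolyBounded fun n => deficiencyTime (N n) (m n) :=
  ((const 100).mul (hN.add (const 1))).add
    ((hN.add (const 2)).mul ((polyBounded_improveTime hN hm).add (const 2)))

theorem polyBounded_gaugeTime : PolyBounded gaugeTime :=
  have hn := (id.mul (id.add (const 1))).add id
  ((const 200).mul (hn.add (const 1))).add
    (polyBounded_deficiencyTime (id.add id) ((const 2).mul hn))

end

theorem add_mul_add_mul_le {P A A' B B' C g m m' : ℕ} (hP : 1 ≤ P) (hA : A' ≤ A)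
    (hB : B' + C ≤ B) (hm : m' ≤ m) :
    g + m' * (B' + (P + 1) * A' + C) ≤ P * (g + m * (B + 2 * A)) := by
  have h1 : (P + 1) * A' ≤ P * (2 * A) := by
    calc _ ≤ (P + P) * A := Nat.mul_le_mul (by omega) hA
      _ = _ := by ring
  have h2 : B ≤ P * B := Nat.le_mul_of_pos_left B hP
  have h3 : g ≤ P * g := Nat.le_mul_of_pos_left _ hP
  calc _ ≤ P * g + m * (P * B + P * (2 * A)) :=
        Nat.add_le_add h3 (Nat.mul_le_mul hm (by omega))
    _ = _ := by ring

/-- The polynomial factor in the running time of `gapCode`, where `g` bounds `gaugeTime`. -/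
def gapFactor (g n : ℕ) : ℕ :=
  g + 30 + (n + 2) * (11 * (8 * (n + 1) + 1) + 50 +
    2 * (11 * (n + n + 2) + 20 * (8 * (n + 1) + 1) + 2 * g + 40 + 15 * (8 * (n + 1) + 1) + 30))

open PolyBounded in
theorem polyBounded_gapFactor {g : ℕ → ℕ} (hg : PolyBounded g) :
    PolyBounded fun n => gapFactor (g n) n :=
  have h8 := (((const 8).mul (id.add (const 1))).add (const 1))
  (hg.add (const 30)).add ((id.add (const 2)).mul ((((const 11).mul h8).add (const 50)).add
    ((const 2).mul ((((((const 11).mul ((id.add id).add (const 2))).add ((const 20).mul h8)).add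
      ((const 2).mul hg)).add (const 40)).add ((const 15).mul h8) |>.add (const 30)))))

/-- Only the number of digit vectors is kept in terms of μ. Everywhere else μ is replaced by `n`,
leaving a polynomial factor. -/
theorem gapTime_le {n μ : ℕ} (hμ : μ ≤ n) :
    gapTime n μ ≤ (n + n + 2) ^ (8 * (μ + 1)) * gapFactor (gaugeTime n) n := by
  have hp : 1 ≤ (n + n + 2) ^ (8 * (μ + 1)) := Nat.one_le_pow _ _ (by omega)
  unfold gapTime levelTime enumerateTime checkTime gapFactor
  generalize gaugeTime n = g
  generalize (n + n + 2) ^ (8 * (μ + 1)) = P at hp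
  exact add_mul_add_mul_le hp (by omega) (by omega) (by omega)

theorem exists_gapTime_le : ∃ c, ∀ n μ, μ ≤ n → gapTime n μ ≤ (max n 2) ^ (c * (μ + 1)) := by
  obtain ⟨c, hc⟩ : PolyBounded fun n => n + n + 2 := (PolyBounded.id.add PolyBounded.id).add
    (PolyBounded.const 2)
  obtain ⟨d, hd⟩ := polyBounded_gapFactor polyBounded_gaugeTime
  -- Here `c` bounds the base `2n + 2`, raised to the power 8(μ + 1), and `d` bounds the polynomial
  -- factor.
  refine ⟨8 * c + d, fun n μ hμ => ?_⟩
  set z := max n 2 with hz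
  have hz1 : 1 ≤ z := by omega
  have h2 : (n + n + 2) ^ (8 * (μ + 1)) ≤ z ^ (8 * c * (μ + 1)) := by
    calc _ ≤ (z ^ c) ^ (8 * (μ + 1)) := Nat.pow_le_pow_left (hc n) _
      _ = _ := by rw [← pow_mul]; ring_nf
  calc gapTime n μ ≤ _ := gapTime_le hμ
    _ ≤ z ^ (8 * c * (μ + 1)) * z ^ d := Nat.mul_le_mul h2 (hd n)
    _ = z ^ (8 * c * (μ + 1) + d) := (pow_add _ _ _).symm
    _ ≤ z ^ ((8 * c + d) * (μ + 1)) := Nat.pow_le_pow_right hz1 (by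
      have : d ≤ d * (μ + 1) := Nat.le_mul_of_pos_right _ (by omega)
      rw [Nat.add_mul]
      omega)

end MatchingGap

theorem mainTheorem10 :
    ∃ (p : MatchingGap.Program) (c : ℕ),
      ∀ (n : ℕ) (G : SimpleGraph (Fin n)) (k : ℕ), ∃ t : ℕ,
        MatchingGap.DecidesMatchingGapIn p G k t ∧
          t ≤ (max n 2) ^ (c * (MatchingGap.matchingGap G + MatchingGap.rho G) ^ 2) := by
  obtain ⟨c, hc⟩ := MatchingGap.exists_gapTime_le
  refine ⟨MatchingGap.gapCode, c, fun n G k => ?_⟩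
  obtain ⟨s, ⟨t, ht, hr⟩, hs⟩ := MatchingGap.runsIn_gapCode G k
  refine ⟨t, ⟨s, hr, hs⟩, ht.trans ((hc n _ (MatchingGap.matchingGap_le G)).trans ?_)⟩
  -- The exponent obtained is linear in μ + 1, and μ + 1 ≤ μ + ρ ≤ (μ + ρ)².
  refine Nat.pow_le_pow_right (by omega) (Nat.mul_le_mul_left _ ?_)
  have h1 := MatchingGap.one_le_rho G
  calc MatchingGap.matchingGap G + 1 ≤ MatchingGap.matchingGap G + MatchingGap.rho G := by omega
    _ ≤ _ := Nat.le_self_pow (by norm_num) _
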